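/- \textbf{Setting.} Let $g\ge 0$ and let $\mathbf C=(\mathbf c_1,\dots,\mathbf c_g)$ be an ordered collection of distinct real numbers. Operators are bounded operators on $\ell^2(\mathbb Z)$ with standard basis $\{e_n\}$, and $Se_n=e_{n+1}$. \emph{GMP matrices.} An operator $A$ is of class $\mathbb A$ (for $\mathbf C$) if there are $\vec p_j=(p^{(j)}_0,\dots,p^{(j)}_g)^T$, $\vec q_j=(q^{(j)}_0,\dots,q^{(j)}_g)^T\in\mathbb R^{g+1}$, $j\in\mathbb Z$, with $p^{(j)}_g>0$, such that $A$ is the self-adjoint block tridiagonal matrix with $(g+1)\times(g+1)$ blocks $$A_{j,j}=(\vec q_j\vec p_j^{\,*})^-+(\vec p_j\vec q_j^{\,*})^++\operatorname{diag}(\mathbf c_1,\dots,\mathbf c_g,0),\qquad A_{j-1,j}=\delta_g\vec p_j^{\,*},\qquad A_{j,j-1}=A_{j-1,j}^*,$$ where $T^-$ is the strictly upper triangular part of $T$, $T^+=T-T^-$, and $\delta_g=(0,\dots,0,1)^T$. It belongs to $\mathrm{GMP}(\mathbf C)$ if moreover, for each $1\le k\le g$, $\mathbf c_k-A$ is invertible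 and $S^{-k}(\mathbf c_k-A)^{-1}S^k$ is of class $\mathbb A$ for some ordered collection of $g$ distinct real points. It is periodic with coefficients $\vec p,\vec q$ if $\vec p_j=\vec p$ and $\vec q_j=\vec q$ for all $j$; these are then uniquely determined by $A$. For a set $E\subset\mathbb R$ put $$A(E,\mathbf C)=\{A\in\mathrm{GMP}(\mathbf C):\ \sigma(A)=E,\ A\text{ is periodic}\}.$$ \emph{Discriminant.} For periodic $A\in\mathrm{GMP}(\mathbf C)$ with coefficients $\vec p,\vec q$, let $\Delta^A$ be the rational function $$\Delta^A(z)=\operatorname{tr}\bigl(\mathfrak a(z,\mathbf c_1;p_0,q_0)\cdots\mathfrak a(z,\mathbf c_g;p_{g-1},q_{g-1})\,\mathfrak a(z;p_g,q_g)\bigr),$$ $$\mathfrak a(z,\mathbf c;p,q)=I-\frac1{\mathbf c-z}\begin{bmatrix}p\\q\end{bmatrix}\begin{bmatrix}p&q\end{bmatrix}\begin{bmatrix}0&-1\\1&0\end{bmatrix},\qquad \mathfrak a(z;p,q)=\begin{bmatrix}0&-p\\ \frac1p&\frac{z-pq}{p}\end{bmatrix}.$$ \emph{The function $\Delta_E$.}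 A finite gap set is a set $E=[\mathbf b_0,\mathbf a_0]\setminus\bigcup_{j=1}^{n}(\mathbf a_j,\mathbf b_j)$ with $n\ge0$ and $\mathbf b_0<\mathbf a_1<\mathbf b_1<\mathbf a_2<\dots<\mathbf b_n<\mathbf a_0$. The Ahlfors function $\Psi$ of $\overline{\mathbb C}\setminus E$ is the function that maximizes $|\lim_{z\to\infty}zf(z)|$ among all analytic $f$ on $\overline{\mathbb C}\setminus E$ with $|f|\le1$ and $f(\infty)=0$, normalized by $\lim_{z\to\infty}z\Psi(z)>0$; $\Delta_E$ is the rational function given by $\Delta_E=\Psi+1/\Psi$ on $\overline{\mathbb C}\setminus E$. \textbf{Lemma.} Let $E$ be a finite gap set and let $A\in\mathrm{GMP}(\mathbf C)$ be periodic. Then the following are equivalent: \begin{itemize} \item[(i)] $A\in A(E,\mathbf C)$; \item[(ii)] $\Delta^A=\Delta_E$ as rational functions; \item[(iii)] no pole of $\Delta^A$ or $\Delta_E$ in $\mathbb C$ lies in $\sigma(A)$, so that both $\Delta^A(A)$ and $\Delta_E(A)$ are defined, and $\Delta^A(A)=\Delta_E(A)$. \end{itemize} -/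

import Mathlib

open Filter Topology

namespace GMP

/-- The Hilbert space `ℓ²(ℤ)`. -/
abbrev Ell2 : Type := lp (fun _ : ℤ => ℂ) 2

/-- Bounded operators on `ℓ²(ℤ)`. -/
abbrev Op : Type := Ell2 →L[ℂ] Ell2

/-- The matrix `⟨T eₙ, eₘ⟩` of a bounded operator in the standard basis of `ℓ²(ℤ)`. -/
noncomputable def toMatrix (T : Op) : Matrix ℤ ℤ ℂ :=
  fun m n => (T (lp.single 2 n (1 : ℂ)) : ℤ → ℂ) m

/-- The matrix of `S⁻ᵏ M Sᵏ`, where `S eₙ = eₙ₊₁` is the right shift on `ℓ²(ℤ)`: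
its entries are `⟨M eₙ₊ₖ, eₘ₊ₖ⟩`. -/
def shiftConj (k : ℤ) (M : Matrix ℤ ℤ ℂ) : Matrix ℤ ℤ ℂ :=
  M.submatrix (fun m => m + k) (fun n => n + k)

/-- The `(i, j)` block of size `d × d` of a two-sided infinite matrix. -/
def block (d : ℕ) (M : Matrix ℤ ℤ ℂ) (i j : ℤ) : Matrix (Fin d) (Fin d) ℂ :=
  fun m n => M (d * i + (m : ℕ)) (d * j + (n : ℕ))

/-- The upper triangular part of a matrix, without the main diagonal. -/
def upperPart {d : ℕ} (T : Matrix (Fin d) (Fin d) ℝ) : Matrix (Fin d) (Fin d) ℝ :=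
  fun m n => if m < n then T m n else 0

/-- The lower triangular part of a matrix, with the main diagonal. -/
def lowerPart {d : ℕ} (T : Matrix (Fin d) (Fin d) ℝ) : Matrix (Fin d) (Fin d) ℝ :=
  T - upperPart T

/-- The off-diagonal block `δ_g p*`: its last row is `p`, its other rows vanish. -/
def offBlock {g : ℕ} (p : Fin (g + 1) → ℝ) : Matrix (Fin (g + 1)) (Fin (g + 1)) ℝ :=
  Matrix.vecMulVec (Pi.single (Fin.last g) 1) p

/-- The diagonal block `(q p*)⁻ + (p q*)⁺ + diag(c₁, …, c_g, 0)`. -/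
def diagBlock {g : ℕ} (c : Fin g → ℝ) (p q : Fin (g + 1) → ℝ) :
    Matrix (Fin (g + 1)) (Fin (g + 1)) ℝ :=
  upperPart (Matrix.vecMulVec q p) + lowerPart (Matrix.vecMulVec p q) +
    Matrix.diagonal (Fin.snoc (α := fun _ => ℝ) c 0)

/-- `M` belongs to the class `𝔸` for the points `c`, with generating coefficient sequences
`(pⱼ, qⱼ)`, `j ∈ ℤ`. -/
structure HasCoeffs {g : ℕ} (c : Fin g → ℝ) (p q : ℤ → Fin (g + 1) → ℝ)
    (M : Matrix ℤ ℤ ℂ) : Prop where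
  pos : ∀ j, 0 < p j (Fin.last g)
  diag : ∀ j, block (g + 1) M j j = (diagBlock c (p j) (q j)).map (fun x => (x : ℂ))
  upper : ∀ j, block (g + 1) M (j - 1) j = (offBlock (p j)).map (fun x => (x : ℂ))
  lower : ∀ j, block (g + 1) M j (j - 1) =
    (offBlock (p j)).transpose.map (fun x => (x : ℂ))
  far : ∀ i j, 1 < |i - j| → block (g + 1) M i j = 0

/-- The class `𝔸` for the ordered collection of points `c`. -/
def ClassA {g : ℕ} (c : Fin g → ℝ) (M : Matrix ℤ ℤ ℂ) : Prop :=
  ∃ p q : ℤ → Fin (g + 1) → ℝ, HasCoeffs c p q M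

/-- The class `GMP(C)`. The index `k : Fin g` stands for the `(k + 1)`-st point of `C`. The
conjugated resolvents belong to the class `𝔸` of an ordered collection of `g` distinct points;
comparing entries, it is the cyclically ordered collection of the images of
`c_{k+1}, …, c_g, ∞, c_1, …, c_{k-1}` under `z ↦ 1 / (c_k - z)`. -/
structure IsGMP {g : ℕ} (c : Fin g → ℝ) (A : Op) : Prop where
  classA : ClassA c (toMatrix A)
  isUnit : ∀ k, IsUnit (algebraMap ℂ Op (c k : ℂ) - A)
  resolvent : ∀ k : Fin g, ∃ c' : Fin g → ℝ, Function.Injective c' ∧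
    ClassA c' (shiftConj ((k : ℕ) + 1)
      (toMatrix (Ring.inverse (algebraMap ℂ Op (c k : ℂ) - A))))

/-- `A` is (one-block) periodic with generating coefficients `p`, `q`. -/
def IsPeriodicWith {g : ℕ} (c : Fin g → ℝ) (p q : Fin (g + 1) → ℝ) (A : Op) : Prop :=
  HasCoeffs c (fun _ => p) (fun _ => q) (toMatrix A)

/-- The isospectral torus `A(E, C)`. -/
def isospectralTorus {g : ℕ} (E : Set ℝ) (c : Fin g → ℝ) : Set Op :=
  {A | IsGMP c A ∧ spectrum ℂ A = (fun x : ℝ => (x : ℂ)) '' E ∧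
    ∃ p q : Fin (g + 1) → ℝ, IsPeriodicWith c p q A}

/-- The matrix `𝔧`. -/
noncomputable def jMat : Matrix (Fin 2) (Fin 2) (RatFunc ℂ) := !![0, -1; 1, 0]

/-- The factor `𝔞(z; p, q) = 𝔞(z, ∞; p, q)`. -/
noncomputable def factorInf (p q : ℝ) : Matrix (Fin 2) (Fin 2) (RatFunc ℂ) :=
  !![0, -RatFunc.C (p : ℂ);
    1 / RatFunc.C (p : ℂ), (RatFunc.X - RatFunc.C ((p * q : ℝ) : ℂ)) / RatFunc.C (p : ℂ)]

/-- The factor `𝔞(z, c; p, q) = I - (c - z)⁻¹ (p, q)ᵀ (p, q) 𝔧`. -/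
noncomputable def factor (c p q : ℝ) : Matrix (Fin 2) (Fin 2) (RatFunc ℂ) :=
  1 - (1 / (RatFunc.C (c : ℂ) - RatFunc.X)) •
    (Matrix.vecMulVec ![RatFunc.C (p : ℂ), RatFunc.C (q : ℂ)]
      ![RatFunc.C (p : ℂ), RatFunc.C (q : ℂ)] * jMat)

/-- The transfer matrix
`𝔞(z, c₁; p₀, q₀) 𝔞(z, c₂; p₁, q₁) ⋯ 𝔞(z, c_g; p_{g-1}, q_{g-1}) 𝔞(z; p_g, q_g)`. -/
noncomputable def transferMatrix {g : ℕ} (c : Fin g → ℝ) (p q : Fin (g + 1) → ℝ) :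
    Matrix (Fin 2) (Fin 2) (RatFunc ℂ) :=
  (List.ofFn fun k : Fin g => factor (c k) (p k.castSucc) (q k.castSucc)).prod *
    factorInf (p (Fin.last g)) (q (Fin.last g))

/-- The discriminant `Δ^A`, the trace of the transfer matrix. -/
noncomputable def discriminant {g : ℕ} (c : Fin g → ℝ) (p q : Fin (g + 1) → ℝ) : RatFunc ℂ :=
  (transferMatrix c p q).trace

/-- `f` can be evaluated at the operator `T`: its reduced denominator is invertible at `T`
(that is, no pole of `f` lies in the spectrum of `T`). -/
def IsDefinedAt (f : RatFunc ℂ) (T : Op) : Prop :=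
  IsUnit (Polynomial.aeval T f.denom)

/-- The operator `f(T)` for a rational function `f` which is defined at `T`. -/
noncomputable def evalOp (f : RatFunc ℂ) (T : Op) : Op :=
  Polynomial.aeval T f.num * Ring.inverse (Polynomial.aeval T f.denom)

/-- `E = [b₀, a₀] \ ⋃_{j=1}^n (aⱼ, bⱼ)` is a finite gap set: the gaps are non-empty and ordered,
and the gaps and the exterior of `[b₀, a₀]` have pairwise disjoint closures. -/
def IsFiniteGapSet (E : Set ℝ) : Prop :=
  ∃ (n : ℕ) (a b : Fin (n + 1) → ℝ),
    b 0 < a 0 ∧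
    (∀ j : Fin n, b 0 < a j.succ ∧ a j.succ < b j.succ ∧ b j.succ < a 0) ∧
    (∀ i j : Fin n, i < j → b i.succ < a j.succ) ∧
    E = Set.Icc (b 0) (a 0) \ ⋃ j : Fin n, Set.Ioo (a j.succ) (b j.succ)

/-- `f` is analytic on the complement of `E` in the Riemann sphere, bounded by one in modulus,
and vanishes at infinity. (Being bounded near infinity, `f` is analytic there.) Values of `f`
on `E` play no role. -/
structure IsAdmissible (E : Set ℝ) (f : ℂ → ℂ) : Prop where
  differentiableOn : DifferentiableOn ℂ f ((fun x : ℝ => (x : ℂ)) '' E)ᶜ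
  norm_le : ∀ z ∈ ((fun x : ℝ => (x : ℂ)) '' E)ᶜ, ‖f z‖ ≤ 1
  tendsto_zero : Tendsto f (cocompact ℂ) (𝓝 0)

/-- `Ψ` is the Ahlfors function of the complement of `E`: it maximizes `|lim z f(z)|` among all
admissible `f`, with the usual normalization `lim z Ψ(z) > 0`. -/
def IsAhlfors (E : Set ℝ) (Ψ : ℂ → ℂ) : Prop :=
  IsAdmissible E Ψ ∧ ∃ κ : ℝ, 0 < κ ∧
    Tendsto (fun z => z * Ψ z) (cocompact ℂ) (𝓝 (κ : ℂ)) ∧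
    ∀ (f : ℂ → ℂ) (l : ℂ), IsAdmissible E f →
      Tendsto (fun z => z * f z) (cocompact ℂ) (𝓝 l) → ‖l‖ ≤ κ

/-- The rational function `D` equals `Ψ + 1 / Ψ` off `E` (and off the zeros of `Ψ`), where `Ψ` is
the Ahlfors function of the complement of `E`. -/
def IsDelta (E : Set ℝ) (D : RatFunc ℂ) : Prop :=
  ∃ Ψ : ℂ → ℂ, IsAhlfors E Ψ ∧
    ∀ z ∈ ((fun x : ℝ => (x : ℂ)) '' E)ᶜ, Ψ z ≠ 0 →
      D.eval (RingHom.id ℂ) z = Ψ z + 1 / Ψ z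

/-- `Δ_E`, the rational function `Ψ + 1 / Ψ` with `Ψ` the Ahlfors function of the complement
of `E`. -/
noncomputable def deltaE (E : Set ℝ) : RatFunc ℂ := Classical.epsilon (IsDelta E)

end GMP

/-! The proof identifies the spectrum of `A` with the preimage of `[-2, 2]` under the discriminant,
and identifies a rational function with the right mapping properties with `Δ_E` for its own preimage
of `[-2, 2]`.

Operator side. The trace of the transfer matrix has an expansion `D(z) = z / p_g + β + ∑ ν_k / (c_k
- z)` with coefficients valid over every commutative ring (`exists_trace_cellMat`). Let `T` be the
shift by one period. Viewing `ℓ²(ℤ)` as a module over a commutative algebra containing `A`, `T^{±1}`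
and the resolvents, Cayley-Hamilton for the transfer matrix gives the magic formula `D(A) = T + T⁻¹`
(`IsPeriodicWith.pfOp_eq`). Comparing one matrix entry on both sides, with the resolvents in shifted
class `𝔸`, forces `ν_k > 0` (`residue_pos`), so `D` maps the upper half plane into itself. The magic
formula and Bloch solutions give `σ(A) = D⁻¹([-2, 2])` (`IsPeriodicWith.mem_spectrum_iff`).

Function side. If `Ψ + 1/Ψ = D`, then `W = (D + 2) / (D - 2)` is the square of `(1 + Ψ) / (1 - Ψ)`.
Conversely, when `W` maps the upper half plane to the lower one, avoids `(-∞, 0]` off `E` and is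
negative on `E` up to finitely many points, the Cayley transform of its principal root is an Ahlfors
function; the extremal property follows from a maximum principle for arguments
(`IsAhlforsSquare.isAhlfors`). Ahlfors functions agree near infinity (`IsAhlfors.eventually_eq`), so
`Δ_E`, a chosen object, is determined. This is used twice: with `D` the discriminant and `E =
D⁻¹([-2, 2])`, giving `D = Δ_E` (`deltaE_eq_pf`); and for a finite gap set with `W` the product over
the bands of (z - left end) / (z - right end), giving `Δ_E⁻¹([-2, 2]) = E`
(`IsFiniteGapSet.mem_iff_of_deltaE_eq`).

The first gives (i) ⇒ (ii), the second (ii) ⇒ (i). Finally `σ(A)` is infinite, so rational functions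
that agree at `A` are equal (`eq_of_evalOp_eq`), which links (iii) with (ii). -/

namespace GMP

open Complex

/-! ### Maximum principles -/

/-- If a superlevel set of `‖f‖` in an open set is compact, then it is empty. -/
theorem norm_lt_of_isCompact_superlevel {U : Set ℂ} (hU : IsOpen U) {f : ℂ → ℂ}
    (hf : DifferentiableOn ℂ f U) {η : ℝ} (hK : IsCompact {z | z ∈ U ∧ η ≤ ‖f z‖})
    {z : ℂ} (hz : z ∈ U) : ‖f z‖ < η := by
  by_contra hlt
  have hne : {z | z ∈ U ∧ η ≤ ‖f z‖}.Nonempty := ⟨z, hz, not_lt.mp hlt⟩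
  have hcont : ContinuousOn (fun z => ‖f z‖) {z | z ∈ U ∧ η ≤ ‖f z‖} :=
    (hf.continuousOn.mono fun z hz => hz.1).norm
  obtain ⟨w, hw, hmax⟩ := hK.exists_isMaxOn hne hcont
  have hmaxU : ∀ z ∈ U, ‖f z‖ ≤ ‖f w‖ := fun z hz => by
    by_cases h : η ≤ ‖f z‖
    · exact hmax ⟨hz, h⟩
    · exact (not_le.mp h).le.trans hw.2
  -- The set where the maximum is attained is closed in `ℂ`, being closed in a compact set, and open
  -- by the local maximum principle. Connectedness of `ℂ` makes it the whole plane, which is not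
  -- compact; `U` itself need not be connected.
  have hset : {z | z ∈ U ∧ ‖f w‖ ≤ ‖f z‖} =
      {z | z ∈ {z | z ∈ U ∧ η ≤ ‖f z‖} ∧ ‖f w‖ ≤ ‖f z‖} := by
    ext z
    exact ⟨fun h => ⟨⟨h.1, hw.2.trans h.2⟩, h.2⟩, fun h => ⟨h.1.1, h.2⟩⟩
  have hclosed : IsClosed {z | z ∈ U ∧ ‖f w‖ ≤ ‖f z‖} := by
    rw [hset]
    exact (hcont.preimage_isClosed_of_isClosed hK.isClosed isClosed_Ici :)
  have hopen : IsOpen {z | z ∈ U ∧ ‖f w‖ ≤ ‖f z‖} := by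
    rw [isOpen_iff_mem_nhds]
    rintro x ⟨hxU, hx⟩
    have hUx : U ∈ 𝓝 x := hU.mem_nhds hxU
    have hmaxx : IsLocalMax (norm ∘ f) x := by
      filter_upwards [hUx] with y hy
      exact (hmaxU y hy).trans hx
    have hdx : ∀ᶠ y in 𝓝 x, DifferentiableAt ℂ f y := by
      filter_upwards [hU.eventually_mem hxU] with y hy
      exact hf.differentiableAt (hU.mem_nhds hy)
    filter_upwards [hUx, norm_eventually_eq_of_isLocalMax hdx hmaxx] with y hy hfy
    exact ⟨hy, hx.trans hfy.ge⟩
  have huniv := IsClopen.eq_univ ⟨hclosed, hopen⟩ ⟨w, hw.1, le_rfl⟩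
  have hcomp : IsCompact (Set.univ : Set ℂ) := by
    refine hK.of_isClosed_subset isClosed_univ ?_
    rw [← huniv, hset]
    exact fun z hz => hz.1
  exact noncompact_univ ℂ hcomp

/-- Maximum principle in the exterior of a disc. -/
theorem norm_le_of_exterior {f : ℂ → ℂ} {R C : ℝ}
    (hf : DifferentiableOn ℂ f {z | R < ‖z‖}) (hc : ContinuousOn f {z | R ≤ ‖z‖})
    (hb : ∀ z, ‖z‖ = R → ‖f z‖ ≤ C) (hC : 0 ≤ C) (hlim : Tendsto f (cocompact ℂ) (𝓝 0))
    {z : ℂ} (hz : R ≤ ‖z‖) : ‖f z‖ ≤ C := by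
  rcases hz.eq_or_lt with h | h
  · exact hb z h.symm
  refine le_of_forall_gt_imp_ge_of_dense fun η hη => (norm_lt_of_isCompact_superlevel
    (isOpen_lt continuous_const continuous_norm) hf ?_ h).le
  -- On the circle `‖f‖ ≤ C < η`, so including the circle adds no points and makes the set closed.
  have hset : {z | z ∈ {z : ℂ | R < ‖z‖} ∧ η ≤ ‖f z‖} = {z | z ∈ {z : ℂ | R ≤ ‖z‖} ∧ η ≤ ‖f z‖} := by
    ext z
    refine ⟨fun h => ⟨show R ≤ ‖z‖ from le_of_lt h.1, h.2⟩, fun h => ⟨show R < ‖z‖ from lt_of_le_of_ne h.1 fun e => ?_, h.2⟩⟩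
    exact absurd (h.2.trans (hb z e.symm)) (not_le.mpr hη)
  rw [hset]
  have hclosed : IsClosed {z | z ∈ {z : ℂ | R ≤ ‖z‖} ∧ η ≤ ‖f z‖} :=
    (hc.norm.preimage_isClosed_of_isClosed (isClosed_le continuous_const continuous_norm)
      isClosed_Ici :)
  have hev : ∀ᶠ z in cocompact ℂ, ‖f z‖ < η :=
    (tendsto_zero_iff_norm_tendsto_zero.mp hlim).eventually_lt_const (hC.trans_lt hη)
  obtain ⟨K, hK, hKs⟩ := mem_cocompact.mp hev
  refine hK.of_isClosed_subset hclosed fun z hz => ?_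
  by_contra hzK
  exact absurd (hKs hzK) (not_lt.mpr hz.2)

/-- Maximum principle in the upper half plane, with boundary limits superior. -/
theorem norm_le_of_upperHalfPlane {f : ℂ → ℂ} (hf : DifferentiableOn ℂ f {z | 0 < z.im})
    (hb : ∀ (x : ℝ) (η : ℝ), 1 < η → ∀ᶠ z in 𝓝[{z | 0 < z.im}] (x : ℂ), ‖f z‖ < η)
    (hinf : ∀ η : ℝ, 1 < η → ∀ᶠ z in cocompact ℂ, 0 < z.im → ‖f z‖ < η)
    {z : ℂ} (hz : 0 < z.im) : ‖f z‖ ≤ 1 := by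
  refine le_of_forall_gt_imp_ge_of_dense fun η hη => (norm_lt_of_isCompact_superlevel
    (isOpen_lt continuous_const continuous_im) hf ?_ hz).le
  have hclosed : IsClosed {z | z ∈ {z : ℂ | 0 < z.im} ∧ η ≤ ‖f z‖} := by
    rw [isClosed_iff_frequently]
    intro w hw
    have hw0 : 0 ≤ w.im := by
      by_contra hlt
      have : ∀ᶠ y : ℂ in 𝓝 w, y.im < 0 :=
        (isOpen_lt continuous_im continuous_const).mem_nhds (not_le.mp hlt)
      obtain ⟨y, hy, hy'⟩ := (hw.and_eventually this).exists
      exact lt_asymm hy' hy.1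
    rcases hw0.eq_or_lt with h0 | h0
    · have hwr : ((w.re : ℝ) : ℂ) = w := Complex.ext rfl h0
      have := hb w.re η hη
      rw [hwr, eventually_nhdsWithin_iff] at this
      obtain ⟨y, hy, hy'⟩ := (hw.and_eventually this).exists
      exact absurd (hy' hy.1) (not_lt.mpr hy.2)
    · refine ⟨h0, le_of_not_gt fun hlt => ?_⟩
      have hcw : ContinuousAt (fun z => ‖f z‖) w :=
        (hf.differentiableAt ((isOpen_lt continuous_const continuous_im).mem_nhds
          h0)).continuousAt.norm
      obtain ⟨y, hy, hy'⟩ := (hw.and_eventually (hcw.eventually_lt_const hlt)).exists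
      exact absurd hy' (not_lt.mpr hy.2)
  obtain ⟨K, hK, hKs⟩ := mem_cocompact.mp (hinf η hη)
  refine hK.of_isClosed_subset hclosed fun z hz => ?_
  by_contra hzK
  exact absurd (hKs hzK hz.1) (not_lt.mpr hz.2)

/-- Maximum principle in the upper half plane for a bounded function, with finitely many
exceptional boundary points. -/
theorem norm_le_of_upperHalfPlane_of_finite {f : ℂ → ℂ} (hf : DifferentiableOn ℂ f {z | 0 < z.im})
    (X : Finset ℝ) {B : ℝ} (hB : ∀ z, 0 < z.im → ‖f z‖ ≤ B)
    (hb : ∀ x : ℝ, x ∉ X → ∀ η : ℝ, 1 < η → ∀ᶠ z in 𝓝[{z | 0 < z.im}] (x : ℂ), ‖f z‖ < η)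
    (hinf : ∀ η : ℝ, 1 < η → ∀ᶠ z in cocompact ℂ, 0 < z.im → ‖f z‖ < η)
    {z : ℂ} (hz : 0 < z.im) : ‖f z‖ ≤ 1 := by
  -- A damping factor that vanishes at the exceptional points and has modulus at most one in the
  -- upper half plane.
  set b : ℂ → ℂ := fun z => ∏ x ∈ X, (z - x) / (z - x + I) with hbdef
  have hden : ∀ (w : ℂ) (x : ℝ), 0 ≤ w.im → w - x + I ≠ 0 := fun w x hw h => by
    have := congrArg Complex.im h
    simp at this
    linarith
  have hfac : ∀ (w : ℂ) (x : ℝ), 0 ≤ w.im → ‖(w - x) / (w - x + I)‖ ≤ 1 := fun w x hw => by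
    rw [norm_div]
    refine div_le_one_of_le₀ ?_ (norm_nonneg _)
    rw [Complex.norm_def, Complex.norm_def]
    refine Real.sqrt_le_sqrt ?_
    simp [normSq_apply]
    nlinarith
  have hb1 : ∀ w : ℂ, 0 ≤ w.im → ‖b w‖ ≤ 1 := fun w hw => by
    rw [hbdef]; simp only [norm_prod]
    exact Finset.prod_le_one (fun _ _ => norm_nonneg _) fun x _ => hfac w x hw
  have hbd : ∀ w : ℂ, 0 ≤ w.im → DifferentiableAt ℂ b w := fun w hw => by
    refine DifferentiableAt.fun_finsetProd fun x _ => ?_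
    exact DifferentiableAt.div (by fun_prop) (by fun_prop) (hden w x hw)
  have hb0 : ∀ x ∈ X, b x = 0 := fun x hx => Finset.prod_eq_zero hx (by simp)
  have hbz : b z ≠ 0 := by
    refine Finset.prod_ne_zero_iff.mpr fun x _ => div_ne_zero (fun h => ?_) (hden z x hz.le)
    have := congrArg Complex.im h
    simp at this
    linarith
  -- The previous principle applies to `f ^ n * b`, since boundedness of `f` lets `b` kill the
  -- exceptional points. As `b z ≠ 0` is fixed, letting `n → ∞` forces `‖f z‖ ≤ 1`.
  have key : ∀ n : ℕ, ‖f z‖ ^ n * ‖b z‖ ≤ 1 := fun n => by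
    have hpow : ∀ η : ℝ, 1 < η → ∃ η' : ℝ, 1 < η' ∧ ∀ t : ℝ, 0 ≤ t → t < η' → t ^ n < η := by
      intro η hη
      have hc : ∀ᶠ s : ℝ in 𝓝 1, s ^ n < η :=
        (continuous_pow n).continuousAt.eventually_lt_const (by simpa using hη)
      obtain ⟨s, hs, hs1⟩ := ((hc.filter_mono nhdsWithin_le_nhds).and
        (self_mem_nhdsWithin (s := Set.Ioi (1 : ℝ)))).exists
      exact ⟨s, hs1, fun t h0 ht => (pow_le_pow_left₀ h0 ht.le n).trans_lt hs⟩
    have := norm_le_of_upperHalfPlane (f := fun z => f z ^ n * b z) ?_ ?_ ?_ hz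
    · simpa using this
    · exact (hf.pow n).mul fun w hw => (hbd w (le_of_lt hw)).differentiableWithinAt
    · intro x η hη
      by_cases hx : x ∈ X
      · have hbx : Tendsto (fun w => B ^ n * ‖b w‖) (𝓝 (x : ℂ)) (𝓝 0) := by
          have := ((hbd x (by simp)).continuousAt.norm).tendsto.const_mul (B ^ n)
          simpa [hb0 x hx] using this
        filter_upwards [nhdsWithin_le_nhds (hbx.eventually_lt_const (by linarith : 0 < η)),
          self_mem_nhdsWithin] with w hw hwi
        rw [norm_mul, norm_pow]
        refine lt_of_le_of_lt ?_ hw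
        gcongr
        exact hB w hwi
      · obtain ⟨η', hη', h⟩ := hpow η hη
        filter_upwards [hb x hx η' hη', self_mem_nhdsWithin] with w hw hwi
        rw [norm_mul, norm_pow]
        exact (mul_le_of_le_one_right (by positivity) (hb1 w (le_of_lt hwi))).trans_lt
          (h _ (norm_nonneg _) hw)
    · intro η hη
      obtain ⟨η', hη', h⟩ := hpow η hη
      filter_upwards [hinf η' hη'] with w hw hwi
      rw [norm_mul, norm_pow]
      exact (mul_le_of_le_one_right (by positivity) (hb1 w (le_of_lt hwi))).trans_lt
        (h _ (norm_nonneg _) (hw hwi))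
  by_contra hlt
  have htop : Tendsto (fun n : ℕ => ‖f z‖ ^ n * ‖b z‖) atTop atTop :=
    (tendsto_pow_atTop_atTop_of_one_lt (not_le.mp hlt)).atTop_mul_const (norm_pos_iff.mpr hbz)
  obtain ⟨n, hn⟩ := (htop.eventually_gt_atTop 1).exists
  exact absurd (key n) (not_le.mpr hn)

end GMP

namespace GMP

open Complex ComplexConjugate

/-! ### The Ahlfors function -/

/-- `E` as a subset of the complex plane. -/
abbrev realImage (E : Set ℝ) : Set ℂ := (fun x : ℝ => (x : ℂ)) '' E

/-- The function `W = ((1 + Ψ) / (1 - Ψ))²`, where `Ψ` is the Ahlfors function of the complement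
of `E`: it maps the upper half plane to the lower one and is negative on `E` outside the finite
set `X`. -/
structure IsAhlforsSquare (E : Set ℝ) (W : ℂ → ℂ) (X : Finset ℝ) (κ : ℝ) : Prop where
  differentiableOn : DifferentiableOn ℂ W (realImage E)ᶜ
  mem_slitPlane : ∀ z ∈ (realImage E)ᶜ, W z ∈ slitPlane
  im_neg : ∀ z : ℂ, 0 < z.im → (W z).im < 0
  im_eq_zero : ∀ x : ℝ, x ∉ E → (W x).im = 0
  boundary : ∀ x ∈ E, x ∉ X → ContinuousAt W x ∧ (W x).re < 0 ∧ (W x).im = 0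
  pos : 0 < κ
  tendsto : Tendsto (fun z => z * (W z - 1)) (cocompact ℂ) (𝓝 (4 * κ))

theorem mem_compl_of_im_ne_zero {E : Set ℝ} {z : ℂ} (hz : z.im ≠ 0) : z ∈ (realImage E)ᶜ := by
  rintro ⟨x, -, rfl⟩
  exact hz (ofReal_im x)

theorem conj_mem_compl {E : Set ℝ} {z : ℂ} (hz : z ∈ (realImage E)ᶜ) : conj z ∈ (realImage E)ᶜ := by
  rintro ⟨x, hx, h⟩
  refine hz ⟨x, hx, ?_⟩
  have := congrArg conj h
  simpa using this

theorem isOpen_compl {E : Set ℝ} (hE : IsClosed E) : IsOpen (realImage E)ᶜ :=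
  (Complex.isometry_ofReal.isClosedEmbedding.isClosedMap E hE).isOpen_compl

theorem tendsto_inv_cocompact : Tendsto (fun z : ℂ => z⁻¹) (cocompact ℂ) (𝓝 0) :=
  Metric.cobounded_eq_cocompact (α := ℂ) ▸ tendsto_inv₀_cobounded

theorem eventually_ne_zero_cocompact : ∀ᶠ z : ℂ in cocompact ℂ, z ≠ 0 := by
  have := (tendsto_norm_cocompact_atTop (E := ℂ)).eventually_gt_atTop 0
  filter_upwards [this] with z hz
  exact norm_pos_iff.mp hz

theorem tendsto_of_tendsto_mul {u : ℂ → ℂ} {a : ℂ}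
    (h : Tendsto (fun z => z * u z) (cocompact ℂ) (𝓝 a)) : Tendsto u (cocompact ℂ) (𝓝 0) := by
  have := tendsto_inv_cocompact.mul h
  rw [zero_mul] at this
  refine this.congr' ?_
  filter_upwards [eventually_ne_zero_cocompact] with z hz
  rw [inv_mul_cancel_left₀ hz]

theorem tendsto_one_of_tendsto_mul {u : ℂ → ℂ} {a : ℂ}
    (h : Tendsto (fun z => z * (u z - 1)) (cocompact ℂ) (𝓝 a)) :
    Tendsto u (cocompact ℂ) (𝓝 1) := by
  simpa using (tendsto_of_tendsto_mul h).add_const 1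

/-- The logarithm has derivative 1 at 1, so `log u` and `u - 1` differ by `o(u - 1)`. -/
theorem tendsto_mul_log {u : ℂ → ℂ} {a : ℂ}
    (h : Tendsto (fun z => z * (u z - 1)) (cocompact ℂ) (𝓝 a)) :
    Tendsto (fun z => z * log (u z)) (cocompact ℂ) (𝓝 a) := by
  have h1 := tendsto_one_of_tendsto_mul h
  have ho := ((hasDerivAt_log one_mem_slitPlane).isLittleO).comp_tendsto h1
  simp only [log_one, sub_zero, inv_one, smul_eq_mul, mul_one, Function.comp_def] at ho
  have ho2 := (Asymptotics.isBigO_refl (fun z : ℂ => z) (cocompact ℂ)).mul_isLittleO ho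
  have ho3 := (ho2.trans_isBigO (h.isBigO_one ℂ)).tendsto_zero_of_tendsto (tendsto_const_nhds)
  have := ho3.add h
  rw [zero_add] at this
  exact this.congr fun z => by ring

namespace IsAhlforsSquare

variable {E : Set ℝ} {W : ℂ → ℂ} {X : Finset ℝ} {κ : ℝ}

/-- The Cayley transform of the square root of `W`. -/
noncomputable def psi (W : ℂ → ℂ) (z : ℂ) : ℂ :=
  (exp (log (W z) / 2) - 1) / (exp (log (W z) / 2) + 1)

theorem exp_half_log_sq {w : ℂ} (hw : w ∈ slitPlane) : exp (log w / 2) ^ 2 = w := by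
  rw [← exp_nat_mul, Nat.cast_ofNat, mul_div_cancel₀ _ two_ne_zero,
    exp_log (slitPlane_ne_zero hw)]

/-- Halving an argument in `(-π, π)` puts it in `(-π/2, π/2)`. -/
theorem exp_half_log_re_pos {w : ℂ} (hw : w ∈ slitPlane) : 0 < (exp (log w / 2)).re := by
  rw [exp_re]
  have h2 : (log w / 2).im = arg w / 2 := by
    rw [show (2 : ℂ) = ((2 : ℝ) : ℂ) by norm_num, div_ofReal_im, log_im]
  rw [h2]
  refine mul_pos (Real.exp_pos _) (Real.cos_pos_of_mem_Ioo ⟨?_, ?_⟩)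
  · have := neg_pi_lt_arg w; linarith
  · have := lt_of_le_of_ne (arg_le_pi w) (mem_slitPlane_iff_arg.mp hw).1; linarith

theorem exp_half_log_add_one_ne_zero {w : ℂ} (hw : w ∈ slitPlane) : exp (log w / 2) + 1 ≠ 0 := by
  intro h
  have := congrArg re h
  simp only [add_re, one_re, zero_re] at this
  linarith [exp_half_log_re_pos hw]

/-- The principal root of `W` lies in the right half plane, which the Cayley transform maps into the
unit disc; at infinity the root tends to 1, which is sent to 0. -/
theorem isAdmissible_psi (h : IsAhlforsSquare E W X κ) : IsAdmissible E (psi W) where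
  differentiableOn z hz := by
    have hl : DifferentiableWithinAt ℂ (fun z => exp (log (W z) / 2)) (realImage E)ᶜ z :=
      (((h.differentiableOn z hz).clog (h.mem_slitPlane z hz)).div_const 2).cexp
    exact (hl.sub_const 1).div (hl.add_const 1)
      (exp_half_log_add_one_ne_zero (h.mem_slitPlane z hz))
  norm_le z hz := by
    rw [psi, norm_div]
    refine div_le_one_of_le₀ ?_ (norm_nonneg _)
    rw [Complex.norm_def, Complex.norm_def]
    refine Real.sqrt_le_sqrt ?_
    have := exp_half_log_re_pos (h.mem_slitPlane z hz)
    simp only [normSq_apply, sub_re, one_re, sub_im, one_im, add_re, add_im]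
    nlinarith
  tendsto_zero := by
    have h1 := tendsto_one_of_tendsto_mul h.tendsto
    have h2 : ContinuousAt (fun w : ℂ => (exp (log w / 2) - 1) / (exp (log w / 2) + 1)) 1 := by
      have : ContinuousAt (fun w : ℂ => exp (log w / 2)) 1 :=
        ((continuousAt_clog one_mem_slitPlane).div_const 2).cexp
      exact (this.sub continuousAt_const).div (this.add continuousAt_const)
        (exp_half_log_add_one_ne_zero one_mem_slitPlane)
    have := h2.tendsto.comp h1
    simp only [log_one, zero_div, exp_zero, sub_self] at this
    exact this

/-- With `s² = W` one has `(s - 1) / (s + 1) = (W - 1) / (s + 1)²`, and the denominator tends to 4.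
This is the reason for the factor 4 in `IsAhlforsSquare.tendsto`. -/
theorem tendsto_mul_psi (h : IsAhlforsSquare E W X κ) (hE : ∀ᶠ z in cocompact ℂ, z ∈ (realImage E)ᶜ) :
    Tendsto (fun z => z * psi W z) (cocompact ℂ) (𝓝 κ) := by
  have h1 := tendsto_one_of_tendsto_mul h.tendsto
  have h2 : ContinuousAt (fun w : ℂ => (exp (log w / 2) + 1) ^ 2) 1 := by
    have : ContinuousAt (fun w : ℂ => exp (log w / 2)) 1 :=
      ((continuousAt_clog one_mem_slitPlane).div_const 2).cexp
    exact (this.add continuousAt_const).pow 2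
  have h3 := h.tendsto.div (h2.tendsto.comp h1)
    (pow_ne_zero 2 (exp_half_log_add_one_ne_zero one_mem_slitPlane))
  simp only [log_one, zero_div, exp_zero, Function.comp_def] at h3
  rw [show (4 * (κ : ℂ)) / (1 + 1) ^ 2 = κ by norm_num] at h3
  refine h3.congr' ?_
  filter_upwards [hE] with z hz
  have hs := exp_half_log_sq (h.mem_slitPlane z hz)
  have hne := exp_half_log_add_one_ne_zero (h.mem_slitPlane z hz)
  simp only [Pi.div_apply, psi]
  rw [div_eq_iff (pow_ne_zero 2 hne), mul_div_assoc', div_mul_eq_mul_div, eq_div_iff hne]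
  nth_rewrite 1 [← hs]
  ring

theorem re_cayley_pos {u : ℂ} (hu : ‖u‖ < 1) : 0 < ((1 + u) / (1 - u)).re := by
  have hne : 1 - u ≠ 0 := fun h => by
    rw [← sub_eq_zero.mp h] at hu
    simp at hu
  have hn : u.re * u.re + u.im * u.im < 1 := by
    rw [← normSq_apply, normSq_eq_norm_sq]
    exact pow_lt_one₀ (norm_nonneg _) hu two_ne_zero
  rw [div_re, ← add_div]
  refine div_pos ?_ (normSq_pos.mpr hne)
  simp
  nlinarith

/-- The extremal property among functions symmetric with respect to the real axis. -/
theorem le_of_symmetric (h : IsAhlforsSquare E W X κ) (hEc : IsClosed E) {f : ℂ → ℂ}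
    (hf : IsAdmissible E f) (hsymm : ∀ z, f (conj z) = conj (f z)) {l : ℝ}
    (hl : Tendsto (fun z => z * f z) (cocompact ℂ) (𝓝 (l : ℂ))) {s : ℝ} (hs0 : 0 < s)
    (hs1 : s < 1) : s * l ≤ κ := by
  -- The factor `s < 1` keeps `s f` strictly inside the disc, so `F` has positive real part; for `f`
  -- extremal and `s = 1` it would be the square root of `W`.
  set F : ℂ → ℂ := fun z => (1 + s * f z) / (1 - s * f z) with hF
  have hlt : ∀ z ∈ (realImage E)ᶜ, ‖s * f z‖ < 1 := fun z hz => by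
    rw [norm_mul, norm_real, Real.norm_of_nonneg hs0.le]
    exact (mul_le_of_le_one_right hs0.le (hf.norm_le z hz)).trans_lt hs1
  have hne : ∀ z ∈ (realImage E)ᶜ, 1 - s * f z ≠ 0 := fun z hz e => by
    have := hlt z hz
    rw [← sub_eq_zero.mp e] at this
    simp at this
  have hFre : ∀ z ∈ (realImage E)ᶜ, 0 < (F z).re := fun z hz => re_cayley_pos (hlt z hz)
  have hFs : ∀ z ∈ (realImage E)ᶜ, F z ∈ slitPlane := fun z hz => Or.inl (hFre z hz)
  have hFd : DifferentiableOn ℂ F (realImage E)ᶜ := fun z hz =>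
    (((hf.differentiableOn z hz).const_mul _).const_add 1).div
      (((hf.differentiableOn z hz).const_mul _).const_sub 1) (hne z hz)
  have hsf0 : Tendsto (fun z => (s : ℂ) * f z) (cocompact ℂ) (𝓝 0) := by
    simpa using hf.tendsto_zero.const_mul (s : ℂ)
  have hFinf : Tendsto (fun z => z * (F z - 1)) (cocompact ℂ) (𝓝 (2 * s * l)) := by
    have h1 : Tendsto (fun z => 2 * s * (z * f z) / (1 - s * f z)) (cocompact ℂ)
        (𝓝 (2 * s * l / (1 - 0))) :=
      (hl.const_mul (2 * (s : ℂ))).div (hsf0.const_sub 1) (by simp)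
    simp only [sub_zero, div_one] at h1
    refine h1.congr' ?_
    filter_upwards [(hsf0.const_sub 1).eventually_ne (by simp : (1 : ℂ) - 0 ≠ 0)] with z hz
    simp only [hF]
    field_simp
    ring
  -- The aim is `0 ≤ Im L` in the upper half plane, that is `‖exp (I L)‖ ≤ 1`; the behaviour of `z
  -- L(z)` at infinity then compares `s l` with `κ`.
  set L : ℂ → ℂ := fun z => log (F z) - log (W z) / 2 with hL
  have hLim : ∀ z, (L z).im = arg (F z) - arg (W z) / 2 := fun z => by
    simp only [hL, sub_im, log_im]
    rw [show (2 : ℂ) = ((2 : ℝ) : ℂ) by norm_num, div_ofReal_im, log_im]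
  have hnorm : ∀ z, ‖exp (I * L z)‖ = Real.exp (arg (W z) / 2 - arg (F z)) := fun z => by
    rw [norm_exp, I_mul_re, hLim, neg_sub]
  have hUE : ∀ z : ℂ, 0 < z.im → z ∈ (realImage E)ᶜ := fun z hz => mem_compl_of_im_ne_zero hz.ne'
  have hWneg : ∀ z : ℂ, 0 < z.im → arg (W z) < 0 := fun z hz => arg_neg_iff.mpr (h.im_neg z hz)
  have hFlow : ∀ z ∈ (realImage E)ᶜ, -(Real.pi / 2) < arg (F z) := fun z hz =>
    (abs_lt.mp (abs_arg_lt_pi_div_two_iff.mpr (Or.inl (hFre z hz)))).1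
  have hlim_lt : ∀ {𝓕 : Filter ℂ}, Tendsto (fun z => arg (W z) / 2 - arg (F z)) 𝓕 (𝓝 0) →
      ∀ η : ℝ, 1 < η → ∀ᶠ z in 𝓕, ‖exp (I * L z)‖ < η := fun {𝓕} hlim η hη => by
    have := (Real.continuous_exp.tendsto 0).comp hlim
    rw [Real.exp_zero] at this
    filter_upwards [this.eventually_lt_const hη] with z hz
    rw [hnorm]
    exact hz
  have hmain : ∀ z : ℂ, 0 < z.im → ‖exp (I * L z)‖ ≤ 1 := by
    intro z hz
    refine norm_le_of_upperHalfPlane_of_finite (f := fun z => exp (I * L z)) ?_ X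
      (B := Real.exp (Real.pi / 2)) ?_ ?_ ?_ hz
    · intro w hw
      exact ((((hFd w (hUE w hw)).clog (hFs w (hUE w hw))).sub
        (((h.differentiableOn w (hUE w hw)).clog
          (h.mem_slitPlane w (hUE w hw))).div_const 2)).const_mul I).cexp.mono
            fun y hy => hUE y hy
    · intro w hw
      rw [hnorm]
      refine Real.exp_le_exp.mpr ?_
      have := hWneg w hw
      have := hFlow w (hUE w hw)
      linarith
    · intro x hx η hη
      -- On `E` the argument of `W` tends to `-π` from above, while that of `F` exceeds `-π/2`. Off
      -- `E` both functions are positive on the real axis, `F` by the symmetry of `f`, so both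
      -- arguments vanish.
      by_cases hxE : x ∈ E
      · obtain ⟨hc, hre, him⟩ := h.boundary x hxE hx
        have hW1 : Tendsto W (𝓝[{z | 0 < z.im}] (x : ℂ)) (𝓝[{z | z.im < 0}] (W x)) :=
          tendsto_nhdsWithin_of_tendsto_nhds_of_eventually_within _
            (hc.tendsto.mono_left nhdsWithin_le_nhds)
            (by filter_upwards [self_mem_nhdsWithin] with w hw using h.im_neg w hw)
        have hW2 := (tendsto_arg_nhdsWithin_im_neg_of_re_neg_of_im_zero hre him).comp hW1
        have hlt : -Real.pi < 2 * Real.log η - Real.pi := by linarith [Real.log_pos hη]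
        filter_upwards [hW2.eventually_lt_const hlt, self_mem_nhdsWithin] with w hw hwi
        rw [hnorm, ← Real.lt_log_iff_exp_lt (by linarith)]
        have := hFlow w (hUE w hwi)
        simp only [Function.comp_apply] at hw
        linarith
      · have hxE' : (x : ℂ) ∈ (realImage E)ᶜ := by
          rintro ⟨y, hy, hxy⟩
          exact hxE (ofReal_injective hxy ▸ hy)
        have hnhds := (isOpen_compl hEc).mem_nhds hxE'
        have hreal : (f x).im = 0 := by
          have := hsymm x
          rw [conj_ofReal] at this
          exact conj_eq_iff_im.mp this.symm
        have hfr : f x = ((f x).re : ℂ) := Complex.ext rfl hreal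
        have hFim : (F x).im = 0 := by
          simp only [hF]
          rw [hfr]
          exact_mod_cast ofReal_im ((1 + s * (f x).re) / (1 - s * (f x).re))
        have hFa : arg (F x) = 0 := arg_eq_zero_iff.mpr ⟨(hFre x hxE').le, hFim⟩
        have hWa : arg (W x) = 0 := by
          rcases h.mem_slitPlane x hxE' with h1 | h1
          · exact arg_eq_zero_iff.mpr ⟨h1.le, h.im_eq_zero x hxE⟩
          · exact absurd (h.im_eq_zero x hxE) h1
        have hFt : Tendsto (fun z => arg (F z)) (𝓝 (x : ℂ)) (𝓝 0) := by
          have := (continuousAt_arg (hFs x hxE')).tendsto.comp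
            (hFd.differentiableAt hnhds).continuousAt.tendsto
          rwa [hFa] at this
        have hWt : Tendsto (fun z => arg (W z)) (𝓝 (x : ℂ)) (𝓝 0) := by
          have := (continuousAt_arg (h.mem_slitPlane x hxE')).tendsto.comp
            (h.differentiableOn.differentiableAt hnhds).continuousAt.tendsto
          rwa [hWa] at this
        refine (hlim_lt ?_ η hη).filter_mono nhdsWithin_le_nhds
        simpa using (hWt.div_const 2).sub hFt
    · intro η hη
      have hFt : Tendsto (fun z => arg (F z)) (cocompact ℂ) (𝓝 0) := by
        have := (continuousAt_arg one_mem_slitPlane).tendsto.comp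
          (tendsto_one_of_tendsto_mul hFinf)
        rwa [arg_one] at this
      have hWt : Tendsto (fun z => arg (W z)) (cocompact ℂ) (𝓝 0) := by
        have := (continuousAt_arg one_mem_slitPlane).tendsto.comp
          (tendsto_one_of_tendsto_mul h.tendsto)
        rwa [arg_one] at this
      filter_upwards [hlim_lt (by simpa using (hWt.div_const 2).sub hFt) η hη] with w hw _
      exact hw
  have hLpos : ∀ z : ℂ, 0 < z.im → 0 ≤ (L z).im := fun z hz => by
    have := hmain z hz
    rw [hnorm, Real.exp_le_one_iff] at this
    rw [hLim]
    linarith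
  have hLlim : Tendsto (fun z => z * L z) (cocompact ℂ) (𝓝 (2 * s * l - 4 * κ / 2)) := by
    refine ((tendsto_mul_log hFinf).sub ((tendsto_mul_log h.tendsto).div_const 2)).congr
      fun z => ?_
    simp only [hL]
    ring
  have hIy : Tendsto (fun y : ℝ => I * y) atTop (cocompact ℂ) := by
    rw [← Metric.cobounded_eq_cocompact, ← tendsto_norm_atTop_iff_cobounded]
    simpa using tendsto_abs_atTop_atTop
  have hre := (continuous_re.tendsto _).comp (hLlim.comp hIy)
  -- On the ray `z = I y` the real part of `z L(z)` is `-y Im L(z) ≤ 0`.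
  have hle : (2 * s * l - 4 * κ / 2 : ℂ).re ≤ 0 := by
    refine le_of_tendsto hre ?_
    filter_upwards [eventually_gt_atTop 0] with y hy
    have := hLpos (I * y) (by simpa using hy)
    simp
    nlinarith
  have hcast : (2 * s * l - 4 * κ / 2 : ℂ) = ((2 * s * l - 4 * κ / 2 : ℝ) : ℂ) := by
    push_cast; ring
  rw [hcast, ofReal_re] at hle
  linarith

/-- Rotating `f` makes its limit the positive number `‖l‖`; averaging with the reflection in the
real axis keeps admissibility and the limit. The symmetric case then applies, with `s → 1`. -/
theorem norm_le (h : IsAhlforsSquare E W X κ) (hEc : IsClosed E) {f : ℂ → ℂ}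
    (hf : IsAdmissible E f) {l : ℂ} (hl : Tendsto (fun z => z * f z) (cocompact ℂ) (𝓝 l)) :
    ‖l‖ ≤ κ := by
  rcases eq_or_ne l 0 with rfl | hl0
  · simpa using h.pos.le
  set u : ℂ := conj l / ‖l‖ with hu
  have hun : ‖u‖ = 1 := by
    rw [hu, norm_div, norm_conj, norm_real, norm_norm, div_self (norm_ne_zero_iff.mpr hl0)]
  have hul : u * l = ‖l‖ := by
    rw [hu, div_mul_eq_mul_div, conj_mul', pow_two, mul_div_cancel_left₀]
    exact_mod_cast norm_ne_zero_iff.mpr hl0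
  set g : ℂ → ℂ := fun z => (u * f z + conj (u * f (conj z))) / 2 with hg
  have hconj : Tendsto (conj : ℂ → ℂ) (cocompact ℂ) (cocompact ℂ) :=
    (conjCLE.toHomeomorph.isClosedEmbedding).tendsto_cocompact
  have hga : IsAdmissible E g := by
    refine ⟨fun z hz => ?_, fun z hz => ?_, ?_⟩
    · have hd : ∀ w ∈ (realImage E)ᶜ, DifferentiableAt ℂ (fun z => u * f z) w := fun w hw =>
        (hf.differentiableOn.differentiableAt ((isOpen_compl hEc).mem_nhds hw)).const_mul u
      have h2 := (hd _ (conj_mem_compl hz)).conj_conj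
      rw [conj_conj] at h2
      exact (((hd z hz).add h2).div_const 2).differentiableWithinAt
    · simp only [hg, norm_div]
      rw [div_le_one (by norm_num)]
      refine (norm_add_le _ _).trans ?_
      rw [norm_conj, norm_mul, norm_mul, hun, norm_ofNat]
      linarith [hf.norm_le z hz, hf.norm_le _ (conj_mem_compl hz)]
    · have h1 := hf.tendsto_zero.const_mul u
      have h2 := (continuous_conj.tendsto _).comp (h1.comp hconj)
      simpa [hg, Function.comp_def] using (h1.add h2).div_const 2
  have hgl : Tendsto (fun z => z * g z) (cocompact ℂ) (𝓝 (‖l‖ : ℂ)) := by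
    have h1 := hl.const_mul u
    rw [hul] at h1
    have h2 := (continuous_conj.tendsto _).comp (h1.comp hconj)
    rw [conj_ofReal] at h2
    have h3 := (h1.add h2).div_const 2
    rw [add_self_div_two] at h3
    refine h3.congr fun z => ?_
    simp only [hg, Function.comp_apply, map_mul, conj_conj]
    ring
  have hsymm : ∀ z, g (conj z) = conj (g z) := fun z => by
    simp only [hg, map_div₀, map_add, conj_conj, map_ofNat]
    ring
  have key : ∀ s : ℝ, 0 < s → s < 1 → s * ‖l‖ ≤ κ := fun s h0 h1 =>
    h.le_of_symmetric hEc hga hsymm hgl h0 h1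
  have hc : Tendsto (fun s : ℝ => s * ‖l‖) (𝓝[<] 1) (𝓝 (1 * ‖l‖)) :=
    (tendsto_id.mul_const ‖l‖).mono_left nhdsWithin_le_nhds
  rw [one_mul] at hc
  refine le_of_tendsto hc ?_
  filter_upwards [Ioo_mem_nhdsLT (zero_lt_one' ℝ)] with s hs using key s hs.1 hs.2

theorem isAhlfors (h : IsAhlforsSquare E W X κ) (hEc : IsCompact E) : IsAhlfors E (psi W) := by
  refine ⟨h.isAdmissible_psi, κ, h.pos, h.tendsto_mul_psi ?_, fun f l hf hl =>
    h.norm_le hEc.isClosed hf hl⟩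
  exact (hEc.image continuous_ofReal).compl_mem_cocompact

end IsAhlforsSquare

end GMP

namespace GMP

open Complex ComplexConjugate

/-! ### Uniqueness of the Ahlfors function -/

/-- A quantitative strict convexity of the disc, from the parallelogram law: the gap below 1 leaves
room for perturbing an average of two extremal functions. -/
theorem norm_half_add_le {a b : ℂ} (ha : ‖a‖ ≤ 1) (hb : ‖b‖ ≤ 1) :
    ‖(a + b) / 2‖ + ‖(a - b) / 2‖ ^ 2 / 2 ≤ 1 := by
  have h := parallelogram_law_with_norm ℝ a b
  rw [norm_div, norm_div, norm_ofNat]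
  have h1 : ‖a‖ * ‖a‖ ≤ 1 := mul_le_one₀ ha (norm_nonneg _) ha
  have h2 : ‖b‖ * ‖b‖ ≤ 1 := mul_le_one₀ hb (norm_nonneg _) hb
  have h3 : (‖a + b‖ / 2) ^ 2 ≤ (1 - (‖a - b‖ / 2) ^ 2 / 2) ^ 2 := by
    nlinarith [sq_nonneg ((‖a - b‖ / 2) ^ 2)]
  have h4 : 0 ≤ 1 - (‖a - b‖ / 2) ^ 2 / 2 := by
    nlinarith [norm_nonneg (a + b), norm_nonneg (a - b)]
  linarith [(pow_le_pow_iff_left₀ (by positivity) h4 two_ne_zero).mp h3]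

/-- A function analytic near infinity and vanishing there either vanishes near infinity or has
a zero of finite order. -/
theorem eventually_eq_zero_or_tendsto_pow_mul {g : ℂ → ℂ}
    (hd : ∀ᶠ z in cocompact ℂ, DifferentiableAt ℂ g z) (h0 : Tendsto g (cocompact ℂ) (𝓝 0)) :
    (∀ᶠ z in cocompact ℂ, g z = 0) ∨
      ∃ (n : ℕ) (a : ℂ), n ≠ 0 ∧ a ≠ 0 ∧ Tendsto (fun z => z ^ n * g z) (cocompact ℂ) (𝓝 a) := by
  have hinv : Tendsto (fun z : ℂ => z⁻¹) (𝓝[≠] 0) (cocompact ℂ) := by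
    rw [← Metric.cobounded_eq_cocompact]
    exact tendsto_inv₀_nhdsNE_zero
  -- The function `g` in the coordinate `1 / z`, with the removable singularity at infinity filled
  -- in.
  set G : ℂ → ℂ := Function.update (fun ζ => g ζ⁻¹) 0 0 with hG
  have hGne : ∀ ζ ≠ 0, G ζ = g ζ⁻¹ := fun ζ hζ => Function.update_of_ne hζ _ _
  have hG0 : G 0 = 0 := Function.update_self _ _ _
  have hGc : ContinuousAt G 0 := continuousAt_update_same.mpr (h0.comp hinv)
  have hGa : AnalyticAt ℂ G 0 := by
    refine analyticAt_of_differentiable_on_punctured_nhds_of_continuousAt ?_ hGc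
    filter_upwards [hinv.eventually hd, self_mem_nhdsWithin] with ζ hζ hne
    have h1 : DifferentiableAt ℂ (fun ζ => g ζ⁻¹) ζ :=
      DifferentiableAt.comp ζ hζ (differentiableAt_inv hne)
    refine h1.congr_of_eventuallyEq ?_
    filter_upwards [isOpen_ne.mem_nhds hne] with y hy using hGne y hy
  have hz : ∀ z ≠ 0, G z⁻¹ = g z := fun z hz => by rw [hGne _ (inv_ne_zero hz), inv_inv]
  by_cases hev : ∀ᶠ ζ in 𝓝 0, G ζ = 0
  · left
    filter_upwards [tendsto_inv_cocompact.eventually hev, eventually_ne_zero_cocompact]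
      with z h1 h2
    rwa [hz z h2] at h1
  · right
    obtain ⟨n, k, hk, hk0, hGk⟩ := hGa.exists_eventuallyEq_pow_smul_nonzero_iff.mpr hev
    refine ⟨n, k 0, ?_, hk0, ?_⟩
    · rintro rfl
      have := hGk.self_of_nhds
      simp [hG0] at this
      exact hk0 this.symm
    · refine (hk.continuousAt.tendsto.comp tendsto_inv_cocompact).congr' ?_
      filter_upwards [tendsto_inv_cocompact.eventually hGk, eventually_ne_zero_cocompact]
        with z h1 h2
      rw [hz z h2, sub_zero, smul_eq_mul] at h1
      rw [Function.comp_apply, h1, ← mul_assoc, ← mul_pow, mul_inv_cancel₀ h2, one_pow, one_mul]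

/-- Let `f` and `g` be half the sum and half the difference. Then `‖f‖ + ‖g‖² / 2 ≤ 1`, so a small
multiple of `g²`, amplified by a power of `z`, can be added to `f` without leaving the unit ball. If
`g` has a zero of finite order at infinity, this increases the extremal coefficient. -/
theorem IsAhlfors.eventually_eq {E : Set ℝ} (hE : IsCompact E) {Ψ₁ Ψ₂ : ℂ → ℂ}
    (h₁ : IsAhlfors E Ψ₁) (h₂ : IsAhlfors E Ψ₂) : ∀ᶠ z in cocompact ℂ, Ψ₁ z = Ψ₂ z := by
  obtain ⟨ha₁, κ, hκ, hl₁, hm₁⟩ := h₁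
  obtain ⟨ha₂, κ', hκ', hl₂, hm₂⟩ := h₂
  have hκκ : κ = κ' := by
    refine le_antisymm ?_ ?_
    · simpa [abs_of_pos hκ] using hm₂ _ _ ha₁ hl₁
    · simpa [abs_of_pos hκ'] using hm₁ _ _ ha₂ hl₂
  subst hκκ
  have hEc : IsCompact (realImage E) := hE.image continuous_ofReal
  have hopen := isOpen_compl hE.isClosed
  set f : ℂ → ℂ := fun z => (Ψ₁ z + Ψ₂ z) / 2 with hf
  set g : ℂ → ℂ := fun z => (Ψ₁ z - Ψ₂ z) / 2 with hg
  have hfd : DifferentiableOn ℂ f (realImage E)ᶜ := fun z hz =>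
    ((ha₁.differentiableOn z hz).add (ha₂.differentiableOn z hz)).div_const 2
  have hgd : DifferentiableOn ℂ g (realImage E)ᶜ := fun z hz =>
    ((ha₁.differentiableOn z hz).sub (ha₂.differentiableOn z hz)).div_const 2
  have hf0 : Tendsto f (cocompact ℂ) (𝓝 0) := by
    simpa using (ha₁.tendsto_zero.add ha₂.tendsto_zero).div_const 2
  have hg0 : Tendsto g (cocompact ℂ) (𝓝 0) := by
    simpa using (ha₁.tendsto_zero.sub ha₂.tendsto_zero).div_const 2
  have hfl : Tendsto (fun z => z * f z) (cocompact ℂ) (𝓝 κ) := by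
    have := (hl₁.add hl₂).div_const 2
    rw [add_self_div_two] at this
    refine this.congr fun z => ?_
    simp only [hf]; ring
  have hfg : ∀ z ∈ (realImage E)ᶜ, ‖f z‖ + ‖g z‖ ^ 2 / 2 ≤ 1 := fun z hz =>
    norm_half_add_le (ha₁.norm_le z hz) (ha₂.norm_le z hz)
  have hdiff : ∀ᶠ z in cocompact ℂ, DifferentiableAt ℂ g z := by
    filter_upwards [hEc.compl_mem_cocompact] with z hz
    exact hgd.differentiableAt (hopen.mem_nhds hz)
  rcases eventually_eq_zero_or_tendsto_pow_mul hdiff hg0 with hev | ⟨n, a, hn, ha, hlim⟩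
  · filter_upwards [hev] with z hz
    simp only [hg] at hz
    exact sub_eq_zero.mp (by simpa using hz)
  exfalso
  obtain ⟨R, hR⟩ := hEc.isBounded.subset_ball 0
  set r : ℝ := max R 1 with hr
  have hr1 : 1 ≤ r := le_max_right _ _
  have hEr : ∀ z : ℂ, r ≤ ‖z‖ → z ∈ (realImage E)ᶜ := fun z hz hzE => by
    have := hR hzE
    rw [mem_ball_zero_iff] at this
    exact absurd ((le_max_left R 1).trans hz) (not_le.mpr this)
  -- The size is chosen so that `‖δ‖ r ^ (2n - 1) = 1/2`, and the phase `conj (a ^ 2)` so that the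
  -- gain `δ a²` is positive.
  set ε : ℝ := 1 / (2 * ‖a‖ ^ 2 * r ^ (2 * n - 1)) with hε
  have hεpos : 0 < ε := by positivity
  set δ : ℂ := ε * conj (a ^ 2) with hδ
  have hδn : ‖δ‖ * r ^ (2 * n - 1) = 1 / 2 := by
    rw [hδ, norm_mul, norm_conj, norm_real, Real.norm_of_nonneg hεpos.le, norm_pow, hε]
    field_simp
  -- The exponent is such that the perturbation times `z` is `δ (z ^ n g)²`, with limit `δ a²`. For
  -- `‖z‖ ≤ r` the bound is absorbed by `‖g‖² / 2`; beyond, the maximum principle in the exterior of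
  -- the disc takes over.
  set h : ℂ → ℂ := fun z => f z + δ * z ^ (2 * n - 1) * g z ^ 2 with hh
  have hhd : DifferentiableOn ℂ h (realImage E)ᶜ := fun z hz =>
    (hfd z hz).add (DifferentiableWithinAt.mul (by fun_prop) ((hgd z hz).pow 2))
  have hhl : Tendsto (fun z => z * h z) (cocompact ℂ) (𝓝 (κ + δ * a ^ 2)) := by
    refine (hfl.add ((hlim.pow 2).const_mul δ)).congr fun z => ?_
    have : z ^ (2 * n) = z * z ^ (2 * n - 1) := by
      rw [← pow_succ', Nat.sub_add_cancel (by lia)]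
    simp only [hh]
    rw [mul_pow, ← pow_mul, mul_comm n 2, this]
    ring
  have hh0 := tendsto_of_tendsto_mul hhl
  have hin : ∀ z ∈ (realImage E)ᶜ, ‖z‖ ≤ r → ‖h z‖ ≤ 1 := fun z hz hzr => by
    refine (norm_add_le _ _).trans (le_trans ?_ (hfg z hz))
    gcongr
    rw [norm_mul, norm_mul, norm_pow, norm_pow]
    calc ‖δ‖ * ‖z‖ ^ (2 * n - 1) * ‖g z‖ ^ 2 ≤ ‖δ‖ * r ^ (2 * n - 1) * ‖g z‖ ^ 2 := by gcongr
      _ = ‖g z‖ ^ 2 / 2 := by rw [hδn]; ring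
  have hadm : IsAdmissible E h := by
    refine ⟨hhd, fun z hz => ?_, hh0⟩
    rcases le_total ‖z‖ r with hzr | hzr
    · exact hin z hz hzr
    · exact norm_le_of_exterior (R := r) (hhd.mono fun w hw => hEr w (le_of_lt hw))
        (hhd.continuousOn.mono fun w hw => hEr w hw) (fun w hw => hin w (hEr w hw.ge) hw.le)
        zero_le_one hh0 hzr
  have hle := hm₁ h _ hadm hhl
  have hval : (κ + δ * a ^ 2 : ℂ) = ((κ + ε * ‖a ^ 2‖ ^ 2 : ℝ) : ℂ) := by
    rw [hδ, mul_assoc, conj_mul']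
    push_cast
    ring
  rw [hval, norm_real, Real.norm_of_nonneg (by positivity)] at hle
  have : 0 < ε * ‖a ^ 2‖ ^ 2 :=
    mul_pos hεpos (pow_pos (norm_pos_iff.mpr (pow_ne_zero 2 ha)) 2)
  linarith

/-! ### The function `Δ_E` -/

theorem eventually_cocompact_not_mem_of_finite {S : Set ℂ} (hS : S.Finite) :
    ∀ᶠ z in cocompact ℂ, z ∉ S :=
  hS.isCompact.compl_mem_cocompact

theorem polynomial_eq_zero_of_eventually {P : Polynomial ℂ}
    (h : ∀ᶠ z in cocompact ℂ, P.eval z = 0) : P = 0 := by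
  refine Polynomial.eq_zero_of_infinite_isRoot P fun hfin => ?_
  obtain ⟨z, h1, h2⟩ := (h.and (eventually_cocompact_not_mem_of_finite hfin)).exists
  exact h2 h1

theorem eventually_eval_ne_zero {P : Polynomial ℂ} (hP : P ≠ 0) :
    ∀ᶠ z in cocompact ℂ, P.eval z ≠ 0 :=
  eventually_cocompact_not_mem_of_finite
    (S := {z | P.eval z = 0}) (Polynomial.finite_setOfPred_isRoot hP)

/-- Evaluation of a quotient of polynomials. -/
theorem eval_div_algebraMap {P Q : Polynomial ℂ} {z : ℂ} (hz : Q.eval z ≠ 0) :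
    RatFunc.eval (RingHom.id ℂ) z
      (algebraMap (Polynomial ℂ) (RatFunc ℂ) P / algebraMap (Polynomial ℂ) (RatFunc ℂ) Q) =
      P.eval z / Q.eval z := by
  have hQ : Q ≠ 0 := by rintro rfl; simp at hz
  set x : RatFunc ℂ :=
    algebraMap (Polynomial ℂ) (RatFunc ℂ) P / algebraMap (Polynomial ℂ) (RatFunc ℂ) Q with hx
  have h1 : x.num * Q = P * x.denom := (RatFunc.num_mul_eq_mul_denom_iff hQ).mpr hx
  have h2 : x.denom.eval z ≠ 0 := by
    obtain ⟨R, hR⟩ := RatFunc.denom_div_dvd P Q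
    intro h0
    rw [hR, Polynomial.eval_mul, ← hx, h0, zero_mul] at hz
    exact hz rfl
  rw [RatFunc.eval, Polynomial.eval₂_id, Polynomial.eval₂_id, div_eq_div_iff h2 hz]
  simpa using congrArg (Polynomial.eval z) h1

theorem ratFunc_eq_of_eventually_eval_eq {D₁ D₂ : RatFunc ℂ}
    (h : ∀ᶠ z in cocompact ℂ, D₁.eval (RingHom.id ℂ) z = D₂.eval (RingHom.id ℂ) z) : D₁ = D₂ := by
  have hP : D₁.num * D₂.denom - D₂.num * D₁.denom = 0 := by
    refine polynomial_eq_zero_of_eventually ?_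
    filter_upwards [h, eventually_eval_ne_zero D₁.denom_ne_zero,
      eventually_eval_ne_zero D₂.denom_ne_zero] with z hz h1 h2
    rw [RatFunc.eval, RatFunc.eval] at hz
    simp only [Polynomial.eval₂_id] at hz
    rw [div_eq_div_iff h1 h2] at hz
    simp [hz]
  rw [← RatFunc.num_div_denom D₁, ← RatFunc.num_div_denom D₂, div_eq_div_iff
    (RatFunc.algebraMap_ne_zero D₁.denom_ne_zero) (RatFunc.algebraMap_ne_zero D₂.denom_ne_zero),
    ← map_mul, ← map_mul, sub_eq_zero.mp hP]

/-- Agreement of the two Ahlfors functions near infinity is enough for rational functions; there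
they are nonzero because `z Ψ(z)` has a nonzero limit. -/
theorem IsDelta.unique {E : Set ℝ} (hE : IsCompact E) {D₁ D₂ : RatFunc ℂ} (h₁ : IsDelta E D₁)
    (h₂ : IsDelta E D₂) : D₁ = D₂ := by
  obtain ⟨Ψ₁, ha₁, hD₁⟩ := h₁
  obtain ⟨Ψ₂, ha₂, hD₂⟩ := h₂
  have heq := ha₁.eventually_eq hE ha₂
  obtain ⟨-, κ, hκ, hl, -⟩ := ha₁
  refine ratFunc_eq_of_eventually_eval_eq ?_
  filter_upwards [heq, (hE.image continuous_ofReal).compl_mem_cocompact,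
    hl.eventually_ne (ofReal_ne_zero.mpr hκ.ne')] with z h1 h2 h3
  have hne : Ψ₁ z ≠ 0 := right_ne_zero_of_mul h3
  rw [hD₁ z h2 hne, hD₂ z h2 (h1 ▸ hne), h1]

theorem IsDelta.deltaE_eq {E : Set ℝ} (hE : IsCompact E) {D : RatFunc ℂ} (h : IsDelta E D) :
    deltaE E = D :=
  IsDelta.unique hE (Classical.epsilon_spec ⟨D, h⟩) h

/-- With `s² = U / V` and `Ψ = (s - 1) / (s + 1)`, one finds `Ψ + 1/Ψ = 2 (s² + 1) / (s² - 1)`, in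
which only `s²` occurs. -/
theorem IsAhlforsSquare.deltaE_eq {E : Set ℝ} (hE : IsCompact E) {U V : Polynomial ℂ}
    {X : Finset ℝ} {κ : ℝ} (h : IsAhlforsSquare E (fun z => U.eval z / V.eval z) X κ)
    (hV : ∀ z ∈ (realImage E)ᶜ, V.eval z ≠ 0) :
    deltaE E = algebraMap (Polynomial ℂ) (RatFunc ℂ) (2 * (U + V)) /
      algebraMap (Polynomial ℂ) (RatFunc ℂ) (U - V) := by
  refine IsDelta.deltaE_eq hE ⟨_, h.isAhlfors hE, fun z hz hne => ?_⟩
  have hsl := h.mem_slitPlane z hz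
  have hs := IsAhlforsSquare.exp_half_log_sq hsl
  have hs1 := IsAhlforsSquare.exp_half_log_add_one_ne_zero hsl
  have hVz := hV z hz
  rw [IsAhlforsSquare.psi] at hne ⊢
  set s := exp (log (U.eval z / V.eval z) / 2) with hsdef
  have hs2 : s - 1 ≠ 0 := (div_ne_zero_iff.mp hne).1
  have hU : U.eval z = s ^ 2 * V.eval z := by rw [hs, div_mul_cancel₀ _ hVz]
  have hUV : (U - V).eval z = (s - 1) * (s + 1) * V.eval z := by
    rw [Polynomial.eval_sub, hU]; ring
  rw [eval_div_algebraMap (by rw [hUV]; exact mul_ne_zero (mul_ne_zero hs2 hs1) hVz), hUV]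
  simp only [Polynomial.eval_mul, Polynomial.eval_add, Polynomial.eval_ofNat, hU]
  field_simp
  ring

end GMP

namespace GMP

open Complex ComplexConjugate

/-! ### Finite gap sets -/

/-- The intervals `[l j, r j]` are non-degenerate, disjoint and ordered. -/
structure IsBands {n : ℕ} (l r : Fin (n + 1) → ℝ) : Prop where
  lt : ∀ j, l j < r j
  gap : ∀ j : Fin n, r j.castSucc < l j.succ

namespace IsBands

variable {n : ℕ} {l r : Fin (n + 1) → ℝ}

theorem strictMono_left (h : IsBands l r) : StrictMono l :=
  Fin.strictMono_iff_lt_succ.mpr fun j => (h.lt _).trans (h.gap j)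

theorem strictMono_right (h : IsBands l r) : StrictMono r :=
  Fin.strictMono_iff_lt_succ.mpr fun j => (h.gap j).trans (h.lt _)

theorem right_lt_left (h : IsBands l r) {i j : Fin (n + 1)} (hij : i < j) : r i < l j := by
  induction i using Fin.lastCases with
  | last => exact absurd hij (not_lt.mpr (Fin.le_last j))
  | cast i =>
    exact (h.gap i).trans_le
      (h.strictMono_left.monotone (Fin.castSucc_lt_iff_succ_le.mp hij))

theorem mul_pos_of_mem (h : IsBands l r) {x : ℝ} {j i : Fin (n + 1)}
    (hx : x ∈ Set.Icc (l j) (r j)) (hij : i ≠ j) : 0 < (x - l i) * (x - r i) := by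
  rcases lt_or_gt_of_ne hij with hlt | hlt
  · have h1 := h.right_lt_left hlt
    have h2 := h.lt i
    exact mul_pos (by linarith [hx.1]) (by linarith [hx.1])
  · have h1 := h.right_lt_left hlt
    have h2 := h.lt i
    exact mul_pos_of_neg_of_neg (by linarith [hx.2]) (by linarith [hx.2])

theorem prod_mul_prod_pos {x : ℝ} (hx : x ∉ ⋃ j, Set.Icc (l j) (r j)) (h : IsBands l r) :
    0 < (∏ j, (x - l j)) * ∏ j, (x - r j) := by
  rw [← Finset.prod_mul_distrib]
  refine Finset.prod_pos fun j _ => ?_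
  simp only [Set.mem_iUnion, Set.mem_Icc, not_exists, not_and, not_le] at hx
  have h2 := h.lt j
  rcases lt_or_ge x (l j) with hlt | hge
  · exact mul_pos_of_neg_of_neg (by linarith) (by linarith)
  · have := hx j hge
    exact mul_pos (by linarith) (by linarith)

theorem prod_mul_prod_nonpos {x : ℝ} (hx : x ∈ ⋃ j, Set.Icc (l j) (r j)) (h : IsBands l r) :
    (∏ j, (x - l j)) * ∏ j, (x - r j) ≤ 0 := by
  obtain ⟨j, hj⟩ := Set.mem_iUnion.mp hx
  rw [← Finset.prod_mul_distrib, ← Finset.mul_prod_erase _ _ (Finset.mem_univ j)]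
  refine mul_nonpos_of_nonpos_of_nonneg
    (mul_nonpos_of_nonneg_of_nonpos (by linarith [hj.1]) (by linarith [hj.2]))
    (Finset.prod_nonneg fun i hi => (h.mul_pos_of_mem hj (Finset.ne_of_mem_erase hi)).le)

theorem prod_ne_zero_or (h : IsBands l r) (x : ℝ) :
    ∏ j, (x - l j) ≠ 0 ∨ ∏ j, (x - r j) ≠ 0 := by
  by_contra! hcon
  obtain ⟨i, -, hi⟩ := Finset.prod_eq_zero_iff.mp hcon.1
  obtain ⟨k, -, hk⟩ := Finset.prod_eq_zero_iff.mp hcon.2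
  have hxi : x ∈ Set.Icc (l i) (r i) := ⟨by linarith, by linarith [h.lt i]⟩
  rcases eq_or_ne k i with rfl | hne
  · linarith [h.lt k]
  · have := h.mul_pos_of_mem hxi hne
    rw [hk, mul_zero] at this
    exact lt_irrefl _ this

/-- Each gap between bands contributes a nonnegative drop of `φ`, so the drops over the bands sum to
at most the total drop. -/
theorem sum_sub_le (φ : ℝ → ℝ) (hφ : Antitone φ) :
    ∀ {n : ℕ} {l r : Fin (n + 1) → ℝ}, IsBands l r →
      ∑ j, (φ (l j) - φ (r j)) ≤ φ (l 0) - φ (r (Fin.last n))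
  | 0, l, r, _ => by simp
  | n + 1, l, r, h => by
    have h' : IsBands (fun j : Fin (n + 1) => l j.castSucc) (fun j => r j.castSucc) :=
      ⟨fun j => h.lt _, fun j => by simpa using h.gap j.castSucc⟩
    have ih := sum_sub_le φ hφ h'
    rw [Fin.sum_univ_castSucc]
    have := hφ (h.gap (Fin.last n)).le
    simp only [Fin.castSucc_zero, Fin.succ_last] at ih this
    linarith

end IsBands

/-- The polar form of `z - x` for `z` in the upper half plane. -/
theorem exists_pos_sub_eq {z : ℂ} (hz : 0 < z.im) (x : ℝ) :
    ∃ m : ℝ, 0 < m ∧ z - x = m * (I * exp (-(I * Real.arctan ((z.re - x) / z.im)))) := by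
  refine ⟨z.im * √(1 + ((z.re - x) / z.im) ^ 2), by positivity, ?_⟩
  set τ := (z.re - x) / z.im with hτ
  have hre : z.re - x = z.im * τ := by rw [hτ, mul_div_cancel₀ _ hz.ne']
  have hs : 0 < √(1 + τ ^ 2) := by positivity
  have h1 : exp (-(I * Real.arctan τ)) = (Real.cos (Real.arctan τ) : ℂ) -
      Real.sin (Real.arctan τ) * I := by
    rw [show -(I * (Real.arctan τ : ℂ)) = ((-Real.arctan τ : ℝ) : ℂ) * I by push_cast; ring,
      exp_mul_I, ← ofReal_cos, ← ofReal_sin, Real.cos_neg, Real.sin_neg]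
    push_cast
    ring
  rw [h1, Real.cos_arctan, Real.sin_arctan]
  apply Complex.ext
  · simp [hre]
    field_simp
  · simp
    field_simp

/-- The factor `(z - l) / (z - r)` has argument `-(φ l - φ r)` with `φ x = arctan ((Re z - x) / Im
z)` strictly decreasing. The total `Θ` is positive, and below `π` because the bands are disjoint and
`φ` takes values in `(-π/2, π/2)`. -/
theorem IsBands.im_neg {n : ℕ} {l r : Fin (n + 1) → ℝ} (h : IsBands l r) {z : ℂ}
    (hz : 0 < z.im) : ((∏ j, (z - l j)) / ∏ j, (z - r j)).im < 0 := by
  choose m hm hme using exists_pos_sub_eq hz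
  set φ : ℝ → ℝ := fun x => Real.arctan ((z.re - x) / z.im) with hφ
  have hanti : StrictAnti φ := fun x y hxy =>
    Real.arctan_strictMono (div_lt_div_of_pos_right (by linarith) hz)
  have hprod : (∏ j, (z - l j)) / ∏ j, (z - r j) =
      ((∏ j, m (l j) / m (r j) : ℝ) : ℂ) * exp (((-∑ j, (φ (l j) - φ (r j)) : ℝ) : ℂ) * I) := by
    have : exp (((-∑ j, (φ (l j) - φ (r j)) : ℝ) : ℂ) * I) =
        ∏ j, exp (-((φ (l j) - φ (r j)) * I)) := by
      rw [← exp_sum]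
      push_cast
      rw [Finset.sum_neg_distrib, ← Finset.sum_mul, neg_mul]
    rw [this, ofReal_prod, ← Finset.prod_mul_distrib, ← Finset.prod_div_distrib]
    refine Finset.prod_congr rfl fun j _ => ?_
    have hr : (m (r j) : ℂ) ≠ 0 := ofReal_ne_zero.mpr (hm _).ne'
    rw [hme (l j), hme (r j), mul_div_mul_comm, mul_div_mul_left _ _ I_ne_zero, ← exp_sub]
    rw [ofReal_div, mul_comm I, mul_comm I, sub_neg_eq_add, neg_add_eq_sub, sub_mul, neg_sub]
  set Θ := ∑ j, (φ (l j) - φ (r j)) with hΘ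
  have h0 : 0 < Θ := Finset.sum_pos (fun j _ => sub_pos.mpr (hanti (h.lt j)))
    Finset.univ_nonempty
  have h1 : Θ < Real.pi := by
    have := IsBands.sum_sub_le φ hanti.antitone h
    have h2 := Real.arctan_lt_pi_div_two ((z.re - l 0) / z.im)
    have h3 := Real.neg_pi_div_two_lt_arctan ((z.re - r (Fin.last n)) / z.im)
    simp only [hφ] at this h2 h3
    linarith
  rw [hprod, im_ofReal_mul, exp_ofReal_mul_I_im, Real.sin_neg]
  have : 0 < ∏ j, m (l j) / m (r j) := Finset.prod_pos fun j _ => div_pos (hm _) (hm _)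
  nlinarith [mul_pos this (Real.sin_pos_of_pos_of_lt_pi h0 h1)]

theorem tendsto_mul_mul_sub_one {u v : ℂ → ℂ} {a b : ℂ}
    (hu : Tendsto (fun z => z * (u z - 1)) (cocompact ℂ) (𝓝 a))
    (hv : Tendsto (fun z => z * (v z - 1)) (cocompact ℂ) (𝓝 b)) :
    Tendsto (fun z => z * (u z * v z - 1)) (cocompact ℂ) (𝓝 (a + b)) := by
  have := (hu.mul (tendsto_one_of_tendsto_mul hv)).add hv
  rw [mul_one] at this
  exact this.congr fun z => by ring

theorem tendsto_mul_prod_sub_one {ι : Type*} (s : Finset ι) {u : ι → ℂ → ℂ} {a : ι → ℂ}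
    (h : ∀ i ∈ s, Tendsto (fun z => z * (u i z - 1)) (cocompact ℂ) (𝓝 (a i))) :
    Tendsto (fun z => z * (∏ i ∈ s, u i z - 1)) (cocompact ℂ) (𝓝 (∑ i ∈ s, a i)) := by
  classical
  induction s using Finset.induction_on with
  | empty => simp
  | insert i s hi ih =>
    rw [Finset.sum_insert hi]
    refine (tendsto_mul_mul_sub_one (h i (Finset.mem_insert_self _ _))
      (ih fun j hj => h j (Finset.mem_insert_of_mem hj))).congr fun z => ?_
    rw [Finset.prod_insert hi]

theorem tendsto_mul_inv_sub (r : ℂ) :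
    Tendsto (fun z => z * (z - r)⁻¹) (cocompact ℂ) (𝓝 1) := by
  have h : Tendsto (fun z : ℂ => (1 - r * z⁻¹)⁻¹) (cocompact ℂ) (𝓝 (1 - r * 0)⁻¹) :=
    ((tendsto_inv_cocompact.const_mul r).const_sub 1).inv₀ (by simp)
  simp only [mul_zero, sub_zero, inv_one] at h
  refine h.congr' ?_
  filter_upwards [eventually_ne_zero_cocompact] with z hz
  rw [show 1 - r * z⁻¹ = (z - r) * z⁻¹ by rw [sub_mul, mul_inv_cancel₀ hz], mul_inv, inv_inv,
    mul_comm]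

theorem tendsto_mul_moebius (l r : ℂ) :
    Tendsto (fun z => z * ((z - l) / (z - r) - 1)) (cocompact ℂ) (𝓝 (r - l)) := by
  have h := (tendsto_mul_inv_sub r).const_mul (r - l)
  rw [mul_one] at h
  refine h.congr' ?_
  filter_upwards [eventually_cocompact_not_mem_of_finite (Set.finite_singleton r)] with z hz
  have : z - r ≠ 0 := sub_ne_zero.mpr hz
  field_simp
  ring

/-- The monic polynomial with the given real roots. -/
noncomputable def rootPoly {n : ℕ} (l : Fin n → ℝ) : Polynomial ℂ :=
  ∏ j, (Polynomial.X - Polynomial.C (l j : ℂ))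

theorem eval_rootPoly {n : ℕ} (l : Fin n → ℝ) (z : ℂ) :
    (rootPoly l).eval z = ∏ j, (z - l j) := by
  simp [rootPoly, Polynomial.eval_prod]

theorem eval_rootPoly_ofReal {n : ℕ} (l : Fin n → ℝ) (x : ℝ) :
    (rootPoly l).eval (x : ℂ) = ((∏ j, (x - l j) : ℝ) : ℂ) := by
  simp [eval_rootPoly]

theorem eval_rootPoly_conj {n : ℕ} (l : Fin n → ℝ) (z : ℂ) :
    (rootPoly l).eval (conj z) = conj ((rootPoly l).eval z) := by
  simp [eval_rootPoly]

namespace IsBands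

variable {n : ℕ} {l r : Fin (n + 1) → ℝ} {E : Set ℝ}

theorem mem_slitPlane (h : IsBands l r) (hE : E = ⋃ j, Set.Icc (l j) (r j)) {z : ℂ}
    (hz : z ∈ (realImage E)ᶜ) : (rootPoly l).eval z / (rootPoly r).eval z ∈ slitPlane := by
  rcases lt_trichotomy z.im 0 with him | him | him
  · have := h.im_neg (z := conj z) (by simpa using him)
    rw [← eval_rootPoly, ← eval_rootPoly, eval_rootPoly_conj, eval_rootPoly_conj, ← map_div₀,
      conj_im] at this
    exact Or.inr (by linarith)
  · have hzr : z = (z.re : ℂ) := Complex.ext rfl him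
    have hx : z.re ∉ E := fun hx => hz ⟨z.re, hx, hzr.symm⟩
    rw [hE] at hx
    have hp := h.prod_mul_prod_pos hx
    rw [hzr, eval_rootPoly_ofReal, eval_rootPoly_ofReal, ← ofReal_div, ofReal_mem_slitPlane]
    rcases pos_and_pos_or_neg_and_neg_of_mul_pos hp with hp | hp
    · exact div_pos hp.1 hp.2
    · exact div_pos_of_neg_of_neg hp.1 hp.2
  · have := h.im_neg him
    rw [← eval_rootPoly, ← eval_rootPoly] at this
    exact Or.inr this.ne

theorem eval_right_ne_zero (h : IsBands l r) (hE : E = ⋃ j, Set.Icc (l j) (r j)) {z : ℂ}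
    (hz : z ∈ (realImage E)ᶜ) : (rootPoly r).eval z ≠ 0 := by
  intro h0
  have := h.mem_slitPlane hE hz
  rw [h0, div_zero] at this
  exact slitPlane_ne_zero this rfl

/-- The coefficient of `1 / z` adds up over the Möbius factors to the total length of the bands, so
the extremal value is a quarter of the length of `E`. The exceptional points are the band ends,
where the function has a zero or a pole. -/
theorem isAhlforsSquare (h : IsBands l r) (hE : E = ⋃ j, Set.Icc (l j) (r j)) :
    IsAhlforsSquare E (fun z => (rootPoly l).eval z / (rootPoly r).eval z)
      (Finset.univ.image l ∪ Finset.univ.image r) ((∑ j, (r j - l j)) / 4) where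
  differentiableOn z hz := ((rootPoly l).differentiableAt.div (rootPoly r).differentiableAt
    (h.eval_right_ne_zero hE hz)).differentiableWithinAt
  mem_slitPlane z hz := h.mem_slitPlane hE hz
  im_neg z hz := by
    rw [eval_rootPoly, eval_rootPoly]
    exact h.im_neg hz
  im_eq_zero x _ := by
    rw [eval_rootPoly_ofReal, eval_rootPoly_ofReal, ← ofReal_div, ofReal_im]
  boundary x hx hX := by
    rw [eval_rootPoly_ofReal, eval_rootPoly_ofReal, ← ofReal_div, ofReal_im, ofReal_re]
    simp only [Finset.mem_union, Finset.mem_image, Finset.mem_univ, true_and, not_or,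
      not_exists] at hX
    have hl : ∏ j, (x - l j) ≠ 0 :=
      Finset.prod_ne_zero_iff.mpr fun j _ e => hX.1 j (sub_eq_zero.mp e).symm
    have hr : ∏ j, (x - r j) ≠ 0 :=
      Finset.prod_ne_zero_iff.mpr fun j _ e => hX.2 j (sub_eq_zero.mp e).symm
    refine ⟨?_, ?_, rfl⟩
    · refine ((rootPoly l).continuousAt.div (rootPoly r).continuousAt ?_)
      rw [eval_rootPoly_ofReal]
      exact ofReal_ne_zero.mpr hr
    · rw [hE] at hx
      have hneg := lt_of_le_of_ne (h.prod_mul_prod_nonpos hx) (mul_ne_zero hl hr)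
      rw [← mul_div_mul_right _ _ hr]
      exact div_neg_of_neg_of_pos hneg (mul_self_pos.mpr hr)
  pos := div_pos (Finset.sum_pos (fun j _ => sub_pos.mpr (h.lt j)) Finset.univ_nonempty)
    (by norm_num)
  tendsto := by
    have := tendsto_mul_prod_sub_one Finset.univ
      (fun (j : Fin (n + 1)) _ => tendsto_mul_moebius (l j) (r j))
    simp only [Finset.prod_div_distrib] at this
    have hlim : (4 * (((∑ j, (r j - l j)) / 4 : ℝ) : ℂ)) = ∑ j, ((r j : ℂ) - l j) := by
      push_cast
      ring
    rw [hlim]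
    simpa only [eval_rootPoly] using this

end IsBands

theorem IsFiniteGapSet.exists_isBands {E : Set ℝ} (hE : IsFiniteGapSet E) :
    ∃ (n : ℕ) (l r : Fin (n + 1) → ℝ), IsBands l r ∧ E = ⋃ j, Set.Icc (l j) (r j) := by
  obtain ⟨n, a, b, h0, hgap, hord, rfl⟩ := hE
  -- Band `j` runs from `b j` to the start `a (j + 1)` of the next gap; the last band ends at `a 0`,
  -- the right end of `E`.
  set r : Fin (n + 1) → ℝ := Fin.snoc (α := fun _ => ℝ) (fun j : Fin n => a j.succ) (a 0) with hr
  have hrl : r (Fin.last n) = a 0 := by simp [hr]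
  have hrc : ∀ j : Fin n, r j.castSucc = a j.succ := fun j => by simp [hr]
  have hB : IsBands b r := by
    refine ⟨fun j => ?_, fun j => by rw [hrc]; exact (hgap j).2.1⟩
    induction j using Fin.lastCases with
    | last =>
      rw [hrl]
      rcases Fin.eq_zero_or_eq_succ (Fin.last n) with h | ⟨k, h⟩
      · rw [h]; exact h0
      · rw [h]; exact (hgap k).2.2
    | cast i =>
      rw [hrc]
      rcases Fin.eq_zero_or_eq_succ i.castSucc with h | ⟨k, h⟩
      · rw [h]; exact (hgap i).1
      · rw [h]
        refine hord k i ?_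
        have := congrArg Fin.val h
        simp only [Fin.val_castSucc, Fin.val_succ] at this
        exact Fin.lt_def.mpr (by lia)
  refine ⟨n, b, r, hB, ?_⟩
  ext x
  simp only [Set.mem_sdiff, Set.mem_iUnion, not_exists, Set.mem_Icc, Set.mem_Ioo, not_and, not_lt]
  constructor
  · rintro ⟨⟨hx0, hx1⟩, hx⟩
    by_contra! hcon
    -- A point in no band that lies right of `b j` lies right of that band, and, being in no gap,
    -- right of `b (j + 1)`. At the last band this contradicts `x ≤ a 0`.
    have key : ∀ j : Fin (n + 1), b j ≤ x := fun j => by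
      induction j using Fin.induction with
      | zero => exact hx0
      | succ j ih =>
        refine hx j ?_
        rw [← hrc]
        exact hcon _ ih
    have := hcon _ (key (Fin.last n))
    rw [hrl] at this
    exact absurd hx1 (not_le.mpr this)
  · rintro ⟨j, hj⟩
    refine ⟨⟨(hB.strictMono_left.monotone (Fin.zero_le j)).trans hj.1, ?_⟩, fun i hi => ?_⟩
    · rw [← hrl]
      exact hj.2.trans (hB.strictMono_right.monotone (Fin.le_last j))
    · rcases le_or_gt j i.castSucc with hji | hji
      · rw [← hrc] at hi
        exact absurd (hj.2.trans (hB.strictMono_right.monotone hji)) (not_le.mpr hi)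
      · exact (hB.strictMono_left.monotone (Fin.castSucc_lt_iff_succ_le.mp hji)).trans hj.1

theorem IsFiniteGapSet.isCompact {E : Set ℝ} (hE : IsFiniteGapSet E) : IsCompact E := by
  obtain ⟨n, l, r, -, rfl⟩ := hE.exists_isBands
  exact isCompact_iUnion fun j => isCompact_Icc

/-- The preimage of `[-2, 2]` under `Δ_E` is `E`. -/
theorem IsFiniteGapSet.mem_iff_of_deltaE_eq {E : Set ℝ} (hE : IsFiniteGapSet E)
    {N M : Polynomial ℂ} (hM : M ≠ 0) (hNM : ∀ z, M.eval z = 0 → N.eval z ≠ 0)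
    (h : algebraMap (Polynomial ℂ) (RatFunc ℂ) N / algebraMap (Polynomial ℂ) (RatFunc ℂ) M =
      deltaE E) (z : ℂ) :
    z ∈ realImage E ↔ ∃ t ∈ Set.Icc (-2 : ℝ) 2, M.eval z ≠ 0 ∧ N.eval z = t * M.eval z := by
  obtain ⟨n, l, r, hB, hEB⟩ := hE.exists_isBands
  rw [(hB.isAhlforsSquare hEB).deltaE_eq hE.isCompact
    (fun z hz => hB.eval_right_ne_zero hEB hz)] at h
  set U := rootPoly l
  set V := rootPoly r
  have hUV : U - V ≠ 0 := fun h0 => by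
    have h1 : U.eval (l 0 : ℂ) = 0 := by
      rw [eval_rootPoly]
      exact Finset.prod_eq_zero (Finset.mem_univ 0) (sub_self _)
    have h2 := hB.prod_ne_zero_or (l 0)
    rw [sub_eq_zero.mp h0, eval_rootPoly_ofReal, ofReal_eq_zero] at h1
    rcases h2 with h2 | h2
    · exact h2 (Finset.prod_eq_zero (Finset.mem_univ 0) (sub_self _))
    · exact h2 h1
  rw [div_eq_div_iff (RatFunc.algebraMap_ne_zero hM) (RatFunc.algebraMap_ne_zero hUV),
    ← map_mul, ← map_mul] at h
  have hpoly := congrArg (Polynomial.eval z) (RatFunc.algebraMap_injective ℂ h)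
  simp only [Polynomial.eval_mul, Polynomial.eval_sub, Polynomial.eval_add,
    Polynomial.eval_ofNat] at hpoly
  constructor
  · rintro ⟨x, hx, rfl⟩
    have hx' := hx
    rw [hEB] at hx'
    have hle := hB.prod_mul_prod_nonpos hx'
    have hor := hB.prod_ne_zero_or x
    simp only [U, V, eval_rootPoly_ofReal] at hpoly
    set u := ∏ j, (x - l j)
    set v := ∏ j, (x - r j)
    have huv : u - v ≠ 0 := fun h0 => by
      rw [sub_eq_zero.mp h0] at hle hor
      rw [or_self] at hor
      exact absurd (mul_self_pos.mpr hor) (not_lt.mpr hle)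
    have huvc : ((u : ℂ) - v) ≠ 0 := by exact_mod_cast huv
    -- This is the value of `Δ_E` at `x`; it lies in `[-2, 2]` because `u v ≤ 0` gives `|u + v| ≤ |u
    -- - v|`.
    refine ⟨2 * (u + v) / (u - v), ?_, ?_, ?_⟩
    · have h2 : |2 * (u + v) / (u - v)| ≤ 2 := by
        rw [abs_div, div_le_iff₀ (abs_pos.mpr huv), abs_mul, abs_two]
        exact mul_le_mul_of_nonneg_left (sq_le_sq.mp (by nlinarith)) zero_le_two
      exact abs_le.mp h2
    · intro h0
      rw [h0, mul_zero] at hpoly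
      exact hNM _ h0 ((mul_eq_zero.mp hpoly).resolve_right huvc)
    · push_cast
      field_simp
      exact hpoly.trans (by ring)
  · rintro ⟨t, ht, hMz, hN⟩
    by_contra hz
    have hsl := hB.mem_slitPlane hEB (z := z) hz
    have hV := hB.eval_right_ne_zero hEB (z := z) hz
    change U.eval z / V.eval z ∈ slitPlane at hsl
    change V.eval z ≠ 0 at hV
    rw [hN] at hpoly
    have h1 : (t - 2) * U.eval z = (t + 2) * V.eval z := by
      have : M.eval z * ((t - 2) * U.eval z - (t + 2) * V.eval z) = 0 := by
        linear_combination hpoly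
      exact sub_eq_zero.mp ((mul_eq_zero.mp this).resolve_left hMz)
    rcases ht.2.eq_or_lt with rfl | hlt
    · have : ((2 : ℝ) + 2 : ℂ) ≠ 0 := by norm_num
      rw [ofReal_ofNat, sub_self, zero_mul] at h1
      exact (mul_ne_zero (by norm_num) hV) h1.symm
    · have ht2 : (t - 2 : ℂ) ≠ 0 := by
        rw [← ofReal_ofNat, ← ofReal_sub, ofReal_ne_zero]
        exact (sub_neg.mpr hlt).ne
      -- A value `t` in `[-2, 2)` corresponds to a nonpositive value of `W`, which is excluded off
      -- `E`.
      have hW : U.eval z / V.eval z = (((t + 2) / (t - 2) : ℝ) : ℂ) := by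
        push_cast
        rw [div_eq_div_iff hV ht2]
        linear_combination h1
      rw [hW, ofReal_mem_slitPlane] at hsl
      exact absurd hsl (not_lt.mpr (div_nonpos_of_nonneg_of_nonpos (by linarith [ht.1])
        (by linarith)))

end GMP

namespace GMP

open Complex ComplexConjugate

/-! ### Rational functions with a partial fraction expansion -/

section PartialFractions

variable {g : ℕ}

/-- The denominator `∏ (c_k - z)`. -/
noncomputable def pfDen (c : Fin g → ℝ) : Polynomial ℂ :=
  ∏ k, (Polynomial.C (c k : ℂ) - Polynomial.X)

/-- The numerator of `α z + β + ∑ ν_k / (c_k - z)`. -/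
noncomputable def pfNum (c : Fin g → ℝ) (α β : ℝ) (ν : Fin g → ℝ) : Polynomial ℂ :=
  (Polynomial.C (α : ℂ) * Polynomial.X + Polynomial.C (β : ℂ)) * pfDen c +
    ∑ k, Polynomial.C (ν k : ℂ) *
      ∏ j ∈ Finset.univ.erase k, (Polynomial.C (c j : ℂ) - Polynomial.X)

/-- Only inverses of `c_k - z` are needed, so the same identity serves for complex `z` and for the
variable of `RatFunc ℂ`. -/
theorem aeval_pfNum (c : Fin g → ℝ) (α β : ℝ) (ν : Fin g → ℝ) {L : Type*} [CommRing L]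
    [Algebra ℂ L] {z : L} {r : Fin g → L} (hr : ∀ k, r k * (algebraMap ℂ L (c k) - z) = 1) :
    Polynomial.aeval z (pfNum c α β ν) =
      (algebraMap ℂ L α * z + algebraMap ℂ L β + ∑ k, algebraMap ℂ L (ν k) * r k) *
        Polynomial.aeval z (pfDen c) := by
  simp only [pfNum, pfDen, map_add, map_mul, map_sum, map_prod, map_sub, Polynomial.aeval_C,
    Polynomial.aeval_X]
  rw [add_mul _ (∑ k, _) (∏ k, _), Finset.sum_mul]
  congr 1
  refine Finset.sum_congr rfl fun k _ => ?_
  rw [← Finset.mul_prod_erase _ _ (Finset.mem_univ k), mul_assoc, ← mul_assoc (r k), hr, one_mul]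

theorem eval_pfDen (c : Fin g → ℝ) (z : ℂ) : (pfDen c).eval z = ∏ k, ((c k : ℂ) - z) := by
  simp [pfDen, Polynomial.eval_prod]

theorem pfDen_ne_zero (c : Fin g → ℝ) : pfDen c ≠ 0 :=
  Finset.prod_ne_zero_iff.mpr fun k _ h => by
    have := congrArg (Polynomial.eval ((c k : ℂ) - 1)) h
    simp at this

theorem eval_pfDen_eq_zero_iff {c : Fin g → ℝ} {z : ℂ} :
    (pfDen c).eval z = 0 ↔ ∃ k, z = c k := by
  rw [eval_pfDen, Finset.prod_eq_zero_iff]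
  simp [sub_eq_zero, eq_comm]

/-- At `z = c_k` only the `k`-th residue term survives, and its remaining factors are nonzero
because the points are distinct. Hence the fraction is reduced. -/
theorem eval_pfNum_ne_zero {c : Fin g → ℝ} (hc : Function.Injective c) {α β : ℝ}
    {ν : Fin g → ℝ} (hν : ∀ k, ν k ≠ 0) {z : ℂ} (hz : (pfDen c).eval z = 0) :
    (pfNum c α β ν).eval z ≠ 0 := by
  obtain ⟨k, rfl⟩ := eval_pfDen_eq_zero_iff.mp hz
  rw [pfNum, Polynomial.eval_add, Polynomial.eval_mul, hz, mul_zero, zero_add,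
    Polynomial.eval_finsetSum, Finset.sum_eq_single k]
  · rw [Polynomial.eval_mul, Polynomial.eval_prod, Polynomial.eval_C]
    refine mul_ne_zero (ofReal_ne_zero.mpr (hν k)) (Finset.prod_ne_zero_iff.mpr fun j hj => ?_)
    simp only [Polynomial.eval_sub, Polynomial.eval_C, Polynomial.eval_X]
    rw [← ofReal_sub, ofReal_ne_zero, sub_ne_zero]
    exact fun h => Finset.ne_of_mem_erase hj (hc h)
  · intro j _ hj
    rw [Polynomial.eval_mul, Polynomial.eval_prod]
    rw [Finset.prod_eq_zero (Finset.mem_erase.mpr ⟨hj.symm, Finset.mem_univ k⟩) (by simp),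
      mul_zero]
  · simp

/-- The function `α z + β + ∑ ν_k / (c_k - z)`. -/
noncomputable def pfFun (c : Fin g → ℝ) (α β : ℝ) (ν : Fin g → ℝ) (z : ℂ) : ℂ :=
  α * z + β + ∑ k, ν k * ((c k : ℂ) - z)⁻¹

theorem eval_pfNum (c : Fin g → ℝ) (α β : ℝ) (ν : Fin g → ℝ) {z : ℂ}
    (hz : (pfDen c).eval z ≠ 0) :
    (pfNum c α β ν).eval z = pfFun c α β ν z * (pfDen c).eval z := by
  have := aeval_pfNum c α β ν (L := ℂ) (z := z) (r := fun k => ((c k : ℂ) - z)⁻¹) fun k =>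
    inv_mul_cancel₀ fun h => hz (eval_pfDen_eq_zero_iff.mpr ⟨k, (sub_eq_zero.mp h).symm⟩)
  rw [pfFun]
  simpa using this

/-- Every summand is a Herglotz function: `1 / (c - z)` has positive imaginary part when `z` does.
-/
theorem pfFun_im_pos {c : Fin g → ℝ} {α β : ℝ} {ν : Fin g → ℝ} (hα : 0 < α)
    (hν : ∀ k, 0 < ν k) {z : ℂ} (hz : 0 < z.im) : 0 < (pfFun c α β ν z).im := by
  rw [pfFun, add_im, add_im, ofReal_im, add_zero, im_ofReal_mul, im_sum]
  refine add_pos_of_pos_of_nonneg (mul_pos hα hz) (Finset.sum_nonneg fun k _ => ?_)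
  rw [im_ofReal_mul, inv_im]
  refine mul_nonneg (hν k).le (div_nonneg ?_ (normSq_nonneg _))
  simpa using hz.le

theorem pfFun_ofReal_im (c : Fin g → ℝ) (α β : ℝ) (ν : Fin g → ℝ) (x : ℝ) :
    (pfFun c α β ν x).im = 0 := by
  have : pfFun c α β ν x = ((α * x + β + ∑ k, ν k * (c k - x)⁻¹ : ℝ) : ℂ) := by
    simp [pfFun]
  rw [this, ofReal_im]

theorem tendsto_inv_mul_pfFun (c : Fin g → ℝ) (α β : ℝ) (ν : Fin g → ℝ) :
    Tendsto (fun z => z⁻¹ * pfFun c α β ν z) (cocompact ℂ) (𝓝 α) := by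
  have h1 : Tendsto (fun z : ℂ => ∑ k, (ν k : ℂ) * ((c k : ℂ) - z)⁻¹) (cocompact ℂ)
      (𝓝 (∑ k, (ν k : ℂ) * 0)) := by
    refine tendsto_finsetSum _ fun k _ => Tendsto.const_mul _ ?_
    have := (tendsto_of_tendsto_mul (tendsto_mul_inv_sub (c k : ℂ))).neg
    rw [neg_zero] at this
    refine this.congr fun z => ?_
    rw [← inv_neg, neg_sub]
  have h2 := (tendsto_inv_cocompact.mul (h1.const_add (β : ℂ))).const_add (α : ℂ)
  rw [zero_mul, add_zero] at h2
  refine h2.congr' ?_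
  filter_upwards [eventually_ne_zero_cocompact] with z hz
  rw [pfFun, add_assoc, mul_add z⁻¹ (α * z), mul_left_comm, inv_mul_cancel₀ hz, mul_one]

variable {c : Fin g → ℝ} {α β : ℝ} {ν : Fin g → ℝ} {E : Set ℝ}

/-- A rational function with positive residues is `Δ_E` for the preimage `E` of `[-2, 2]`. -/
theorem deltaE_eq_pf (hc : Function.Injective c) (hα : 0 < α) (hν : ∀ k, 0 < ν k)
    (hE : IsCompact E) (h : ∀ z : ℂ, z ∈ realImage E ↔ ∃ t ∈ Set.Icc (-2 : ℝ) 2,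
      (pfDen c).eval z ≠ 0 ∧ (pfNum c α β ν).eval z = t * (pfDen c).eval z) :
    deltaE E = algebraMap (Polynomial ℂ) (RatFunc ℂ) (pfNum c α β ν) /
      algebraMap (Polynomial ℂ) (RatFunc ℂ) (pfDen c) := by
  set N := pfNum c α β ν with hN
  set M := pfDen c with hM
  have hNM : ∀ z, M.eval z = 0 → N.eval z ≠ 0 := fun z hz =>
    eval_pfNum_ne_zero hc (fun k => (hν k).ne') hz
  have hV : ∀ z ∈ (realImage E)ᶜ, (N - 2 * M).eval z ≠ 0 := fun z hz h0 => by
    have h1 : N.eval z = (2 : ℝ) * M.eval z := by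
      simpa [sub_eq_zero] using h0
    refine hz ((h z).mpr ⟨2, by norm_num, fun hMz => hNM z hMz ?_, h1⟩)
    rw [h1, hMz, mul_zero]
  have hsl : ∀ z ∈ (realImage E)ᶜ, (N + 2 * M).eval z / (N - 2 * M).eval z ∈ slitPlane := by
    intro z hz
    by_contra hns
    rw [mem_slitPlane_iff_not_le_zero, not_not] at hns
    obtain ⟨s, hs, hse⟩ : ∃ s : ℝ, s ≤ 0 ∧ (s : ℂ) = (N + 2 * M).eval z / (N - 2 * M).eval z :=
      ⟨_, (Complex.le_def.mp hns).1, Complex.ext rfl (Complex.le_def.mp hns).2.symm⟩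
    rw [eq_div_iff (hV z hz)] at hse
    simp only [Polynomial.eval_sub, Polynomial.eval_add, Polynomial.eval_mul,
      Polynomial.eval_ofNat] at hse
    have hs1 : (1 - s : ℂ) ≠ 0 := by
      rw [← ofReal_one, ← ofReal_sub, ofReal_ne_zero]
      linarith
    -- Solving `(D + 2) / (D - 2) = s` for `D`; the half line `s ≤ 0` goes into `[-2, 2]`, so such a
    -- `z` would belong to `E`.
    have h1 : N.eval z = ((-2 * (1 + s) / (1 - s) : ℝ) : ℂ) * M.eval z := by
      push_cast
      field_simp
      linear_combination -hse
    refine hz ((h z).mpr ⟨_, ⟨?_, ?_⟩, fun hMz => hNM z hMz ?_, h1⟩)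
    · rw [le_div_iff₀ (by linarith)]; linarith
    · rw [div_le_iff₀ (by linarith)]; linarith
    · rw [h1, hMz, mul_zero]
  have hform : ∀ z, M.eval z ≠ 0 → (N + 2 * M).eval z / (N - 2 * M).eval z =
      (pfFun c α β ν z + 2) / (pfFun c α β ν z - 2) := fun z hz => by
    simp only [Polynomial.eval_sub, Polynomial.eval_add, Polynomial.eval_mul,
      Polynomial.eval_ofNat]
    rw [hN, eval_pfNum c α β ν hz, ← add_mul, ← sub_mul, mul_div_mul_right _ _ hz]
  have hMim : ∀ z : ℂ, z.im ≠ 0 → M.eval z ≠ 0 := fun z hz h0 => by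
    obtain ⟨k, rfl⟩ := eval_pfDen_eq_zero_iff.mp h0
    exact hz (ofReal_im _)
  have hreal : ∀ x : ℝ, ((N + 2 * M).eval (x : ℂ) / (N - 2 * M).eval (x : ℂ)).im = 0 := fun x => by
    by_cases hx : M.eval (x : ℂ) = 0
    · simp only [Polynomial.eval_sub, Polynomial.eval_add, Polynomial.eval_mul,
        Polynomial.eval_ofNat, hx, mul_zero, add_zero, sub_zero]
      rw [div_self (hNM _ hx), one_im]
    · rw [hform _ hx]
      have : pfFun c α β ν x = ((pfFun c α β ν x).re : ℂ) :=
        Complex.ext rfl (pfFun_ofReal_im c α β ν x)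
      rw [this]
      exact_mod_cast ofReal_im (((pfFun c α β ν x).re + 2) / ((pfFun c α β ν x).re - 2))
  -- Since `W - 1 = 4 / (D - 2)` and `D` grows like `α z`, the extremal value is `1 / α`.
  have hlim : Tendsto (fun z => z * ((N + 2 * M).eval z / (N - 2 * M).eval z - 1)) (cocompact ℂ)
      (𝓝 (4 * ((1 / α : ℝ) : ℂ))) := by
    have h1 := tendsto_inv_mul_pfFun c α β ν
    have h2 := h1.sub (tendsto_inv_cocompact.mul_const 2)
    rw [zero_mul, sub_zero] at h2
    have hα' : (α : ℂ) ≠ 0 := ofReal_ne_zero.mpr hα.ne'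
    have h3 := (h2.inv₀ hα').const_mul 4
    rw [show (4 * ((1 / α : ℝ) : ℂ)) = 4 * (α : ℂ)⁻¹ by push_cast; rw [one_div]]
    refine h3.congr' ?_
    filter_upwards [eventually_eval_ne_zero (pfDen_ne_zero c), eventually_ne_zero_cocompact,
      h2.eventually_ne hα'] with z hz h0 h4
    rw [hform z hz]
    rw [← mul_sub] at h4 ⊢
    have h5 := right_ne_zero_of_mul h4
    field_simp
    ring
  have hroots : (N + 2 * M) * (N - 2 * M) ≠ 0 := by
    have hz : ∀ᶠ z in cocompact ℂ, z ∈ (realImage E)ᶜ :=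
      (hE.image continuous_ofReal).compl_mem_cocompact
    obtain ⟨z, hz⟩ := hz.exists
    intro h0
    have := slitPlane_ne_zero (hsl z hz)
    have h3 := congrArg (Polynomial.eval z) h0
    rw [Polynomial.eval_mul, Polynomial.eval_zero, mul_eq_zero] at h3
    exact h3.elim (div_ne_zero_iff.mp this).1 (hV z hz)
  -- The exceptional points are those where `D = ±2`. In the upper half plane `W = 1 + 4 / (D - 2)`
  -- has negative imaginary part because `D` has positive imaginary part.
  have hsq : IsAhlforsSquare E (fun z => (N + 2 * M).eval z / (N - 2 * M).eval z)
      (((N + 2 * M) * (N - 2 * M)).roots.toFinset.image re) (1 / α) := by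
    refine ⟨fun z hz => ((N + 2 * M).differentiableAt.div (N - 2 * M).differentiableAt
      (hV z hz)).differentiableWithinAt, hsl, fun z hz => ?_, fun x _ => hreal x,
      fun x hx hX => ?_, by positivity, hlim⟩
    · have him := pfFun_im_pos (c := c) (β := β) hα hν hz
      have hne : pfFun c α β ν z - 2 ≠ 0 := fun h0 => by
        rw [sub_eq_zero.mp h0] at him
        simp at him
      rw [hform z (hMim z hz.ne'), show (pfFun c α β ν z + 2) / (pfFun c α β ν z - 2) =
        1 + ((4 : ℝ) : ℂ) * (pfFun c α β ν z - 2)⁻¹ by push_cast; field_simp; ring,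
        add_im, one_im, zero_add, im_ofReal_mul, inv_im]
      refine mul_neg_of_pos_of_neg (by norm_num) (div_neg_of_neg_of_pos ?_ (normSq_pos.mpr hne))
      simpa using him
    · have hUV : (N + 2 * M).eval (x : ℂ) * (N - 2 * M).eval (x : ℂ) ≠ 0 := fun h0 => hX <| by
        rw [Finset.mem_image]
        refine ⟨x, ?_, ofReal_re x⟩
        rw [Multiset.mem_toFinset, Polynomial.mem_roots hroots, Polynomial.IsRoot,
          Polynomial.eval_mul, h0]
      refine ⟨(N + 2 * M).continuousAt.div (N - 2 * M).continuousAt (right_ne_zero_of_mul hUV), ?_,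
        hreal x⟩
      obtain ⟨t, ht, hMx, hNx⟩ := (h x).mp ⟨x, hx, rfl⟩
      have hW : (N + 2 * M).eval (x : ℂ) / (N - 2 * M).eval (x : ℂ) =
          (((t + 2) / (t - 2) : ℝ) : ℂ) := by
        simp only [Polynomial.eval_sub, Polynomial.eval_add, Polynomial.eval_mul,
          Polynomial.eval_ofNat]
        rw [hNx, ← add_mul, ← sub_mul, mul_div_mul_right _ _ hMx]
        push_cast
        rfl
      have hne := div_ne_zero (left_ne_zero_of_mul hUV) (right_ne_zero_of_mul hUV)
      rw [hW, ofReal_ne_zero] at hne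
      rw [hW, ofReal_re]
      exact lt_of_le_of_ne (div_nonpos_of_nonneg_of_nonpos (by linarith [ht.1])
        (by linarith [ht.2])) hne
  rw [hsq.deltaE_eq hE hV]
  have h1 : 2 * (N + 2 * M + (N - 2 * M)) = 4 * N := by ring
  have h2 : N + 2 * M - (N - 2 * M) = 4 * M := by ring
  rw [h1, h2, map_mul, map_mul, mul_div_mul_left]
  exact RatFunc.algebraMap_ne_zero (by norm_num)

end PartialFractions

end GMP

namespace GMP

/-! ### Transfer matrices over commutative rings -/

section Transfer

/-- The matrix `(p, q)ᵀ (p, q) 𝔧`. -/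
def pqMat (p q : ℝ) : Matrix (Fin 2) (Fin 2) ℝ := !![p * q, -(p * p); q * q, -(p * q)]

variable {L : Type*} [CommRing L]

/-- The factor `𝔞(z, c; p, q)`, with `r = (c - z)⁻¹`. -/
def stepMat (φ : ℝ →+* L) (r : L) (p q : ℝ) : Matrix (Fin 2) (Fin 2) L :=
  1 - r • (pqMat p q).map φ

/-- The factor `𝔞(z; p, q)`. -/
noncomputable def lastMat (φ : ℝ →+* L) (z : L) (p q : ℝ) : Matrix (Fin 2) (Fin 2) L :=
  !![0, -φ p; φ p⁻¹, φ p⁻¹ * (z - φ (p * q))]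

/-- The transfer matrix over a commutative ring, with `r k = (c k - z)⁻¹`. -/
noncomputable def cellMat {g : ℕ} (φ : ℝ →+* L) (z : L) (r : Fin g → L) (p q : Fin (g + 1) → ℝ) :
    Matrix (Fin 2) (Fin 2) L :=
  (List.ofFn fun k : Fin g => stepMat φ (r k) (p k.castSucc) (q k.castSucc)).prod *
    lastMat φ z (p (Fin.last g)) (q (Fin.last g))

theorem map_mul_map_inv (φ : ℝ →+* L) {x : ℝ} (hx : x ≠ 0) : φ x * φ x⁻¹ = 1 := by
  rw [← map_mul, mul_inv_cancel₀ hx, map_one]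

/-- The matrix `pqMat p q` has zero trace and zero determinant, so both corrections to the
determinant of the identity vanish. -/
theorem det_stepMat (φ : ℝ →+* L) (r : L) (p q : ℝ) : (stepMat φ r p q).det = 1 := by
  simp only [stepMat, pqMat, Matrix.det_fin_two, Matrix.sub_apply, Matrix.smul_apply,
    Matrix.map_apply, Matrix.one_apply_eq, smul_eq_mul]
  simp
  ring

theorem det_lastMat (φ : ℝ →+* L) (z : L) {p : ℝ} (hp : p ≠ 0) (q : ℝ) :
    (lastMat φ z p q).det = 1 := by
  simp [lastMat, Matrix.det_fin_two, map_mul_map_inv φ hp]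

theorem det_cellMat {g : ℕ} (φ : ℝ →+* L) (z : L) (r : Fin g → L) (p q : Fin (g + 1) → ℝ)
    (hp : p (Fin.last g) ≠ 0) : (cellMat φ z r p q).det = 1 := by
  rw [cellMat, Matrix.det_mul, det_lastMat φ z hp, mul_one]
  have : ∀ l : List (Matrix (Fin 2) (Fin 2) L), (∀ m ∈ l, m.det = 1) → l.prod.det = 1 := by
    intro l
    induction l with
    | nil => simp
    | cons a l ih =>
      intro h
      rw [List.prod_cons, Matrix.det_mul, h a (by simp), ih fun m hm => h m (by simp [hm]), mul_one]
  refine this _ fun m hm => ?_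
  obtain ⟨k, rfl⟩ := (List.mem_ofFn' _ _).mp hm
  exact det_stepMat _ _ _ _

end Transfer

/-- Partial fraction expansion of a product of factors `1 - (c_k - z)⁻¹ B_k`, with coefficients
which do not depend on the ring. -/
theorem exists_prod_eq_add_sum : ∀ {g : ℕ} (c : Fin g → ℝ), Function.Injective c →
    ∀ B : Fin g → Matrix (Fin 2) (Fin 2) ℝ, ∃ Q : Fin g → Matrix (Fin 2) (Fin 2) ℝ,
      ∀ (L : Type) [CommRing L] (φ : ℝ →+* L) (z : L) (r : Fin g → L),
        (∀ k, r k * (φ (c k) - z) = 1) →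
          (List.ofFn fun k => 1 - r k • (B k).map φ).prod = 1 + ∑ k, r k • (Q k).map φ
  | 0, _, _, _ => ⟨fun _ => 0, fun L _ φ z r _ => by simp⟩
  | g + 1, c, hc, B => by
    obtain ⟨Q, hQ⟩ := exists_prod_eq_add_sum (fun k : Fin g => c k.castSucc)
      (hc.comp (Fin.castSucc_injective g)) fun k => B k.castSucc
    set d : Fin g → ℝ := fun k => (c (Fin.last g) - c k.castSucc)⁻¹ with hd
    refine ⟨Fin.snoc (α := fun _ => Matrix (Fin 2) (Fin 2) ℝ)
      (fun k => Q k - d k • (Q k * B (Fin.last g)))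
      (-B (Fin.last g) + ∑ k, d k • (Q k * B (Fin.last g))), fun L _ φ z r hr => ?_⟩
    -- The resolvent identity; it splits the products created by the new factor into simple
    -- fractions.
    have hrr : ∀ k : Fin g, r k.castSucc * r (Fin.last g) =
        φ (d k) * (r k.castSucc - r (Fin.last g)) := fun k => by
      have hne : c (Fin.last g) - c k.castSucc ≠ 0 :=
        sub_ne_zero.mpr fun h => (Fin.castSucc_lt_last k).ne' (hc h)
      have h1 : φ (c (Fin.last g) - c k.castSucc) * φ (d k) = 1 := map_mul_map_inv φ hne
      rw [map_sub] at h1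
      have h2 := hr k.castSucc
      have h3 := hr (Fin.last g)
      linear_combination (-(r k.castSucc * r (Fin.last g))) * h1 +
        φ (d k) * r k.castSucc * h3 - φ (d k) * r (Fin.last g) * h2
    rw [List.ofFn_succ', List.concat_eq_append, List.prod_append, List.prod_singleton,
      hQ L φ z (fun k => r k.castSucc) fun k => hr _, Fin.sum_univ_castSucc]
    simp only [Fin.snoc_castSucc, Fin.snoc_last]
    ext i j
    simp only [mul_sub, mul_one, add_mul, one_mul, Finset.sum_mul, Matrix.add_apply,
      Matrix.sub_apply, Matrix.sum_apply, Matrix.smul_apply, Matrix.map_apply, smul_eq_mul,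
      Matrix.mul_smul, Matrix.smul_mul, map_add, map_sub, map_neg, map_sum, map_mul,
      Matrix.neg_apply]
    have hmul : ∀ k : Fin g, (((Q k).map φ) * ((B (Fin.last g)).map φ)) i j =
        φ ((Q k * B (Fin.last g)) i j) := fun k => by
      rw [← Matrix.map_mul, Matrix.map_apply]
    simp only [hmul, Finset.mul_sum, mul_add, Finset.sum_sub_distrib, mul_neg]
    have hsum : ∀ F : Fin g → L, ∑ k, r (Fin.last g) * (r k.castSucc * F k) =
        ∑ k, r k.castSucc * (φ (d k) * F k) - ∑ k, r (Fin.last g) * (φ (d k) * F k) := fun F => by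
      rw [← Finset.sum_sub_distrib]
      refine Finset.sum_congr rfl fun k _ => ?_
      linear_combination F k * hrr k
    rw [hsum]
    ring

/-- Partial fraction expansion of the discriminant. -/
theorem exists_trace_cellMat {g : ℕ} (c : Fin g → ℝ) (hc : Function.Injective c)
    (p q : Fin (g + 1) → ℝ) : ∃ (β : ℝ) (ν : Fin g → ℝ),
      ∀ (L : Type) [CommRing L] (φ : ℝ →+* L) (z : L) (r : Fin g → L),
        (∀ k, r k * (φ (c k) - z) = 1) →
          (cellMat φ z r p q).trace =
            φ (p (Fin.last g))⁻¹ * z + φ β + ∑ k, φ (ν k) * r k := by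
  obtain ⟨Q, hQ⟩ := exists_prod_eq_add_sum c hc fun k => pqMat (p k.castSucc) (q k.castSucc)
  set P := p (Fin.last g)
  set R := q (Fin.last g)
  refine ⟨-(P⁻¹ * (P * R)) - ∑ k, Q k 1 1 * P⁻¹,
    fun k => Q k 0 1 * P⁻¹ - Q k 1 0 * P + Q k 1 1 * (P⁻¹ * (c k - P * R)),
    fun L _ φ z r hr => ?_⟩
  -- The last factor contains `z`; this relation moves `r k * z` back into the expansion, and its
  -- `-1` produces the sum in `β`.
  have hrz : ∀ k, r k * z = φ (c k) * r k - 1 := fun k => by linear_combination -hr k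
  have h := hQ L φ z r hr
  simp only [cellMat, stepMat]
  rw [h, Matrix.trace_fin_two, Matrix.mul_apply, Matrix.mul_apply, Fin.sum_univ_two,
    Fin.sum_univ_two]
  simp only [lastMat, Matrix.add_apply, Matrix.sum_apply, Matrix.smul_apply, Matrix.map_apply,
    smul_eq_mul, Matrix.of_apply, Matrix.cons_val', Matrix.cons_val_zero, Matrix.cons_val_one,
    Matrix.one_apply_eq, Matrix.one_apply_ne, ne_eq, zero_ne_one, one_ne_zero,
    not_false_eq_true, mul_zero, zero_add, map_sub, map_neg, map_mul, map_sum, map_add,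
    Matrix.cons_val_fin_one, P, R]
  have hk : ∑ k, (φ (Q k 0 1) * φ (p (Fin.last g))⁻¹ - φ (Q k 1 0) * φ (p (Fin.last g)) +
      φ (Q k 1 1) * (φ (p (Fin.last g))⁻¹ * (φ (c k) - φ (p (Fin.last g)) * φ (q (Fin.last g))))) *
        r k = ∑ k, r k * φ (Q k 0 1) * φ (p (Fin.last g))⁻¹ -
          ∑ k, r k * φ (Q k 1 0) * φ (p (Fin.last g)) +
          (∑ k, r k * φ (Q k 1 1) * (φ (p (Fin.last g))⁻¹ *
            (z - φ (p (Fin.last g)) * φ (q (Fin.last g)))) +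
            ∑ k, φ (Q k 1 1) * φ (p (Fin.last g))⁻¹) := by
    rw [← Finset.sum_add_distrib, ← Finset.sum_sub_distrib, ← Finset.sum_add_distrib]
    refine Finset.sum_congr rfl fun k _ => ?_
    linear_combination -(φ (Q k 1 1) * φ (p (Fin.last g))⁻¹) * hrz k
  rw [hk]
  simp only [Finset.sum_mul, add_mul, one_mul]
  simp only [mul_neg, Finset.sum_neg_distrib]
  ring

/-! ### Solutions in a cell -/

section Cell

open scoped Matrix.Module

variable {g : ℕ} {L M : Type*} [CommRing L] [AddCommGroup M] [Module L M]

theorem eq_prod_smul {G S : Type*} [Monoid G] [MulAction G S] :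
    ∀ {g : ℕ} (a : Fin g → G) (y : Fin (g + 1) → S), (∀ i, y i.castSucc = a i • y i.succ) →
      y 0 = (List.ofFn a).prod • y (Fin.last g)
  | 0, a, y, _ => by simp
  | g + 1, a, y, h => by
    have ih := eq_prod_smul (fun i : Fin g => a i.succ) (fun i => y i.succ) fun i => by
      simpa using h i.succ
    rw [List.ofFn_succ, List.prod_cons, mul_smul, Fin.succ_last] at *
    rw [← Fin.castSucc_zero, h 0]
    exact congrArg _ ih

theorem exists_eq_smul {G S : Type*} [Monoid G] [MulAction G S] :
    ∀ {g : ℕ} (a : Fin g → G) (v : S), ∃ y : Fin (g + 1) → S,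
      y (Fin.last g) = v ∧ ∀ i, y i.castSucc = a i • y i.succ
  | 0, a, v => ⟨fun _ => v, rfl, fun i => i.elim0⟩
  | g + 1, a, v => by
    obtain ⟨y, hy, h⟩ := exists_eq_smul (fun i : Fin g => a i.succ) v
    refine ⟨Fin.cons (α := fun _ => S) (a 0 • y 0) y, ?_, fun i => ?_⟩
    · rw [← Fin.succ_last, Fin.cons_succ, hy]
    · induction i using Fin.cases with
      | zero => simp
      | succ i => rw [← Fin.succ_castSucc, Fin.cons_succ, Fin.cons_succ, h i]

/-- The lower partial sums `t' e_g + ∑_{a < i} q_a e_a`. -/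
def lowSum (φ : ℝ →+* L) (t' : L) (q : Fin (g + 1) → ℝ) (e : Fin (g + 1) → M) (i : Fin (g + 1)) :
    M :=
  t' • e (Fin.last g) + ∑ a with a < i, φ (q a) • e a

/-- The upper partial sums `∑_{a ≥ i} p_a e_a`. -/
def highSum (φ : ℝ →+* L) (p : Fin (g + 1) → ℝ) (e : Fin (g + 1) → M) (i : Fin (g + 1)) : M :=
  ∑ a with i ≤ a, φ (p a) • e a

theorem lowSum_zero (φ : ℝ →+* L) (t' : L) (q : Fin (g + 1) → ℝ) (e : Fin (g + 1) → M) :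
    lowSum φ t' q e 0 = t' • e (Fin.last g) := by
  simp [lowSum]

theorem lowSum_succ (φ : ℝ →+* L) (t' : L) (q : Fin (g + 1) → ℝ) (e : Fin (g + 1) → M)
    (i : Fin g) : lowSum φ t' q e i.succ =
      lowSum φ t' q e i.castSucc + φ (q i.castSucc) • e i.castSucc := by
  have : (Finset.univ.filter fun a : Fin (g + 1) => a < i.succ) =
      insert i.castSucc (Finset.univ.filter fun a : Fin (g + 1) => a < i.castSucc) := by
    ext a
    simp [Fin.lt_def, Fin.ext_iff]
    lia
  rw [lowSum, lowSum, this, Finset.sum_insert (by simp)]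
  abel

theorem highSum_castSucc (φ : ℝ →+* L) (p : Fin (g + 1) → ℝ) (e : Fin (g + 1) → M)
    (i : Fin g) : highSum φ p e i.castSucc =
      highSum φ p e i.succ + φ (p i.castSucc) • e i.castSucc := by
  have : (Finset.univ.filter fun a : Fin (g + 1) => i.castSucc ≤ a) =
      insert i.castSucc (Finset.univ.filter fun a : Fin (g + 1) => i.succ ≤ a) := by
    ext a
    simp [Fin.le_def, Fin.ext_iff]
    lia
  rw [highSum, highSum, this, Finset.sum_insert (by simp [Fin.le_def]), add_comm]

theorem highSum_last (φ : ℝ →+* L) (p : Fin (g + 1) → ℝ) (e : Fin (g + 1) → M) :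
    highSum φ p e (Fin.last g) = φ (p (Fin.last g)) • e (Fin.last g) := by
  have : (Finset.univ.filter fun a : Fin (g + 1) => Fin.last g ≤ a) = {Fin.last g} := by
    ext a
    simp [Fin.last_le_iff]
  rw [highSum, this, Finset.sum_singleton]

/-- Both triangles of the block are parts of rank one matrices, so a column sees the other entries
only through two partial sums. The term from the preceding cell is absorbed into the lower one. -/
theorem sum_diagBlock (φ : ℝ →+* L) (c : Fin g → ℝ) (p q : Fin (g + 1) → ℝ) (t' : L)
    (e : Fin (g + 1) → M) (b : Fin (g + 1)) :
    ∑ a, φ (diagBlock c p q a b) • e a + φ (p b) • t' • e (Fin.last g) =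
      φ (p b) • lowSum φ t' q e b + φ (q b) • highSum φ p e b +
        φ (Fin.snoc (α := fun _ => ℝ) c 0 b) • e b := by
  have h1 : ∀ a, φ (diagBlock c p q a b) • e a =
      (if a < b then φ (p b) • φ (q a) • e a else 0) +
        (if b ≤ a then φ (q b) • φ (p a) • e a else 0) +
        (if a = b then φ (Fin.snoc (α := fun _ => ℝ) c 0 b) • e a else 0) := by
    intro a
    simp only [diagBlock, upperPart, lowerPart, Matrix.add_apply, Matrix.sub_apply,
      Matrix.vecMulVec_apply, Matrix.diagonal_apply]
    rcases lt_trichotomy a b with h | h | h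
    · simp [h, h.ne, not_le.mpr h, ← mul_smul, mul_comm]
    · subst h
      simp [← mul_smul, add_smul, mul_comm]
    · simp [h.le, h.ne', not_lt.mpr h.le, ← mul_smul, mul_comm]
  simp only [h1, Finset.sum_add_distrib, ← Finset.sum_filter, lowSum, highSum, smul_add,
    Finset.smul_sum, Finset.filter_eq', Finset.mem_univ, if_true, Finset.sum_singleton]
  abel

/-- The relation `z e_b = ∑ A_{a b} e_a` for the columns of a periodic matrix, when the shift by
one period acts as multiplication by `t`. -/
def IsCell (φ : ℝ →+* L) (c : Fin g → ℝ) (p q : Fin (g + 1) → ℝ) (z t t' : L)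
    (e : Fin (g + 1) → M) : Prop :=
  ∀ b, z • e b = ∑ a, φ (diagBlock c p q a b) • e a + φ (p b) • t' • e (Fin.last g) +
    if b = Fin.last g then t • ∑ a, φ (p a) • e a else 0

/-- The state of a solution. -/
def state (φ : ℝ →+* L) (t' : L) (p q : Fin (g + 1) → ℝ) (e : Fin (g + 1) → M)
    (i : Fin (g + 1)) : Fin 2 → M :=
  ![highSum φ p e i, -lowSum φ t' q e i]

theorem highSum_zero (φ : ℝ →+* L) (p : Fin (g + 1) → ℝ) (e : Fin (g + 1) → M) :
    highSum φ p e 0 = ∑ a, φ (p a) • e a := by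
  simp [highSum]

variable {φ : ℝ →+* L} {c : Fin g → ℝ} {p q : Fin (g + 1) → ℝ} {z t t' : L}
  {e : Fin (g + 1) → M} {r : Fin g → L}

/-- Columns other than the last do not reach the following cell, so the relation can be solved for
`e_k` by inverting `c_k - z`. -/
theorem IsCell.eq_castSucc (h : IsCell φ c p q z t t' e) (hr : ∀ k, r k * (φ (c k) - z) = 1)
    (k : Fin g) : e k.castSucc = -(r k • (φ (p k.castSucc) • lowSum φ t' q e k.castSucc +
      φ (q k.castSucc) • highSum φ p e k.castSucc)) := by
  have h1 := h k.castSucc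
  rw [sum_diagBlock, if_neg (Fin.castSucc_lt_last k).ne, add_zero, Fin.snoc_castSucc] at h1
  have h2 : φ (p k.castSucc) • lowSum φ t' q e k.castSucc +
      φ (q k.castSucc) • highSum φ p e k.castSucc = -((φ (c k) - z) • e k.castSucc) := by
    rw [sub_smul, h1]; abel
  rw [h2, smul_neg, neg_neg, ← mul_smul, hr, one_smul]

theorem IsCell.state_castSucc (h : IsCell φ c p q z t t' e)
    (hr : ∀ k, r k * (φ (c k) - z) = 1) (k : Fin g) :
    state φ t' p q e k.castSucc =
      stepMat φ (r k) (p k.castSucc) (q k.castSucc) • state φ t' p q e k.succ := by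
  have h0 := h.eq_castSucc hr k
  have h1 := lowSum_succ φ t' q e k
  have h2 := highSum_castSucc φ p e k
  set F := lowSum φ t' q e k.castSucc
  set F' := lowSum φ t' q e k.succ
  set H := highSum φ p e k.castSucc
  set H' := highSum φ p e k.succ
  set x := e k.castSucc
  -- Passing to the next partial sums changes the two terms by opposite multiples of `p q x`, so the
  -- same formula holds with `F'` and `H'`.
  have h3 : x = -(r k • (φ (p k.castSucc) • F' + φ (q k.castSucc) • H')) := by
    rw [h0, h1, h2]
    module
  ext i
  fin_cases i
  · simp only [state, stepMat, pqMat, Matrix.Module.smul_apply, Fin.sum_univ_two]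
    simp
    change H = _ • H' + -(_ • F')
    rw [h2, h3]
    module
  · simp only [state, stepMat, pqMat, Matrix.Module.smul_apply, Fin.sum_univ_two]
    simp
    change -F = -(_ • H') + -(_ • F')
    rw [← sub_eq_iff_eq_add.mpr h1, h3]
    module

/-- The last column couples to the following cell, whose initial state is `t` times the present one.
-/
theorem IsCell.state_last (h : IsCell φ c p q z t t' e) (hp : p (Fin.last g) ≠ 0)
    (htt : t * t' = 1) :
    state φ t' p q e (Fin.last g) =
      lastMat φ z (p (Fin.last g)) (q (Fin.last g)) • (t • state φ t' p q e 0) := by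
  have h1 := h (Fin.last g)
  rw [sum_diagBlock, if_pos rfl, Fin.snoc_last, map_zero, zero_smul, add_zero,
    ← highSum_zero] at h1
  have h2 := highSum_last φ p e
  have h3 := lowSum_zero φ t' q e
  have hpp := map_mul_map_inv φ hp
  set F := lowSum φ t' q e (Fin.last g)
  set H := highSum φ p e (Fin.last g)
  set H₀ := highSum φ p e 0
  set x := e (Fin.last g)
  have h4 : t • t' • x = x := by rw [← mul_smul, htt, one_smul]
  have h5 : -F = φ (p (Fin.last g))⁻¹ • (φ (q (Fin.last g)) • H + t • H₀ - z • x) := by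
    have : φ (q (Fin.last g)) • H + t • H₀ - z • x = -(φ (p (Fin.last g)) • F) := by
      rw [h1]; abel
    rw [this, smul_neg, ← mul_smul, mul_comm, hpp, one_smul]
  ext i
  fin_cases i
  · simp only [state, lastMat, Matrix.Module.smul_apply, Fin.sum_univ_two]
    simp
    change H = _
    rw [h2, h3, h4]
  · simp only [state, lastMat, Matrix.Module.smul_apply, Fin.sum_univ_two]
    simp
    change -F = φ (p (Fin.last g))⁻¹ • t • H₀ + _
    rw [h3, h4, h5, h2]
    module

theorem IsCell.state_zero (h : IsCell φ c p q z t t' e) (hp : p (Fin.last g) ≠ 0)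
    (htt : t * t' = 1) (hr : ∀ k, r k * (φ (c k) - z) = 1) :
    state φ t' p q e 0 = cellMat φ z r p q • (t • state φ t' p q e 0) := by
  rw [cellMat, mul_smul, ← h.state_last hp htt]
  exact eq_prod_smul _ _ (h.state_castSucc hr)

theorem sq_eq_trace_smul_sub (a : Matrix (Fin 2) (Fin 2) L) (ha : a.det = 1) :
    a * a = a.trace • a - 1 := by
  rw [Matrix.det_fin_two] at ha
  ext i j
  fin_cases i <;> fin_cases j <;>
    simp [Matrix.mul_apply, Fin.sum_univ_two, Matrix.trace_fin_two]
  · linear_combination -ha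
  · ring
  · ring
  · linear_combination -ha

/-- The initial state `y` satisfies `a y = t' y` for the transfer matrix `a`, and `a² = D a - 1`
then makes `D - t - t'` kill it. The steps are invertible, so all states are killed, and with them
the `e_b`. The argument is purely algebraic and needs no eigenvectors. -/
theorem IsCell.trace_sub_smul (h : IsCell φ c p q z t t' e) (hp : p (Fin.last g) ≠ 0)
    (htt : t * t' = 1) (hr : ∀ k, r k * (φ (c k) - z) = 1) (b : Fin (g + 1)) :
    ((cellMat φ z r p q).trace - t - t') • e b = 0 := by
  set D := (cellMat φ z r p q).trace with hD
  have hcomm : ∀ (a : Matrix (Fin 2) (Fin 2) L) (s : L) (y : Fin 2 → M),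
      a • s • y = s • a • y := fun a s y => by
    ext i
    simp only [Matrix.Module.smul_apply, Pi.smul_apply, Finset.smul_sum]
    exact Finset.sum_congr rfl fun j _ => smul_comm _ _ _
  have hassoc : ∀ (a : Matrix (Fin 2) (Fin 2) L) (s : L) (y : Fin 2 → M),
      (s • a) • y = s • a • y := fun a s y => by
    ext i
    simp only [Matrix.Module.smul_apply, Pi.smul_apply, Finset.smul_sum, Matrix.smul_apply,
      smul_eq_mul, mul_smul]
  have h0 : (D - t - t') • state φ t' p q e 0 = 0 := by
    set y := state φ t' p q e 0
    set a := cellMat φ z r p q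
    have h1 : y = t • a • y := by
      rw [← hcomm]
      exact h.state_zero hp htt hr
    have h2 : t' • y = a • y := by
      rw [h1, ← mul_smul, mul_comm, htt, one_smul, ← h1]
    have h3 : (a * a) • y = t' • t' • y := by rw [mul_smul, ← h2, hcomm, ← h2]
    rw [sq_eq_trace_smul_sub a (det_cellMat φ z r p q hp), sub_smul, hassoc, one_smul, ← h2] at h3
    have h4 : (D - t - t') • y = t • (D • t' • y - y - t' • t' • y) := by
      simp only [smul_sub, ← mul_smul]
      simp only [← sub_smul]
      congr 1
      linear_combination (t' - D) * htt
    rw [h4, h3, sub_self, smul_zero]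
  have hall : ∀ i, (D - t - t') • state φ t' p q e i = 0 := fun i => by
    induction i using Fin.induction with
    | zero => exact h0
    | succ k ih =>
      have h1 : state φ t' p q e k.succ =
          (stepMat φ (r k) (p k.castSucc) (q k.castSucc)).adjugate •
            state φ t' p q e k.castSucc := by
        rw [h.state_castSucc hr, ← mul_smul, Matrix.adjugate_mul, det_stepMat, one_smul, one_smul]
      rw [h1, ← hcomm, ih, smul_zero]
  have hF : ∀ i, (D - t - t') • lowSum φ t' q e i = 0 := fun i => by
    have := congrFun (hall i) 1
    simpa [state] using this
  have hH : ∀ i, (D - t - t') • highSum φ p e i = 0 := fun i => by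
    have := congrFun (hall i) 0
    simpa [state] using this
  induction b using Fin.lastCases with
  | last =>
    have := hF 0
    rw [lowSum_zero, smul_comm] at this
    have h2 := congrArg (t • ·) this
    simpa [← mul_smul, htt, ← mul_assoc] using h2
  | cast k =>
    rw [h.eq_castSucc hr k, smul_neg, smul_comm, smul_add, smul_comm _ (φ _), smul_comm _ (φ _),
      hF, hH]
    simp

end Cell

end GMP

namespace GMP

/-! ### Quasi-periodic solutions -/

section QuasiPeriodic

open scoped Matrix.Module

variable {g : ℕ} {K : Type*} [Field K] {φ : ℝ →+* K} {c : Fin g → ℝ} {p q : Fin (g + 1) → ℝ}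
  {z t t' : K} {r : Fin g → K}

theorem exists_smul_eq_of_trace_eq {a : Matrix (Fin 2) (Fin 2) K} (ha : a.det = 1)
    (htt : t * t' = 1) (htr : a.trace = t + t') : ∃ y : Fin 2 → K, y ≠ 0 ∧ a • (t • y) = y := by
  have hdet : (t • a - 1).det = 0 := by
    rw [Matrix.det_fin_two] at ha ⊢
    rw [Matrix.trace_fin_two] at htr
    simp
    linear_combination t ^ 2 * ha - t * htr - htt
  obtain ⟨y, hy, h⟩ := Matrix.exists_mulVec_eq_zero_iff.mpr hdet
  refine ⟨y, hy, ?_⟩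
  rw [Matrix.sub_mulVec, Matrix.one_mulVec, sub_eq_zero, Matrix.smul_mulVec] at h
  conv_rhs => rw [← h]
  ext i
  simp only [Matrix.Module.smul_apply, Pi.smul_apply, smul_eq_mul, Matrix.mulVec_eq_sum,
    Fin.sum_univ_two, Pi.add_apply, Matrix.transpose_apply, MulOpposite.smul_eq_mul_unop,
    MulOpposite.unop_op]
  ring

/-- If the discriminant at `z` equals `t + 1 / t`, there is a quasi-periodic solution. -/
theorem exists_isCell (hp : p (Fin.last g) ≠ 0) (htt : t * t' = 1)
    (hr : ∀ k, r k * (φ (c k) - z) = 1) (htr : (cellMat φ z r p q).trace = t + t') :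
    ∃ u : Fin (g + 1) → K, u ≠ 0 ∧ IsCell φ c p q z t t' u := by
  obtain ⟨y₀, hy₀, h₀⟩ := exists_smul_eq_of_trace_eq (det_cellMat φ z r p q hp) htt htr
  obtain ⟨y, hyl, hys⟩ := exists_eq_smul
    (fun k : Fin g => stepMat φ (r k) (p k.castSucc) (q k.castSucc))
    (lastMat φ z (p (Fin.last g)) (q (Fin.last g)) • (t • y₀))
  have hy0 : y 0 = y₀ := by
    rw [eq_prod_smul _ _ hys, hyl, ← mul_smul]
    exact h₀
  -- Components are recovered from the states: the inner ones by `IsCell.eq_castSucc`, the last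
  -- because the second entry of the initial state must be `-t' u_g`.
  set u : Fin (g + 1) → K := Fin.snoc (α := fun _ => K)
    (fun k => -(r k * (φ (q k.castSucc) * y k.succ 0 - φ (p k.castSucc) * y k.succ 1)))
    (-(t * y₀ 1)) with hu
  have hul : u (Fin.last g) = -(t * y₀ 1) := by simp [hu]
  have huc : ∀ k : Fin g, u k.castSucc =
      -(r k * (φ (q k.castSucc) * y k.succ 0 - φ (p k.castSucc) * y k.succ 1)) := fun k => by
    simp [hu]
  have hs0 : ∀ k : Fin g, y k.castSucc 0 = y k.succ 0 + φ (p k.castSucc) * u k.castSucc :=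
    fun k => by
      rw [hys k, huc]
      simp [stepMat, pqMat, Matrix.Module.smul_apply, Fin.sum_univ_two]
      ring
  have hs1 : ∀ k : Fin g, y k.castSucc 1 = y k.succ 1 + φ (q k.castSucc) * u k.castSucc :=
    fun k => by
      rw [hys k, huc]
      simp [stepMat, pqMat, Matrix.Module.smul_apply, Fin.sum_univ_two]
      ring
  have hl0 : y (Fin.last g) 0 = φ (p (Fin.last g)) * u (Fin.last g) := by
    rw [hyl, hul]
    simp [lastMat, Matrix.Module.smul_apply, Fin.sum_univ_two]
  have hl1 : φ (p (Fin.last g)) * y (Fin.last g) 1 =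
      t * y₀ 0 - (z - φ (p (Fin.last g)) * φ (q (Fin.last g))) * u (Fin.last g) := by
    rw [hyl, hul]
    simp [lastMat, Matrix.Module.smul_apply, Fin.sum_univ_two]
    have hp' : φ (p (Fin.last g)) ≠ 0 := fun h => hp ((map_eq_zero φ).mp h)
    field_simp
  have hlow : ∀ i, lowSum φ t' q u i = -y i 1 := fun i => by
    induction i using Fin.induction with
    | zero =>
      rw [lowSum_zero, hul, hy0, smul_eq_mul]
      linear_combination (-y₀ 1) * htt
    | succ k ih =>
      rw [lowSum_succ, ih, hs1, smul_eq_mul]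
      ring
  have hhigh : ∀ i, highSum φ p u i = y i 0 := fun i => by
    induction i using Fin.reverseInduction with
    | last => rw [highSum_last, hl0, smul_eq_mul]
    | cast k ih => rw [highSum_castSucc, ih, hs0, smul_eq_mul]
  refine ⟨u, fun h => hy₀ ?_, fun b => ?_⟩
  · ext i
    fin_cases i
    · change y₀ 0 = 0
      rw [← hy0, ← hhigh, highSum_zero, h]
      simp
    · change y₀ 1 = 0
      rw [← hy0, ← neg_eq_zero, ← hlow, lowSum_zero, h]
      simp
  · rw [sum_diagBlock, hlow, hhigh]
    induction b using Fin.lastCases with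
    | last =>
      rw [if_pos rfl, ← highSum_zero, hhigh, hy0, Fin.snoc_last, hl0, map_zero]
      simp only [smul_eq_mul]
      linear_combination hl1
    | cast k =>
      rw [if_neg (Fin.castSucc_lt_last k).ne, Fin.snoc_castSucc]
      have h2 := huc k
      simp only [smul_eq_mul]
      rw [hs0, hs1]
      linear_combination (φ (c k) - z) * (-1) * h2 + (φ (q k.castSucc) * y k.succ 0 -
        φ (p k.castSucc) * y k.succ 1) * hr k

end QuasiPeriodic

/-! ### The shift and the standard basis -/

/-- The standard basis of `ℓ²(ℤ)`. -/
noncomputable def basisVec (n : ℤ) : Ell2 := lp.single 2 n (1 : ℂ)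

theorem basisVec_apply (n m : ℤ) : basisVec n m = if m = n then 1 else 0 := by
  rw [basisVec, lp.single_apply, Pi.single_apply]

theorem toMatrix_apply (A : Op) (m n : ℤ) : toMatrix A m n = A (basisVec n) m := rfl

theorem op_ext {A B : Op} (h : ∀ n, A (basisVec n) = B (basisVec n)) : A = B := by
  ext1 x
  have hx := lp.hasSum_single (p := 2) (by simp) x
  have hsm : ∀ n : ℤ, lp.single 2 n (x n) = x n • basisVec n := fun n => by
    rw [basisVec, ← lp.single_smul, smul_eq_mul, mul_one]
  have h1 := A.hasSum hx
  have h2 := B.hasSum hx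
  simp only [hsm, map_smul, h] at h1 h2
  exact h1.unique h2

theorem memℓp_shift (k : ℤ) (x : Ell2) : Memℓp (fun n : ℤ => x (n - k)) 2 := by
  have h2 : 0 < (2 : ENNReal).toReal := by norm_num
  have := (memℓp_gen_iff h2).mp (lp.memℓp x)
  exact (memℓp_gen_iff h2).mpr ((Equiv.subRight k).summable_iff.mpr this)

/-- The operator `e_n ↦ e_{n + k}`, as an isometry. -/
noncomputable def shiftIsometry (k : ℤ) : Ell2 ≃ₗᵢ[ℂ] Ell2 where
  toFun x := ⟨fun n => x (n - k), memℓp_shift k x⟩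
  map_add' x y := rfl
  map_smul' a x := rfl
  invFun x := ⟨fun n => x (n - -k), memℓp_shift (-k) x⟩
  left_inv x := by ext n; simp
  right_inv x := by ext n; simp
  norm_map' x := by
    have h2 : 0 < (2 : ENNReal).toReal := by norm_num
    rw [lp.norm_eq_tsum_rpow h2, lp.norm_eq_tsum_rpow h2]
    congr 1
    exact (Equiv.subRight k).tsum_eq fun n => ‖x n‖ ^ (2 : ENNReal).toReal

/-- The operator `e_n ↦ e_{n + k}`. -/
noncomputable def shiftOp (k : ℤ) : Op :=
  (shiftIsometry k).toContinuousLinearEquiv.toContinuousLinearMap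

theorem shiftOp_apply (k : ℤ) (x : Ell2) (n : ℤ) : shiftOp k x n = x (n - k) := rfl

theorem shiftOp_basisVec (k n : ℤ) : shiftOp k (basisVec n) = basisVec (n + k) := by
  ext m
  rw [shiftOp_apply, basisVec_apply, basisVec_apply]
  exact if_congr sub_eq_iff_eq_add rfl rfl

theorem shiftOp_mul_neg (k : ℤ) : shiftOp k * shiftOp (-k) = 1 := by
  refine op_ext fun n => ?_
  rw [mul_apply_eq_comp, shiftOp_basisVec, shiftOp_basisVec, neg_add_cancel_right]
  rfl

theorem norm_eq_one_of_mem_spectrum_shiftOp {k : ℤ} {w : ℂ} (hw : w ∈ spectrum ℂ (shiftOp k)) :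
    ‖w‖ = 1 := by
  have h : shiftOp k ∈ unitary Op := by
    have := (Unitary.linearIsometryEquiv.symm (shiftIsometry k)).2
    exact this
  simpa using spectrum.subset_circle_of_unitary h hw

theorem tendsto_cofinite (x : Ell2) : Tendsto (fun n => ‖x n‖) cofinite (𝓝 0) := by
  have h2 : 0 < (2 : ENNReal).toReal := by norm_num
  have h := ((memℓp_gen_iff h2).mp (lp.memℓp x)).tendsto_cofinite_zero
  have h3 := (Real.continuous_sqrt.tendsto 0).comp h
  rw [Real.sqrt_zero] at h3
  refine h3.congr fun n => ?_
  simp [Real.sqrt_sq]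

instance : Nontrivial Op := by
  refine ⟨⟨1, 0, fun h => ?_⟩⟩
  have h1 := congrArg (fun B : Op => B (basisVec 0) 0) h
  have h2 : basisVec 0 0 = 0 := h1
  rw [basisVec_apply, if_pos rfl] at h2
  exact one_ne_zero h2

end GMP

namespace GMP

open Complex

/-! ### Periodic operators -/

section Periodic

variable {g : ℕ}

/-- The basis vector with index `b` in the `j`-th block. -/
noncomputable def cellVec (j : ℤ) (b : Fin (g + 1)) : Ell2 :=
  basisVec (((g + 1 : ℕ) : ℤ) * j + (b : ℕ))

theorem exists_cell_index (g : ℕ) (n : ℤ) :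
    ∃ (j : ℤ) (b : Fin (g + 1)), n = ((g + 1 : ℕ) : ℤ) * j + (b : ℕ) := by
  have hd : (0 : ℤ) < ((g + 1 : ℕ) : ℤ) := by positivity
  have h0 := Int.emod_nonneg n hd.ne'
  refine ⟨n / ((g + 1 : ℕ) : ℤ), ⟨(n % ((g + 1 : ℕ) : ℤ)).toNat, ?_⟩, ?_⟩
  · have := Int.emod_lt_of_pos n hd
    lia
  · rw [Fin.val_mk, Int.toNat_of_nonneg h0]
    exact (Int.mul_ediv_add_emod n _).symm

theorem cell_index_inj {i j : ℤ} {a b : Fin (g + 1)} :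
    ((g + 1 : ℕ) : ℤ) * i + (a : ℕ) = ((g + 1 : ℕ) : ℤ) * j + (b : ℕ) ↔ i = j ∧ a = b := by
  refine ⟨fun h => ?_, fun h => by rw [h.1, h.2]⟩
  have ha : ((a : ℕ) : ℤ) < ((g + 1 : ℕ) : ℤ) := by exact_mod_cast a.2
  have hb : ((b : ℕ) : ℤ) < ((g + 1 : ℕ) : ℤ) := by exact_mod_cast b.2
  have hij : i = j := by
    rcases lt_trichotomy i j with hlt | heq | hlt
    · nlinarith
    · exact heq
    · nlinarith
  subst hij
  exact ⟨rfl, Fin.ext (by lia)⟩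

theorem cellVec_apply (i j : ℤ) (a b : Fin (g + 1)) :
    (cellVec j b : Ell2) (((g + 1 : ℕ) : ℤ) * i + (a : ℕ)) = if i = j ∧ a = b then 1 else 0 := by
  rw [cellVec, basisVec_apply]
  exact if_congr cell_index_inj rfl rfl

theorem op_ext_cell {A B : Op} (h : ∀ (j : ℤ) (b : Fin (g + 1)),
    A (cellVec j b) = B (cellVec j b)) : A = B := by
  refine op_ext fun n => ?_
  obtain ⟨j, b, rfl⟩ := exists_cell_index g n
  exact h j b

theorem block_toMatrix (A : Op) (i j : ℤ) (a b : Fin (g + 1)) :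
    A (cellVec j b) (((g + 1 : ℕ) : ℤ) * i + (a : ℕ)) = block (g + 1) (toMatrix A) i j a b := rfl

/-- The shift by one period. -/
noncomputable def periodShift (g : ℕ) : Op := shiftOp ((g + 1 : ℕ) : ℤ)

/-- The inverse shift by one period. -/
noncomputable def periodShiftInv (g : ℕ) : Op := shiftOp (-((g + 1 : ℕ) : ℤ))

theorem periodShift_mul_inv : periodShift g * periodShiftInv g = 1 := shiftOp_mul_neg _

theorem periodShiftInv_mul : periodShiftInv g * periodShift g = 1 := by
  have := shiftOp_mul_neg (-((g + 1 : ℕ) : ℤ))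
  rwa [neg_neg] at this

theorem periodShift_cellVec (j : ℤ) (b : Fin (g + 1)) :
    periodShift g (cellVec j b) = cellVec (j + 1) b := by
  rw [periodShift, cellVec, shiftOp_basisVec, cellVec]
  congr 1
  ring

theorem periodShiftInv_cellVec (j : ℤ) (b : Fin (g + 1)) :
    periodShiftInv g (cellVec j b) = cellVec (j - 1) b := by
  rw [periodShiftInv, cellVec, shiftOp_basisVec, cellVec]
  congr 1
  ring

theorem offBlock_apply (p : Fin (g + 1) → ℝ) (a b : Fin (g + 1)) :
    offBlock p a b = if a = Fin.last g then p b else 0 := by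
  rw [offBlock, Matrix.vecMulVec_apply, Pi.single_apply, ite_mul, one_mul, zero_mul]

theorem coe_sum_smul (x : Fin (g + 1) → ℂ) (v : Fin (g + 1) → Ell2) (n : ℤ) :
    (∑ a, x a • v a : Ell2) n = ∑ a, x a * v a n := by
  rw [lp.coeFn_sum, Finset.sum_apply]
  rfl

variable {c : Fin g → ℝ} {p q : Fin (g + 1) → ℝ} {A : Op}

/-- With the shift in place of `t`, this is exactly the relation `IsCell`: the previous cell is met
only in its last entry, the next one only from a last column. -/
theorem IsPeriodicWith.apply_cellVec (h : IsPeriodicWith c p q A) (j : ℤ) (b : Fin (g + 1)) :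
    A (cellVec j b) = ∑ a, (diagBlock c p q a b : ℂ) • cellVec j a +
      (p b : ℂ) • cellVec (j - 1) (Fin.last g) +
        if b = Fin.last g then ∑ a, (p a : ℂ) • cellVec (j + 1) a else 0 := by
  ext n
  obtain ⟨i, a, rfl⟩ := exists_cell_index g n
  rw [block_toMatrix]
  have hR : (∑ a, (diagBlock c p q a b : ℂ) • cellVec j a +
      (p b : ℂ) • cellVec (j - 1) (Fin.last g) +
        if b = Fin.last g then ∑ a, (p a : ℂ) • cellVec (j + 1) a else 0 : Ell2)
          (((g + 1 : ℕ) : ℤ) * i + (a : ℕ)) =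
      (if i = j then (diagBlock c p q a b : ℂ) else 0) +
        (if i = j - 1 then (offBlock p a b : ℂ) else 0) +
          (if i = j + 1 then (offBlock p b a : ℂ) else 0) := by
    rw [lp.coeFn_add, lp.coeFn_add, Pi.add_apply, Pi.add_apply, coe_sum_smul, lp.coeFn_smul,
      Pi.smul_apply, cellVec_apply, smul_eq_mul, offBlock_apply, offBlock_apply]
    congr 1
    · congr 1
      · simp only [cellVec_apply, mul_ite, mul_one, mul_zero]
        by_cases hij : i = j <;> simp [hij]
      · by_cases hij : i = j - 1 <;> by_cases ha : a = Fin.last g <;> simp [hij, ha]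
    · by_cases hb : b = Fin.last g
      · rw [if_pos hb, coe_sum_smul]
        simp only [cellVec_apply, mul_ite, mul_one, mul_zero]
        by_cases hij : i = j + 1 <;> simp [hij, hb]
      · simp [hb]
  rw [hR]
  by_cases h1 : i = j
  · subst h1
    rw [h.diag]
    simp
    lia
  by_cases h2 : i = j - 1
  · subst h2
    rw [h.upper]
    simp
    lia
  by_cases h3 : i = j + 1
  · subst h3
    have := h.lower (j + 1)
    rw [add_sub_cancel_right] at this
    rw [this]
    simp
    lia
  · rw [h.far i j (by rw [lt_abs]; lia)]
    simp [h1, h2, h3]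

theorem IsPeriodicWith.commute_shift (h : IsPeriodicWith c p q A) :
    Commute A (periodShift g) := by
  refine op_ext_cell (g := g) fun j b => ?_
  rw [mul_apply_eq_comp, mul_apply_eq_comp, periodShift_cellVec, h.apply_cellVec,
    h.apply_cellVec]
  simp only [map_add, map_sum, map_smul, periodShift_cellVec]
  rw [apply_ite (periodShift g), map_zero]
  simp only [map_sum, map_smul, periodShift_cellVec, sub_add_cancel, add_sub_cancel_right]

theorem commute_of_mul_eq_one {R : Type*} [Monoid R] {x a b : R} (h : Commute x a)
    (hab : a * b = 1) (hba : b * a = 1) : Commute x b := by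
  have : Commute x (Units.mk a b hab hba : R) := h
  exact this.units_inv_right

theorem commute_ringInverse {R : Type*} [Ring R] {x a : R} (h : Commute x a)
    (ha : IsUnit a) : Commute x (Ring.inverse a) :=
  commute_of_mul_eq_one h (Ring.mul_inverse_cancel a ha) (Ring.inverse_mul_cancel a ha)

/-- The resolvent `(c_k - A)⁻¹`. -/
noncomputable def res (c : Fin g → ℝ) (A : Op) (k : Fin g) : Op :=
  Ring.inverse (algebraMap ℂ Op (c k : ℂ) - A)

/-- The operator `α A + β + ∑ ν_k (c_k - A)⁻¹`. -/
noncomputable def pfOp (c : Fin g → ℝ) (α β : ℝ) (ν : Fin g → ℝ) (A : Op) : Op :=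
  algebraMap ℂ Op α * A + algebraMap ℂ Op β + ∑ k, algebraMap ℂ Op (ν k) * res c A k

/-- The magic formula: the discriminant of a periodic operator `A`, evaluated at `A`. -/
theorem IsPeriodicWith.pfOp_eq (h : IsPeriodicWith c p q A)
    (hu : ∀ k, IsUnit (algebraMap ℂ Op (c k : ℂ) - A)) {β : ℝ} {ν : Fin g → ℝ}
    (htr : ∀ (L : Type) [CommRing L] (φ : ℝ →+* L) (z : L) (r : Fin g → L),
      (∀ k, r k * (φ (c k) - z) = 1) →
        (cellMat φ z r p q).trace = φ (p (Fin.last g))⁻¹ * z + φ β + ∑ k, φ (ν k) * r k) :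
    pfOp c (p (Fin.last g))⁻¹ β ν A = periodShift g + periodShiftInv g := by
  set T := periodShift g with hT
  set T' := periodShiftInv g with hT'
  have hAT : Commute A T := h.commute_shift
  set s : Set Op := {A, T} with hs
  -- The double centralizer of the commuting pair `A`, `T` is commutative and contains `T⁻¹` and the
  -- resolvents, so the cell lemmas apply to `ℓ²(ℤ)` as a module over it.
  set S : Subalgebra ℂ Op := Subalgebra.centralizer ℂ (s.centralizer) with hS
  have hmem : ∀ X : Op, (∀ Y : Op, Commute Y A → Commute Y T → Commute Y X) → X ∈ S := by
    intro X hX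
    rw [hS, Subalgebra.mem_centralizer_iff]
    intro Y hY
    rw [Set.mem_centralizer_iff] at hY
    exact hX Y (hY A (by simp [hs])).symm (hY T (by simp [hs])).symm
  have hcomm : ∀ x ∈ S, ∀ y ∈ S, x * y = y * x := by
    intro x hx y hy
    refine Set.centralizer_centralizer_comm_of_comm (S := s) ?_ x hx y hy
    intro a ha b hb
    simp only [hs, Set.mem_insert_iff, Set.mem_singleton_iff] at ha hb
    rcases ha with rfl | rfl <;> rcases hb with rfl | rfl
    · rfl
    · exact hAT
    · exact hAT.symm
    · rfl
  have hAS : A ∈ S := hmem A fun _ hY _ => hY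
  have hTS : T ∈ S := hmem T fun _ _ hY => hY
  have hTS' : T' ∈ S := hmem T' fun _ _ hY =>
    commute_of_mul_eq_one hY periodShift_mul_inv periodShiftInv_mul
  have hRS : ∀ k, res c A k ∈ S := fun k => hmem _ fun Y hY _ =>
    commute_ringInverse ((Algebra.commute_algebraMap_right _ _).sub_right hY) (hu k)
  let _ : CommRing S := { (inferInstance : Ring S) with
    mul_comm := fun x y => Subtype.ext (hcomm x x.2 y y.2) }
  set φ : ℝ →+* S := (algebraMap ℂ S).comp ofRealHom with hφ
  have hφc : ∀ x : ℝ, ((φ x : S) : Op) = algebraMap ℂ Op x := fun x => rfl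
  have hsm : ∀ (x : S) (v : Ell2), x • v = (x : Op) v := fun x v => rfl
  have hcell : IsCell φ c p q (⟨A, hAS⟩ : S) ⟨T, hTS⟩ ⟨T', hTS'⟩
      (fun b : Fin (g + 1) => cellVec 0 b) := by
    intro b
    simp only [hsm, hφc, h.apply_cellVec, Algebra.algebraMap_eq_smul_one, map_sum,
      hT, hT', smul_apply, one_apply_eq_self, map_smul,
      periodShift_cellVec, periodShiftInv_cellVec]
  have hr : ∀ k, (⟨res c A k, hRS k⟩ : S) * (φ (c k) - ⟨A, hAS⟩) = 1 := fun k =>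
    Subtype.ext (Ring.inverse_mul_cancel _ (hu k))
  have hTT : (⟨T, hTS⟩ : S) * ⟨T', hTS'⟩ = 1 := Subtype.ext periodShift_mul_inv
  have hkill := hcell.trace_sub_smul (h.pos 0).ne' hTT hr
  rw [htr S φ ⟨A, hAS⟩ _ hr] at hkill
  set x : S := φ (p (Fin.last g))⁻¹ * ⟨A, hAS⟩ + φ β +
    ∑ k, φ (ν k) * ⟨res c A k, hRS k⟩ - ⟨T, hTS⟩ - ⟨T', hTS'⟩ with hx
  have hxv : (x : Op) = pfOp c (p (Fin.last g))⁻¹ β ν A - T - T' := by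
    simp only [hx, pfOp, AddSubgroupClass.coe_sub, Subalgebra.coe_add, Subalgebra.coe_mul, hφc,
      AddSubmonoidClass.coe_finsetSum]
  -- The cell lemma gives vanishing on cell `0`; commuting with the shifts carries it to all cells.
  have hx0 : (x : Op) = 0 := by
    refine op_ext_cell (g := g) fun j b => ?_
    rw [zero_apply]
    induction j using Int.induction_on with
    | zero => exact hkill b
    | succ j ih =>
      rw [← periodShift_cellVec, ← mul_apply_eq_comp, hcomm x x.2 T hTS, mul_apply_eq_comp, ih,
        map_zero]
    | pred j ih =>
      rw [← periodShiftInv_cellVec, ← mul_apply_eq_comp, hcomm x x.2 T' hTS', mul_apply_eq_comp,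
        ih, map_zero]
  rw [hxv, sub_sub, sub_eq_zero] at hx0
  exact hx0

end Periodic

end GMP

namespace GMP

open Complex ComplexConjugate

section Spectrum

variable {g : ℕ} {c : Fin g → ℝ} {p q : Fin (g + 1) → ℝ} {A : Op} {α β : ℝ} {ν : Fin g → ℝ}

/-! ### Positivity of the residues -/

/-- The upper off-diagonal blocks of the shifted resolvent have only a last row. Undoing the shift
by `j + 1` places that row at index `j` of a cell, so among the entries one period off the diagonal
only the `j`-th is nonzero, and it is a positive `p'_g`. -/
theorem toMatrix_res_apply (hA : IsGMP c A) (j : Fin g) :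
    0 < (toMatrix (res c A j) ((j : ℕ) : ℤ) (((g + 1 : ℕ) : ℤ) + (j : ℕ))).re ∧
      (toMatrix (res c A j) ((j : ℕ) : ℤ) (((g + 1 : ℕ) : ℤ) + (j : ℕ))).im = 0 ∧
      ∀ k : Fin g, k ≠ j →
        toMatrix (res c A j) ((k : ℕ) : ℤ) (((g + 1 : ℕ) : ℤ) + (k : ℕ)) = 0 := by
  obtain ⟨c', -, p', q', h⟩ := hA.resolvent j
  have key : ∀ (i : ℤ) (a : Fin (g + 1)), toMatrix (res c A j)
      (((g + 1 : ℕ) : ℤ) * (i - 1) + (a : ℕ) + ((j : ℕ) + 1))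
      (((g + 1 : ℕ) : ℤ) * i + (a : ℕ) + ((j : ℕ) + 1)) =
        (if a = Fin.last g then p' i a else 0 : ℝ) := fun i a => by
    have := congrFun (congrFun (h.upper i) a) a
    rw [Matrix.map_apply, offBlock_apply] at this
    exact this
  have hlast : toMatrix (res c A j) ((j : ℕ) : ℤ) (((g + 1 : ℕ) : ℤ) + (j : ℕ)) =
      (p' 0 (Fin.last g) : ℝ) := by
    have := key 0 (Fin.last g)
    rw [if_pos rfl] at this
    rw [← this]
    congr 1 <;> push_cast <;> simp <;> ring
  refine ⟨?_, ?_, fun k hk => ?_⟩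
  · rw [hlast, ofReal_re]
    exact h.pos 0
  · rw [hlast, ofReal_im]
  · have hkj : (k : ℕ) ≠ j := fun h => hk (Fin.ext h)
    have hkg := k.2
    have hjg := j.2
    -- After the shift, indices `k < j` fall into the same block as `j`, and indices `k > j` into
    -- the next one.
    rcases lt_or_gt_of_ne hkj with hlt | hlt
    · obtain ⟨a, ha⟩ : ∃ a : Fin (g + 1), ((a : ℕ) : ℤ) = g + (k : ℕ) - (j : ℕ) :=
        ⟨⟨g + (k : ℕ) - (j : ℕ), by omega⟩, by simp only; omega⟩
      have hne : a ≠ Fin.last g := fun h => by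
        rw [h, Fin.val_last] at ha
        omega
      have := key 0 a
      rw [if_neg hne, ofReal_zero, ha] at this
      rw [← this]
      congr 1 <;> push_cast <;> ring
    · obtain ⟨a, ha⟩ : ∃ a : Fin (g + 1), ((a : ℕ) : ℤ) = (k : ℕ) - (j : ℕ) - 1 :=
        ⟨⟨(k : ℕ) - (j : ℕ) - 1, by omega⟩, by simp only; omega⟩
      have hne : a ≠ Fin.last g := fun h => by
        rw [h, Fin.val_last] at ha
        omega
      have := key 1 a
      rw [if_neg hne, ofReal_zero, ha] at this
      rw [← this]
      congr 1 <;> push_cast <;> ring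

/-- In the magic formula, take the entry at index `k` in the row of cell 0 and the column of cell 1.
The shifts give 1, `A` and the constant give 0, and of the resolvents only the `k`-th contributes.
So `ν_k` times a positive number is 1. -/
theorem residue_pos (hA : IsGMP c A) (hper : IsPeriodicWith c p q A)
    (hmagic : pfOp c α β ν A = periodShift g + periodShiftInv g) (k : Fin g) : 0 < ν k := by
  have h1 := congrArg (fun B : Op => B (cellVec 1 k.castSucc)
    (((g + 1 : ℕ) : ℤ) * 0 + (k.castSucc : ℕ))) hmagic
  have hcell : (cellVec 1 k.castSucc : Ell2) = basisVec (((g + 1 : ℕ) : ℤ) + (k : ℕ)) := by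
    rw [cellVec, mul_one, Fin.val_castSucc]
  have hne : k.castSucc ≠ Fin.last g := (Fin.castSucc_lt_last k).ne
  have hAz : A (cellVec 1 k.castSucc) (((g + 1 : ℕ) : ℤ) * 0 + (k.castSucc : ℕ)) = 0 := by
    rw [block_toMatrix]
    have := congrFun (congrFun (hper.upper 1) k.castSucc) k.castSucc
    rw [sub_self, Matrix.map_apply, offBlock_apply, if_neg hne, ofReal_zero] at this
    exact this
  have hRz : ∀ j, res c A j (cellVec 1 k.castSucc)
      (((g + 1 : ℕ) : ℤ) * 0 + (k.castSucc : ℕ)) =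
        toMatrix (res c A j) ((k : ℕ) : ℤ) (((g + 1 : ℕ) : ℤ) + (k : ℕ)) := fun j => by
    rw [toMatrix_apply, hcell, mul_zero, zero_add, Fin.val_castSucc]
  have hsum : ∀ (f : Fin g → Op) (v : Ell2) (n : ℤ), ((∑ j, f j) v) n = ∑ j, (f j v) n := by
    intro f v n
    rw [sum_apply, lp.coeFn_sum, Finset.sum_apply]
  simp only [pfOp, Algebra.algebraMap_eq_smul_one, smul_mul_assoc, one_mul, add_apply,
    smul_apply, one_apply_eq_self, lp.coeFn_add, Pi.add_apply, hsum, lp.coeFn_smul, Pi.smul_apply,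
    smul_eq_mul, hAz, hRz, periodShift_cellVec, periodShiftInv_cellVec, cellVec_apply] at h1
  rw [Finset.sum_eq_single k (fun j _ hj => by
    rw [(toMatrix_res_apply hA j).2.2 k hj.symm, mul_zero]) (by simp)] at h1
  have h2 := congrArg re h1
  simp at h2
  have hpos := (toMatrix_res_apply hA k).1
  push_cast at hpos
  have : 0 < ν k * (toMatrix (res c A k) ((k : ℕ) : ℤ) ((g : ℤ) + 1 + (k : ℕ))).re := by
    rw [h2]; norm_num
  exact pos_of_mul_pos_left this hpos.le

/-! ### The spectrum of a periodic operator -/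

theorem exists_add_inv_eq (t : ℂ) : ∃ w : ℂ, w ≠ 0 ∧ w + w⁻¹ = t := by
  obtain ⟨s, hs⟩ := IsAlgClosed.exists_eq_mul_self (t ^ 2 - 4)
  have h1 : (t + s) / 2 * ((t - s) / 2) = 1 := by linear_combination (1 / 4) * hs
  refine ⟨(t + s) / 2, left_ne_zero_of_mul_eq_one h1, ?_⟩
  rw [inv_eq_of_mul_eq_one_right h1]
  ring

/-- Writing `t = w + 1/w`, the operator factors as `T⁻¹ (T - w) (T - 1/w)`. If `‖w‖ = 1`, then `t =
2 Re w` lies in `[-2, 2]`; otherwise neither root is in the spectrum of the unitary `T`. -/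
theorem isUnit_shift_sub {t : ℂ} (ht : ∀ s ∈ Set.Icc (-2 : ℝ) 2, t ≠ s) :
    IsUnit (periodShift g + periodShiftInv g - algebraMap ℂ Op t) := by
  obtain ⟨w, hw, rfl⟩ := exists_add_inv_eq t
  have hnorm : ‖w‖ ≠ 1 := fun h1 => by
    have hwc : w⁻¹ = conj w := by
      rw [inv_def, normSq_eq_norm_sq, h1]
      simp
    refine ht (2 * w.re) ?_ ?_
    · have := abs_le.mp ((abs_re_le_norm w).trans h1.le)
      constructor <;> linarith
    · rw [hwc, add_conj]
  have hspec : ∀ v : ℂ, ‖v‖ ≠ 1 → IsUnit (periodShift g - algebraMap ℂ Op v) := fun v hv => by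
    have hns : v ∉ spectrum ℂ (periodShift g) := fun h => hv (norm_eq_one_of_mem_spectrum_shiftOp h)
    rw [spectrum.mem_iff, not_not] at hns
    rw [← neg_sub]
    exact hns.neg
  have hT' : IsUnit (periodShiftInv g) :=
    ⟨⟨periodShiftInv g, periodShift g, periodShiftInv_mul, periodShift_mul_inv⟩, rfl⟩
  have hprod : periodShift g + periodShiftInv g - algebraMap ℂ Op (w + w⁻¹) =
      periodShiftInv g * ((periodShift g - algebraMap ℂ Op w) *
        (periodShift g - algebraMap ℂ Op w⁻¹)) := by
    have h1 : (periodShift g - algebraMap ℂ Op w) * (periodShift g - algebraMap ℂ Op w⁻¹) =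
        periodShift g * periodShift g - periodShift g * algebraMap ℂ Op (w + w⁻¹) + 1 := by
      have h2 : algebraMap ℂ Op w * algebraMap ℂ Op w⁻¹ = 1 := by
        rw [← map_mul, mul_inv_cancel₀ hw, map_one]
      rw [sub_mul, mul_sub, mul_sub, h2, map_add, mul_add, Algebra.commutes w (periodShift g)]
      abel
    rw [h1, mul_add, mul_sub, ← mul_assoc, ← mul_assoc, periodShiftInv_mul, one_mul, one_mul,
      mul_one]
    abel
  rw [hprod]
  refine hT'.mul ((hspec w hnorm).mul (hspec w⁻¹ ?_))
  rw [norm_inv]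
  exact fun h => hnorm (inv_eq_one.mp h)

/-- The difference `D(A) - D(z)` is divisible by `A - z`, with a commuting quotient `Y`, so its
invertibility passes to `A - z`. -/
theorem isUnit_sub_of_pfOp (hu : ∀ k, IsUnit (algebraMap ℂ Op (c k : ℂ) - A))
    (hmagic : pfOp c α β ν A = periodShift g + periodShiftInv g) {z : ℂ} (hz : ∀ k, z ≠ c k)
    (ht : ∀ s ∈ Set.Icc (-2 : ℝ) 2, pfFun c α β ν z ≠ s) :
    IsUnit (algebraMap ℂ Op z - A) := by
  have h1 := isUnit_shift_sub (g := g) ht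
  rw [← hmagic] at h1
  have hcA : ∀ k, Commute (A - algebraMap ℂ Op z) (res c A k) := fun k =>
    commute_ringInverse ((Algebra.commute_algebraMap_right _ _).sub_right
      ((Commute.refl A).sub_left (Algebra.commute_algebraMap_left _ _))) (hu k)
  set Y : Op := algebraMap ℂ Op α +
    ∑ k, algebraMap ℂ Op (ν k * ((c k : ℂ) - z)⁻¹) * res c A k with hY
  have hcomm : Commute (A - algebraMap ℂ Op z) Y :=
    (Algebra.commute_algebraMap_right _ _).add_right (Commute.sum_right _ _ _ fun k _ =>
      (Algebra.commute_algebraMap_right _ _).mul_right (hcA k))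
  have hfac : pfOp c α β ν A - algebraMap ℂ Op (pfFun c α β ν z) =
      (A - algebraMap ℂ Op z) * Y := by
    have hk : ∀ k, algebraMap ℂ Op (ν k) * res c A k -
        algebraMap ℂ Op (ν k * ((c k : ℂ) - z)⁻¹) =
        (A - algebraMap ℂ Op z) * (algebraMap ℂ Op (ν k * ((c k : ℂ) - z)⁻¹) * res c A k) := by
      intro k
      have hcz : (c k : ℂ) - z ≠ 0 := sub_ne_zero.mpr (hz k).symm
      have h2 : (A - algebraMap ℂ Op z) * res c A k =
          algebraMap ℂ Op ((c k : ℂ) - z) * res c A k - 1 := by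
        have h3 : (algebraMap ℂ Op (c k : ℂ) - A) * res c A k = 1 :=
          Ring.mul_inverse_cancel _ (hu k)
        rw [sub_mul] at h3
        rw [map_sub, sub_mul, sub_mul, ← h3]
        abel
      rw [← mul_assoc, ← Algebra.commutes, mul_assoc, h2, mul_sub, mul_one, ← mul_assoc,
        ← map_mul, mul_assoc, inv_mul_cancel₀ hcz, mul_one]
    have h5 : (A - algebraMap ℂ Op z) * algebraMap ℂ Op (α : ℂ) =
        algebraMap ℂ Op (α : ℂ) * A - algebraMap ℂ Op (α : ℂ) * algebraMap ℂ Op z := by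
      rw [← Algebra.commutes (α : ℂ), mul_sub]
    rw [hY, mul_add, h5, Finset.mul_sum, ← Finset.sum_congr rfl fun k _ => hk k,
      Finset.sum_sub_distrib, pfOp, pfFun, map_add, map_add, map_sum, map_mul]
    abel
  rw [hfac, hcomm.isUnit_mul_iff] at h1
  rw [← neg_sub]
  exact h1.1.neg

theorem eq_zero_of_norm_const {s : ℕ → ℂ} (hs : ∀ n, ‖s (n + 1)‖ = ‖s n‖)
    (hlim : Tendsto (fun n => ‖s n‖) atTop (𝓝 0)) : s 0 = 0 := by
  have hconst : ∀ n, ‖s n‖ = ‖s 0‖ := fun n => by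
    induction n with
    | zero => rfl
    | succ n ih => rw [hs, ih]
  simp only [hconst] at hlim
  exact norm_eq_zero.mp (tendsto_nhds_unique tendsto_const_nhds hlim)

/-- A vector supported in one cell is not in the range of `T - w` for unimodular `w`. -/
theorem eq_zero_of_sum_cellVec_eq {u : Fin (g + 1) → ℂ} {w : ℂ} (hw : ‖w‖ = 1) {x : Ell2}
    (h : ∑ b, u b • cellVec 0 b = (periodShift g - algebraMap ℂ Op w) x) : u = 0 := by
  have hd : (0 : ℤ) < ((g + 1 : ℕ) : ℤ) := by positivity
  ext b
  -- Away from cell 0 this recurrence preserves modulus, so square summability makes `x` vanish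
  -- along both half lines, and `j = 0` then gives `u b = 0`.
  have key : ∀ j : ℤ, (if j = 0 then u b else 0) =
      x (((g + 1 : ℕ) : ℤ) * (j - 1) + (b : ℕ)) - w * x (((g + 1 : ℕ) : ℤ) * j + (b : ℕ)) := by
    intro j
    have h1 := congrArg (fun y : Ell2 => y (((g + 1 : ℕ) : ℤ) * j + (b : ℕ))) h
    simp only [coe_sum_smul, cellVec_apply, sub_apply, Algebra.algebraMap_eq_smul_one,
      smul_apply, one_apply_eq_self, lp.coeFn_sub, Pi.sub_apply, lp.coeFn_smul, Pi.smul_apply,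
      smul_eq_mul, periodShift, shiftOp_apply] at h1
    have h2 : ((g + 1 : ℕ) : ℤ) * j + (b : ℕ) - ((g + 1 : ℕ) : ℤ) =
        ((g + 1 : ℕ) : ℤ) * (j - 1) + (b : ℕ) := by ring
    rw [h2] at h1
    rw [← h1]
    by_cases hj : j = 0 <;> simp [hj]
  have hnorm : ∀ j : ℤ, j ≠ 0 → ‖x (((g + 1 : ℕ) : ℤ) * (j - 1) + (b : ℕ))‖ =
      ‖x (((g + 1 : ℕ) : ℤ) * j + (b : ℕ))‖ := fun j hj => by
    have := key j
    rw [if_neg hj] at this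
    exact (congrArg norm (sub_eq_zero.mp this.symm)).trans (by rw [norm_mul, hw, one_mul])
  have hlim : ∀ f : ℕ → ℤ, Function.Injective f →
      Tendsto (fun n => ‖x (((g + 1 : ℕ) : ℤ) * f n + (b : ℕ))‖) atTop (𝓝 0) := fun f hf => by
    have hinj : Function.Injective fun n => ((g + 1 : ℕ) : ℤ) * f n + (b : ℕ) := fun m n hmn =>
      hf (mul_left_cancel₀ hd.ne' (add_right_cancel hmn))
    have := (tendsto_cofinite x).comp hinj.tendsto_cofinite
    rwa [Nat.cofinite_eq_atTop] at this
  have h0 := eq_zero_of_norm_const (s := fun n : ℕ => x (((g + 1 : ℕ) : ℤ) * (n : ℤ) + (b : ℕ)))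
    (fun n => by
      have := hnorm ((n + 1 : ℕ) : ℤ) (by positivity)
      rw [show ((n + 1 : ℕ) : ℤ) - 1 = n by push_cast; ring] at this
      exact this.symm) (hlim _ Nat.cast_injective)
  have h1 := eq_zero_of_norm_const
    (s := fun n : ℕ => x (((g + 1 : ℕ) : ℤ) * (-1 - (n : ℤ)) + (b : ℕ)))
    (fun n => by
      have := hnorm (-1 - (n : ℤ)) (by lia)
      rw [show -1 - (n : ℤ) - 1 = -1 - ((n + 1 : ℕ) : ℤ) by push_cast; ring] at this
      exact this) (hlim _ fun m n hmn => by simpa using hmn)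
  have := key 0
  rw [if_pos rfl] at this
  simp only [Nat.cast_zero, sub_zero] at h0 h1
  rw [this, h0, zero_sub, h1]
  simp

theorem diagBlock_comm (c : Fin g → ℝ) (p q : Fin (g + 1) → ℝ) (a b : Fin (g + 1)) :
    diagBlock c p q a b = diagBlock c p q b a := by
  simp only [diagBlock, upperPart, lowerPart, Matrix.add_apply, Matrix.sub_apply,
    Matrix.vecMulVec_apply, Matrix.diagonal_apply]
  rcases lt_trichotomy a b with h | h | h
  · simp [h, h.ne, h.ne', not_lt.mpr h.le, mul_comm]
  · rw [h]
  · simp [h, h.ne, h.ne', not_lt.mpr h.le, mul_comm]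

/-- Truncate the Bloch solution to one cell, obtaining `v`. The truncation error `(A - z) v` has the
form `(T - w) x`. If `A - z` were invertible, `v` itself would lie in the range of `T - w`, which is
impossible for a nonzero vector in one cell. -/
theorem IsPeriodicWith.not_isUnit (h : IsPeriodicWith c p q A) {z w w' : ℂ} (hw : ‖w‖ = 1)
    (hww : w' * w = 1) {u : Fin (g + 1) → ℂ} (hu : u ≠ 0)
    (hcell : IsCell ofRealHom c p q z w' w u) : ¬ IsUnit (algebraMap ℂ Op z - A) := by
  intro hunit
  set T := periodShift g with hT
  set T' := periodShiftInv g with hT'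
  set v : Ell2 := ∑ b, u b • cellVec 0 b with hv
  set eg : Ell2 := cellVec 0 (Fin.last g) with heg
  set h₀ : Ell2 := ∑ a, (p a : ℂ) • cellVec 0 a with hh₀
  set s : ℂ := ∑ a, (p a : ℂ) * u a with hs
  have hAv : A v = z • v + u (Fin.last g) • (T h₀ - w • h₀) + s • (T' eg - w' • eg) := by
    have hAb : ∀ b, A (cellVec 0 b) = ∑ a, (diagBlock c p q a b : ℂ) • cellVec 0 a +
        (p b : ℂ) • T' eg + if b = Fin.last g then T h₀ else 0 := fun b => by
      rw [h.apply_cellVec, hh₀, heg, hT, hT', periodShiftInv_cellVec]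
      simp only [map_sum, map_smul, periodShift_cellVec]
    have hz : ∀ a, ∑ b, u b * (diagBlock c p q a b : ℂ) =
        z * u a - w * u (Fin.last g) * p a - if a = Fin.last g then w' * s else 0 := fun a => by
      have := hcell a
      simp only [smul_eq_mul, ofRealHom_eq_coe, ← hs] at this
      rw [this]
      have h2 : ∑ b, u b * (diagBlock c p q a b : ℂ) = ∑ b, (diagBlock c p q b a : ℂ) * u b :=
        Finset.sum_congr rfl fun b _ => by rw [diagBlock_comm, mul_comm]
      rw [h2]
      ring
    have h1 : ∑ b, u b • ∑ a, (diagBlock c p q a b : ℂ) • (cellVec 0 a : Ell2) =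
        z • v - (w * u (Fin.last g)) • h₀ - (w' * s) • eg := by
      simp only [Finset.smul_sum, ← mul_smul]
      rw [Finset.sum_comm]
      simp only [← Finset.sum_smul, hz, sub_smul, Finset.sum_sub_distrib, ite_smul, zero_smul,
        Finset.sum_ite_eq', Finset.mem_univ, if_true, hv, hh₀, Finset.smul_sum, ← mul_smul, heg]
    have h2 : ∑ b, u b • (p b : ℂ) • T' eg = s • T' eg := by
      rw [hs, Finset.sum_smul]
      exact Finset.sum_congr rfl fun b _ => by rw [← mul_smul, mul_comm]
    have h3 : ∑ b, u b • (if b = Fin.last g then T h₀ else 0) = u (Fin.last g) • T h₀ := by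
      simp
    rw [hv, map_sum]
    simp only [map_smul, hAb, smul_add, Finset.sum_add_distrib]
    rw [h1, h2, h3, ← hv]
    module
  -- Both boundary terms of `hAv` are divided by `T - w`: since `w' w = 1`, `T' eg - w' eg = -w' (T
  -- - w) T' eg`.
  set x : Ell2 := u (Fin.last g) • h₀ - (s * w') • T' eg with hx
  have hTx : (A - algebraMap ℂ Op z) v = (T - algebraMap ℂ Op w) x := by
    have hTT : T (T' eg) = eg := by
      rw [← mul_apply_eq_comp, periodShift_mul_inv, one_apply_eq_self]
    simp only [sub_apply, Algebra.algebraMap_eq_smul_one, smul_apply, one_apply_eq_self, hAv, hx,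
      map_sub, map_smul, hTT]
    have : (s * w' * w) • T' eg = s • T' eg := by rw [mul_assoc, hww, mul_one]
    rw [← sub_eq_zero] at this ⊢
    rw [← neg_eq_zero, ← this]
    module
  have hunit' : IsUnit (A - algebraMap ℂ Op z) := by
    rw [← neg_sub]
    exact hunit.neg
  have hcT : Commute (T - algebraMap ℂ Op w) (A - algebraMap ℂ Op z) :=
    (h.commute_shift.symm.sub_right (Algebra.commute_algebraMap_right _ _)).sub_left
      (Algebra.commute_algebraMap_left _ _)
  have hcY := commute_ringInverse hcT hunit'
  refine hu (eq_zero_of_sum_cellVec_eq hw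
    (x := Ring.inverse (A - algebraMap ℂ Op z) x) ?_)
  rw [← mul_apply_eq_comp, hcY.eq, mul_apply_eq_comp, ← hTx, ← mul_apply_eq_comp,
    Ring.inverse_mul_cancel _ hunit', one_apply_eq_self]

theorem exists_norm_one_add_inv {t : ℝ} (ht : t ∈ Set.Icc (-2 : ℝ) 2) :
    ∃ w : ℂ, ‖w‖ = 1 ∧ w⁻¹ + w = t := by
  refine ⟨exp ((Real.arccos (t / 2) : ℂ) * I), norm_exp_ofReal_mul_I _, ?_⟩
  rw [← exp_neg, ← neg_mul, add_comm, ← two_cos, ← ofReal_cos, Real.cos_arccos]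
  · push_cast; ring
  · linarith [ht.1]
  · linarith [ht.2]

/-- Outside the preimage of `[-2, 2]` the magic formula gives invertibility. Inside it, `D(z) = w +
1/w` with `‖w‖ = 1` yields a Bloch solution that rules it out. -/
theorem IsPeriodicWith.mem_spectrum_iff (h : IsPeriodicWith c p q A)
    (hu : ∀ k, IsUnit (algebraMap ℂ Op (c k : ℂ) - A))
    (htr : ∀ (L : Type) [CommRing L] (φ : ℝ →+* L) (z : L) (r : Fin g → L),
      (∀ k, r k * (φ (c k) - z) = 1) →
        (cellMat φ z r p q).trace = φ (p (Fin.last g))⁻¹ * z + φ β + ∑ k, φ (ν k) * r k)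
    (z : ℂ) : z ∈ spectrum ℂ A ↔ ∃ t ∈ Set.Icc (-2 : ℝ) 2, (pfDen c).eval z ≠ 0 ∧
      (pfNum c (p (Fin.last g))⁻¹ β ν).eval z = t * (pfDen c).eval z := by
  have hmagic := h.pfOp_eq hu htr
  rw [spectrum.mem_iff]
  constructor
  · intro hz
    have hzc : ∀ k, z ≠ c k := fun k hk => hz (hk ▸ hu k)
    have hden : (pfDen c).eval z ≠ 0 := fun h0 => by
      obtain ⟨k, hk⟩ := eval_pfDen_eq_zero_iff.mp h0
      exact hzc k hk
    by_contra! hcon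
    refine hz (isUnit_sub_of_pfOp hu hmagic hzc fun t ht htz => hcon t ht hden ?_)
    rw [eval_pfNum _ _ _ _ hden, htz]
  · rintro ⟨t, ht, hden, hN⟩
    have hzc : ∀ k, (c k : ℂ) - z ≠ 0 := fun k hk =>
      hden (eval_pfDen_eq_zero_iff.mpr ⟨k, (sub_eq_zero.mp hk).symm⟩)
    obtain ⟨w, hw, hwt⟩ := exists_norm_one_add_inv ht
    have hw0 : w ≠ 0 := fun h0 => by simp [h0] at hw
    have hr : ∀ k, ((c k : ℂ) - z)⁻¹ * (ofRealHom (c k) - z) = 1 := fun k =>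
      inv_mul_cancel₀ (hzc k)
    rw [eval_pfNum _ _ _ _ hden] at hN
    have hD : (cellMat ofRealHom z (fun k => ((c k : ℂ) - z)⁻¹) p q).trace = w⁻¹ + w := by
      rw [htr ℂ ofRealHom z _ hr, hwt, ← mul_right_cancel₀ hden hN, pfFun]
      rfl
    obtain ⟨u, hu0, hcell⟩ := exists_isCell (h.pos 0).ne' (inv_mul_cancel₀ hw0) hr hD
    exact h.not_isUnit hw (inv_mul_cancel₀ hw0) hu0 hcell

/-! ### Values of the discriminant and rational functions of the operator -/

/-- Every value is attained by a rational function with a pole at infinity. -/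
theorem exists_eval_pfNum_eq (hc : Function.Injective c) (hα : α ≠ 0) (hν : ∀ k, ν k ≠ 0)
    (t : ℂ) : ∃ z : ℂ, (pfDen c).eval z ≠ 0 ∧ (pfNum c α β ν).eval z = t * (pfDen c).eval z := by
  set Q := pfNum c α β ν - Polynomial.C t * pfDen c with hQ
  -- A nonzero constant is the only polynomial without a root; here it would force `D - t = κ / M`,
  -- which is incompatible with linear growth of `D` at infinity.
  by_cases hdeg : Q.degree = 0
  · exfalso
    obtain ⟨κ, hκ⟩ : ∃ κ, Q = Polynomial.C κ := ⟨_, Polynomial.eq_C_of_degree_eq_zero hdeg⟩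
    have hXM : 0 < (Polynomial.X * pfDen c).degree := by
      rw [Polynomial.degree_mul, Polynomial.degree_X]
      have : 0 ≤ (pfDen c).degree := Polynomial.zero_le_degree_iff.mpr (pfDen_ne_zero c)
      exact lt_of_lt_of_le zero_lt_one (le_add_of_nonneg_right this)
    have hinf : Tendsto (fun z => (Polynomial.X * pfDen c).eval z) (cocompact ℂ)
        (cocompact ℂ) := by
      rw [← Metric.cobounded_eq_cocompact, ← tendsto_norm_atTop_iff_cobounded]
      exact Polynomial.tendsto_norm_atTop _ hXM tendsto_norm_cobounded_atTop
    have h1 := (tendsto_inv_cocompact.comp hinf).const_mul κ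
    have h2 := (tendsto_inv_mul_pfFun c α β ν).sub (tendsto_inv_cocompact.mul_const t)
    rw [mul_zero] at h1
    rw [zero_mul, sub_zero] at h2
    have heq : (fun z => κ * ((fun z : ℂ => z⁻¹) ∘ fun z => (Polynomial.X * pfDen c).eval z) z)
        =ᶠ[cocompact ℂ] fun z => z⁻¹ * pfFun c α β ν z - z⁻¹ * t := by
      filter_upwards [eventually_eval_ne_zero (pfDen_ne_zero c), eventually_ne_zero_cocompact]
        with z hz hz0
      have h3 := congrArg (Polynomial.eval z) hκ
      simp only [hQ, Polynomial.eval_sub, Polynomial.eval_mul, Polynomial.eval_C] at h3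
      rw [eval_pfNum _ _ _ _ hz] at h3
      simp only [Function.comp_apply, Polynomial.eval_mul, Polynomial.eval_X]
      rw [← h3]
      field_simp
    exact hα (ofReal_eq_zero.mp (tendsto_nhds_unique h2 (h1.congr' heq)))
  · obtain ⟨z, hz⟩ := IsAlgClosed.exists_root Q hdeg
    have hz' : (pfNum c α β ν).eval z = t * (pfDen c).eval z := by
      simpa [hQ, Polynomial.IsRoot, sub_eq_zero] using hz
    refine ⟨z, fun h0 => eval_pfNum_ne_zero (α := α) (β := β) hc hν h0 ?_, hz'⟩
    rw [hz', h0, mul_zero]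

/-- The ring-independent expansion of the trace, taken in `RatFunc ℂ` at the variable. -/
theorem discriminant_eq (htr : ∀ (L : Type) [CommRing L] (φ : ℝ →+* L) (z : L) (r : Fin g → L),
      (∀ k, r k * (φ (c k) - z) = 1) →
        (cellMat φ z r p q).trace = φ (p (Fin.last g))⁻¹ * z + φ β + ∑ k, φ (ν k) * r k) :
    discriminant c p q =
      algebraMap (Polynomial ℂ) (RatFunc ℂ) (pfNum c (p (Fin.last g))⁻¹ β ν) /
        algebraMap (Polynomial ℂ) (RatFunc ℂ) (pfDen c) := by
  set φ : ℝ →+* RatFunc ℂ := (RatFunc.C).comp ofRealHom with hφ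
  have hφc : ∀ x : ℝ, φ x = RatFunc.C (x : ℂ) := fun x => rfl
  have hne : ∀ k, RatFunc.C (c k : ℂ) - RatFunc.X ≠ 0 := fun k h0 => by
    rw [← RatFunc.algebraMap_C, ← RatFunc.algebraMap_X, ← map_sub] at h0
    have h1 := (map_eq_zero_iff _ (RatFunc.algebraMap_injective ℂ)).mp h0
    have := congrArg (Polynomial.eval ((c k : ℂ) - 1)) h1
    simp at this
  have hr : ∀ k, 1 / (RatFunc.C (c k : ℂ) - RatFunc.X) * (φ (c k) - RatFunc.X) = 1 := fun k =>
    one_div_mul_cancel (hne k)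
  have hstep : ∀ (k : Fin g), factor (c k) (p k.castSucc) (q k.castSucc) =
      stepMat φ (1 / (RatFunc.C (c k : ℂ) - RatFunc.X)) (p k.castSucc) (q k.castSucc) := fun k => by
    rw [factor, stepMat]
    congr 2
    ext i j
    fin_cases i <;> fin_cases j <;>
      simp [pqMat, jMat, Matrix.mul_apply, Fin.sum_univ_two, hφc, mul_comm]
  have hlast : factorInf (p (Fin.last g)) (q (Fin.last g)) =
      lastMat φ RatFunc.X (p (Fin.last g)) (q (Fin.last g)) := by
    rw [factorInf, lastMat, map_inv₀]
    simp only [hφc, div_eq_inv_mul, mul_one]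
  have hcm : transferMatrix c p q =
      cellMat φ RatFunc.X (fun k => 1 / (RatFunc.C (c k : ℂ) - RatFunc.X)) p q := by
    simp only [transferMatrix, cellMat, hstep, hlast]
  rw [discriminant, hcm, htr _ φ RatFunc.X _ hr, eq_div_iff
    (RatFunc.algebraMap_ne_zero (pfDen_ne_zero c))]
  have := aeval_pfNum c (p (Fin.last g))⁻¹ β ν (L := RatFunc ℂ) (z := RatFunc.X) hr
  rw [RatFunc.aeval_X_left_eq_algebraMap, RatFunc.aeval_X_left_eq_algebraMap] at this
  exact this.symm

theorem isUnit_aeval_pfDen (hu : ∀ k, IsUnit (algebraMap ℂ Op (c k : ℂ) - A)) :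
    IsUnit (Polynomial.aeval A (pfDen c)) := by
  have : ∀ s : Finset (Fin g), IsUnit (Polynomial.aeval A
      (∏ k ∈ s, (Polynomial.C (c k : ℂ) - Polynomial.X))) := fun s => by
    induction s using Finset.induction_on with
    | empty => simp
    | insert k s hk ih =>
      rw [Finset.prod_insert hk, map_mul]
      refine IsUnit.mul ?_ ih
      simpa using hu k
  exact this _

theorem isDefinedAt_div {P Q : Polynomial ℂ} (hQ : IsUnit (Polynomial.aeval A Q)) :
    IsDefinedAt (algebraMap (Polynomial ℂ) (RatFunc ℂ) P /
      algebraMap (Polynomial ℂ) (RatFunc ℂ) Q) A := by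
  obtain ⟨R, hR⟩ := RatFunc.denom_div_dvd P Q
  rw [hR, map_mul, Commute.isUnit_mul_iff (by
    rw [Commute, SemiconjBy, ← map_mul, mul_comm, map_mul])] at hQ
  exact hQ.1

/-- Rational functions which agree at an operator with infinite spectrum are equal. -/
theorem eq_of_evalOp_eq (hinf : (spectrum ℂ A).Infinite) {f₁ f₂ : RatFunc ℂ}
    (h₁ : IsDefinedAt f₁ A) (h₂ : IsDefinedAt f₂ A) (h : evalOp f₁ A = evalOp f₂ A) : f₁ = f₂ := by
  have hc : ∀ P Q : Polynomial ℂ, Polynomial.aeval A P * Polynomial.aeval A Q =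
      Polynomial.aeval A Q * Polynomial.aeval A P := fun P Q => by
    rw [← map_mul, mul_comm, map_mul]
  have h3 : Polynomial.aeval A (f₁.num * f₂.denom - f₂.num * f₁.denom) = 0 := by
    rw [map_sub, map_mul, map_mul, sub_eq_zero]
    have h4 := congrArg (· * (Polynomial.aeval A f₁.denom * Polynomial.aeval A f₂.denom)) h
    simp only [evalOp] at h4
    rw [mul_assoc, ← mul_assoc (Ring.inverse _), Ring.inverse_mul_cancel _ h₁, one_mul, hc f₁.denom,
      mul_assoc, ← mul_assoc (Ring.inverse _), Ring.inverse_mul_cancel _ h₂, one_mul] at h4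
    exact h4
  have hP : f₁.num * f₂.denom - f₂.num * f₁.denom = 0 := by
    -- By spectral mapping, a polynomial annihilating `A` vanishes on the spectrum of `A`.
    refine Polynomial.eq_zero_of_infinite_isRoot _ (hinf.mono fun z hz => ?_)
    have h5 := spectrum.subset_polynomial_aeval A (f₁.num * f₂.denom - f₂.num * f₁.denom)
      ⟨z, hz, rfl⟩
    rw [h3, spectrum.zero_eq] at h5
    exact h5
  rw [← RatFunc.num_div_denom f₁, ← RatFunc.num_div_denom f₂, div_eq_div_iff
    (RatFunc.algebraMap_ne_zero f₁.denom_ne_zero) (RatFunc.algebraMap_ne_zero f₂.denom_ne_zero),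
    ← map_mul, ← map_mul, sub_eq_zero.mp hP]

end Spectrum

end GMP

/-! ### The equivalence -/

theorem mainTheorem11 {g : ℕ} (c : Fin g → ℝ) (hc : Function.Injective c)
    (E : Set ℝ) (hE : GMP.IsFiniteGapSet E)
    (A : GMP.Op) (hA : GMP.IsGMP c A)
    (p q : Fin (g + 1) → ℝ) (hper : GMP.IsPeriodicWith c p q A) :
    List.TFAE
      [A ∈ GMP.isospectralTorus E c,
        GMP.discriminant c p q = GMP.deltaE E,
        GMP.IsDefinedAt (GMP.discriminant c p q) A ∧ GMP.IsDefinedAt (GMP.deltaE E) A ∧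
          GMP.evalOp (GMP.discriminant c p q) A = GMP.evalOp (GMP.deltaE E) A] := by
  obtain ⟨β, ν, htr⟩ := GMP.exists_trace_cellMat c hc p q
  have hν : ∀ k, 0 < ν k := GMP.residue_pos hA hper (hper.pfOp_eq hA.isUnit htr)
  have hα : 0 < (p (Fin.last g))⁻¹ := inv_pos.mpr (hper.pos 0)
  have hspec := hper.mem_spectrum_iff hA.isUnit htr
  have hdisc := GMP.discriminant_eq htr
  have hdef : GMP.IsDefinedAt (GMP.discriminant c p q) A := by
    rw [hdisc]
    exact GMP.isDefinedAt_div (GMP.isUnit_aeval_pfDen hA.isUnit)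
  -- Each `t` in `[-2, 2]` is a value of the discriminant, at a point of the spectrum, and different
  -- values come from different points.
  have hinf : (spectrum ℂ A).Infinite := by
    have h := fun t : ℝ => GMP.exists_eval_pfNum_eq (β := β) hc hα.ne' (fun k => (hν k).ne') t
    choose z hz hzt using h
    refine Set.infinite_of_injOn_mapsTo (s := Set.Icc (-2 : ℝ) 2) (f := z) ?_ ?_
      (Set.Icc_infinite (by norm_num))
    · intro s _ t _ hst
      have h1 := hzt s
      rw [hst, hzt t] at h1
      exact (Complex.ofReal_injective (mul_right_cancel₀ (hz t) h1)).symm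
    · exact fun t ht => (hspec _).mpr ⟨t, ht, hz t, hzt t⟩
  tfae_have 1 → 2 := by
    rintro ⟨-, hsp, -⟩
    rw [hdisc]
    refine (GMP.deltaE_eq_pf hc hα hν hE.isCompact fun z => ?_).symm
    rw [← hspec, hsp]
  tfae_have 2 → 1 := by
    intro h
    refine ⟨hA, ?_, p, q, hper⟩
    ext z
    rw [hspec]
    exact (hE.mem_iff_of_deltaE_eq (GMP.pfDen_ne_zero c)
      (fun z hz => GMP.eval_pfNum_ne_zero hc (fun k => (hν k).ne') hz) (hdisc ▸ h) z).symm
  tfae_have 2 → 3 := fun h => ⟨hdef, h ▸ hdef, by rw [h]⟩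
  tfae_have 3 → 2 := fun ⟨h1, h2, h3⟩ => GMP.eq_of_evalOp_eq hinf h1 h2 h3
  tfae_finish
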